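/- Let $\Theta_1,\Theta_2\subset\mathbb R^3$ be disjoint, nonempty, compact convex sets with smooth boundary whose second fundamental form is bounded below by a positive constant, and let $\mathcal R=[a_1,a_2]$ be the periodic ray, i.e. the segment with $a_i\in\partial\Theta_i$ that meets both boundaries orthogonally from outside. Write $n$ for the outward unit normal, and let $e_j$ be the unit vector parallel to $\mathcal R$ pointing towards $a_j$. Fix $0<\delta_1<1$. Given a function $\varphi$ on a set $\mathcal U$, put $\Gamma_j(\varphi)=\{X\in\partial\Theta_j\cap\operatorname{int}\mathcal U:\ -n(X)\cdot\nabla\varphi(X)\ge\delta_1\}$ and, for $X\in\Gamma_j(\varphi)$, $\Xi(X)=\nabla\varphi(X)-2(n(X)\cdot\nabla\varphi(X))\,n(X)$. The phase $\varphi_j$ reflected on $\Theta_j$ is defined on $\mathcal U_j(\varphi)=\{X+\tau\,\Xi(X):X\in\Gamma_j(\varphi),\ \tau\ge0\}$ by $$\varphi_j(X+\tau\,\Xi(X))=\varphi(X)+\tau .$$ A story of reflections is a finite nonempty sequence $J=(j_1,\dots,j_n)$ in $\{1,2\}$ with $j_i\ne j_{i+1}$; $|J|=n$. For $y\in\mathbb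 R^3$ and $\xi\in\mathbb R^3\setminus\{0\}$ let $\varphi_J(\cdot,\xi)$ be the phase obtained from the plane phase $\varphi(x)=(x-y)\cdot\xi/|\xi|$ on $\mathbb R^3$ by reflecting successively on $\Theta_{j_1},\dots,\Theta_{j_n}$. Then there exist $\eta>0$ and an open cylinder $\mathcal U_\infty\supset\mathcal R$ with axis $\mathcal R$ (of some radius $r>0$, and prolonged by some length $\rho>0$ beyond both endpoints of $\mathcal R$) such that the following holds. For every $y$ and every story $J=(j_1,\dots,j_n)$, the defining relation of $\varphi_J(\cdot,\xi)$ is consistent whenever $\left|\xi/|\xi|-e_{j_1}\right|<\eta$, and $\varphi_J$ is defined on $\mathcal U_\infty$ for these $\xi$: $\mathcal U_\infty\setminus\operatorname{int}\Theta_{j_n}$ is contained in the domain of $\varphi_J(\cdot,\xi)$, and $\varphi_J$ extends from this set to a function on $\mathcal U_\infty$, still denoted $\varphi_J$, that is $C^\infty$ in $(x,\xi)\in\mathcal U_\infty\times\{\xi\neq0:|\xi/|\xi|-e_{j_1}|<\eta\}$ and satisfies $|\nabla_x\varphi_J|=1$ there. Moreover, for all $0<\alpha_0\le\beta_0$ and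 all multi-indices $\alpha,\beta\in\mathbb N^3$ there is a constant $D_{\alpha,\beta}>0$ such that, for all $y$, all stories $J$, all $x\in\mathcal U_\infty$ and all $\xi$ with $|\xi|\in[\alpha_0,\beta_0]$ and $\left|\xi/|\xi|-e_{j_1}\right|<\eta$, $$\left|D_\xi^\alpha D_x^\beta\nabla_x\varphi_J(x,\xi)\right|\le D_{\alpha,\beta}^{|J|}.$$ -/

import Mathlib

open scoped ContDiff

noncomputable section

/-- Euclidean space of dimension three. -/
abbrev E3 : Type := EuclideanSpace ℝ (Fin 3)

/-- A smooth, compact, strictly convex obstacle: a nonempty compact convex set of the form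
`{g ≤ 0}`, where `g` is smooth with nonvanishing gradient on the boundary `{g = 0}`, and whose
second fundamental form `D²g(v, v) / ‖∇g‖` (for `v` tangent to the boundary) is bounded below by
a positive constant. -/
def IsObstacle (Θ : Set E3) : Prop :=
  Θ.Nonempty ∧ IsCompact Θ ∧ Convex ℝ Θ ∧
    ∃ g : E3 → ℝ, ContDiff ℝ ∞ g ∧ Θ = {x | g x ≤ 0} ∧ (∀ x, g x = 0 → gradient g x ≠ 0) ∧
      ∃ c : ℝ, 0 < c ∧ ∀ x, g x = 0 → ∀ v : E3, inner ℝ (gradient g x) v = 0 →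
        c * ‖v‖ ^ 2 ≤ fderiv ℝ (fderiv ℝ g) x v v / ‖gradient g x‖

/-- `ν` is an outward unit normal at the boundary point `x` of the convex set `Θ`. -/
def IsOutwardUnitNormal (Θ : Set E3) (x ν : E3) : Prop :=
  ‖ν‖ = 1 ∧ x ∈ frontier Θ ∧ ∀ y ∈ Θ, inner ℝ ν (y - x) ≤ 0

/-- The other index in `Fin 2`. -/
def other (j : Fin 2) : Fin 2 := 1 - j

/-- The unit vector along the segment `[a 0, a 1]` that points towards `a j`. -/
def axisDir (a : Fin 2 → E3) (j : Fin 2) : E3 :=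
  ‖a j - a (other j)‖⁻¹ • (a j - a (other j))

/-- The segment `[a 0, a 1]` is the periodic ray of the obstacles `Θ 0`, `Θ 1`: its endpoints lie
on the two boundaries, and it hits both boundaries orthogonally from outside, so that the
trajectory running along it bounces back and forth. -/
def IsPeriodicRay (Θ : Fin 2 → Set E3) (a : Fin 2 → E3) : Prop :=
  ∀ j, IsOutwardUnitNormal (Θ j) (a j) (-axisDir a j)

/-- The open cylinder of radius `r` around the segment `[a 0, a 1]`, prolonged by the length `ρ`
beyond both endpoints (for `r, ρ > 0` it is an open set that contains the segment). -/
def openCylinder (a : Fin 2 → E3) (r ρ : ℝ) : Set E3 :=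
  {x | -ρ < inner ℝ (x - a 0) (axisDir a 1) ∧
    inner ℝ (x - a 0) (axisDir a 1) < ‖a 1 - a 0‖ + ρ ∧
    ‖(x - a 0) - (inner ℝ (x - a 0) (axisDir a 1)) • axisDir a 1‖ < r}

/-- A real function together with the set on which it is considered
(its values off `dom` are meaningless). -/
structure LocalPhase where
  dom : Set E3
  toFun : E3 → ℝ

/-- The plane phase `x ↦ (x - y) · ξ / |ξ|` on the whole space. -/
def planePhase (y ξ : E3) : LocalPhase where
  dom := Set.univ
  toFun x := inner ℝ (x - y) ξ / ‖ξ‖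

/-- The ray of the phase `φ` through the point `X` hits the boundary of `Θ` at `X` from outside,
with `-n(X) · ∇φ(X) ≥ δ`, and `p` is the direction of the ray reflected there according to the
law of geometrical optics. -/
def ReflectsAt (Θ : Set E3) (δ : ℝ) (φ : LocalPhase) (X p : E3) : Prop :=
  X ∈ interior φ.dom ∧ ∃ ν : E3, IsOutwardUnitNormal Θ X ν ∧
    δ ≤ -inner ℝ ν (gradient φ.toFun X) ∧
    p = gradient φ.toFun X - (2 * inner ℝ ν (gradient φ.toFun X)) • ν

open scoped Classical in
/-- The phase reflected on `Θ`: it is considered on the union of the reflected half-rays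
`X + τ p`, `τ ≥ 0`, and takes there the value `φ(X) + τ`. -/
def reflectPhase (Θ : Set E3) (δ : ℝ) (φ : LocalPhase) : LocalPhase where
  dom := {z | ∃ X p : E3, ∃ τ : ℝ, ReflectsAt Θ δ φ X p ∧ 0 ≤ τ ∧ z = X + τ • p}
  toFun z :=
    if h : ∃ s : ℝ, ∃ X p : E3, ∃ τ : ℝ, ReflectsAt Θ δ φ X p ∧ 0 ≤ τ ∧ z = X + τ • p ∧
        s = φ.toFun X + τ
    then h.choose else 0

/-- `ψ` satisfies the relation `ψ(X + τ p) = φ(X) + τ` that defines the phase reflected on `Θ`,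
for all the reflected half-rays. -/
def IsReflectionOf (Θ : Set E3) (δ : ℝ) (φ ψ : LocalPhase) : Prop :=
  ∀ X p : E3, ∀ τ : ℝ, ReflectsAt Θ δ φ X p → 0 ≤ τ → ψ.toFun (X + τ • p) = φ.toFun X + τ

/-- A nonempty story of reflections `J = (j, …, k)`: consecutive entries are distinct, the first
one is `j` and the last one is `k`. -/
def IsStory (j k : Fin 2) (J : List (Fin 2)) : Prop :=
  J.head? = some j ∧ J.getLast? = some k ∧ J.IsChain (· ≠ ·)

/-- The phase `φ_J` for `J = (j₁, …, jₙ)`: the plane phase reflected successively on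
`Θ j₁`, …, `Θ jₙ`. -/
def storyPhase (Θ : Fin 2 → Set E3) (δ : ℝ) (y ξ : E3) (J : List (Fin 2)) : LocalPhase :=
  J.foldl (fun φ j => reflectPhase (Θ j) δ φ) (planePhase y ξ)

/-- The open cone of the `ξ ≠ 0` whose direction is at distance less than `η` from `d`. -/
def directionCone (d : E3) (η : ℝ) : Set E3 :=
  {ξ | ξ ≠ 0 ∧ ‖‖ξ‖⁻¹ • ξ - d‖ < η}

/-- The partial derivative in the `i`-th coordinate. -/
def partialDeriv (i : Fin 3) (F : E3 → E3) : E3 → E3 :=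
  fun x => fderiv ℝ F x (EuclideanSpace.single i 1)

/-- The derivative `D^α` for a multi-index `α`. -/
def multiDeriv (α : Fin 3 → ℕ) (F : E3 → E3) : E3 → E3 :=
  (partialDeriv 0)^[α 0] ((partialDeriv 1)^[α 1] ((partialDeriv 2)^[α 2] F))

/-- The mixed derivative `D_ξ^α D_x^β ∇_x Φ` of a function `Φ` of `(x, ξ)`. -/
def mixedDerivGrad (α β : Fin 3 → ℕ) (Φ : E3 → E3 → ℝ) (x ξ : E3) : E3 :=
  multiDeriv α (fun ζ => multiDeriv β (gradient (fun z => Φ z ζ)) x) ξ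

/-- `Φ` realises `φ_J` (for `J` with last entry `k`) as a phase function on `U`, depending
smoothly on the parameter `ξ ∈ C`. The half-rays leaving the boundary of `Θ k` do not enter
the interior of `Θ k`, so the set on which `φ_J` is built covers only the complement of this
interior: there `Φ` is `φ_J`, and on the rest of `U` it is a smooth prolongation of `φ_J` as
a solution of `|∇_x Φ| = 1`. -/
def RealisesPhaseOn (Θ : Fin 2 → Set E3) (δ : ℝ) (y : E3) (J : List (Fin 2)) (k : Fin 2)
    (U C : Set E3) (Φ : E3 → E3 → ℝ) : Prop :=
  (∀ ξ ∈ C, IsReflectionOf (Θ k) δ (storyPhase Θ δ y ξ J.dropLast) (storyPhase Θ δ y ξ J)) ∧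
  (∀ ξ ∈ C, ∀ x ∈ U \ interior (Θ k),
    x ∈ (storyPhase Θ δ y ξ J).dom ∧ Φ x ξ = (storyPhase Θ δ y ξ J).toFun x) ∧
  ContDiffOn ℝ ∞ (fun q : E3 × E3 => Φ q.1 q.2) (U ×ˢ C) ∧
  ∀ ξ ∈ C, ∀ x ∈ U, ‖gradient (fun z => Φ z ξ) x‖ = 1

end

/-! The main tool is convexity. Replace the locally defined phase of a story by a global function:
start from the plane phase and, for each reflection on `Θ j`, pass from `M` to `z ↦ min_{Y ∈ Θ j} (M
Y + |Y - z|)` (`valueThrough`). This minimises a jointly convex function over a convex set, so all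
these functions are convex. If `X` is a reflection point, the gradient inequality for `M` and the
supporting half-space of `Θ j` at `X` show that the new function equals `M X + τ` on the whole
reflected half-ray (`valueThrough_reflected`). Two half-rays through one point therefore never
disagree, which is the consistency of the phase. Conversely, the first order condition at a
minimiser `X` is the law of reflection, so near the axis every point off the interior of `Θ j` lies
on a reflected ray (`ObstacleChart.exists_foot`).

Uniformity in the number of reflections comes from a set of inequalities that each reflection
reproduces with the same constants (`OutgoingRays.incomingFamily`). Gradients of convex functions
are monotone, and so are the outward normals of a convex body. Outgoing rays hence do not converge,
and the foot of a ray is a 6-Lipschitz function of its end, whatever came before. After a flight of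
length comparable to `d`, the direction is determined by foot and end, so its closeness to the axis
and its Lipschitz constant `28 / d` are reset. The remaining invariant, that a ray at distance `u`
from the axis approaches it with slope at most `η u`, survives both the flight (`slope_mono`) and
the reflection (`ObstacleChart.slope_reflected`).

For the derivatives, a ray is coded by its direction and its point of given abscissa. Reflection is
then a smooth map `B k` with derivatives bounded near the relevant states, and the story is a
composite `Ψ`, whose derivatives grow at most exponentially in the length of the story. The state
`w(x, ξ)` of the initial ray that ends at `x` satisfies `Ψ₁(w, ξ/|ξ|) = x`, and the gradient of the
phase is `Ψ₂(w, ξ/|ξ|)`. Chaining the Lipschitz bounds for the feet makes `w` Lipschitz in `x` with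
constant `48 ^ |J|`. Consequently `∂Ψ₁/∂w` is invertible with inverse of norm at most `48 ^ |J|`,
the implicit function theorem makes `w` smooth, and repeated differentiation of the inverse keeps
the growth exponential (`RayChart.expBounded_snd`).

Inside the obstacle the phase is prolonged along its rays: `x` is moved forward by a small fixed
length `s` to the point `x⁺` with `x⁺ = x + s ∇M(x⁺)`, and the value is `M(x⁺) - s`. -/

/-! ### Convex functions and their gradients -/

section ConvexGradient

variable {E : Type*} [NormedAddCommGroup E] [InnerProductSpace ℝ E] [CompleteSpace E]

/-- A convex function touched from above at `z` by a function with gradient `p` at `z`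
has gradient `p` at `z`. -/
theorem ConvexOn.hasGradientAt_of_le {f u : E → ℝ} {p z : E} (hf : ConvexOn ℝ Set.univ f)
    (hu : HasGradientAt u p z) (hle : ∀ w, f w ≤ u w) (heq : f z = u z) :
    HasGradientAt f p z := by
  rw [hasGradientAt_iff_hasFDerivAt, hasFDerivAt_iff_isLittleO_nhds_zero] at *
  rw [Asymptotics.isLittleO_iff] at *
  intro c hc
  have h1 := hu hc
  have h2 : ∀ᶠ h in nhds (0 : E), ‖u (z + -h) - u z - (InnerProductSpace.toDual ℝ E p) (-h)‖
      ≤ c * ‖-h‖ := by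
    have : Filter.Tendsto (fun h : E => -h) (nhds 0) (nhds 0) := by
      simpa using (continuous_neg (G := E)).tendsto 0
    exact this.eventually h1
  filter_upwards [h1, h2] with h h1 h2
  -- Midpoint convexity gives `f (z + h) ≥ 2 f z - u (z - h)`, and `f (z + h) ≤ u (z + h)`. Both
  -- bounds have the same first order expansion.
  have hm := hf.2 (Set.mem_univ (z + h)) (Set.mem_univ (z + -h))
    (by norm_num : (0 : ℝ) ≤ 1 / 2) (by norm_num : (0 : ℝ) ≤ 1 / 2) (by norm_num)
  have hz : (1 / 2 : ℝ) • (z + h) + (1 / 2 : ℝ) • (z + -h) = z := by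
    rw [← smul_add, show z + h + (z + -h) = (2 : ℝ) • z by rw [two_smul]; abel, smul_smul]
    norm_num
  rw [hz] at hm
  have e1 := hle (z + h)
  have e2 := hle (z + -h)
  simp only [smul_eq_mul, map_neg, norm_neg, Real.norm_eq_abs, abs_le] at *
  constructor <;> linarith [h1.1, h1.2, h2.1, h2.2]

/-- The gradient inequality for convex functions. -/
theorem ConvexOn.add_inner_le {f : E → ℝ} {p z : E} (hf : ConvexOn ℝ Set.univ f)
    (hp : HasGradientAt f p z) (w : E) : f z + inner ℝ p (w - z) ≤ f w := by
  have hd : HasDerivAt (fun t : ℝ => f (z + t • (w - z))) (inner ℝ p (w - z)) 0 := by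
    have h1 : HasDerivAt (fun t : ℝ => z + t • (w - z)) (w - z) 0 := by
      simpa using ((hasDerivAt_id (0 : ℝ)).smul_const (w - z)).const_add z
    have h2 : HasFDerivAt f (InnerProductSpace.toDual ℝ E p) (z + (0 : ℝ) • (w - z)) := by
      simpa using hp.hasFDerivAt
    exact (h2.comp_hasDerivAt (0 : ℝ) h1).congr_deriv (by simp)
  have hs := hd.tendsto_slope_zero_right
  have : inner ℝ p (w - z) ≤ f w - f z := by
    refine le_of_tendsto hs ?_
    have h01 : Set.Ioo (0 : ℝ) 1 ∈ nhdsWithin 0 (Set.Ioi 0) := Ioo_mem_nhdsGT one_pos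
    filter_upwards [h01] with t ht
    have hm := hf.2 (Set.mem_univ z) (Set.mem_univ w) (sub_nonneg.2 ht.2.le) ht.1.le (by ring)
    have hz : (1 - t) • z + t • w = z + t • (w - z) := by module
    rw [hz] at hm
    simp only [smul_eq_mul, zero_add, zero_smul, add_zero] at *
    rw [inv_mul_le_iff₀ ht.1]
    linarith
  linarith

/-- The sum of the two gradient inequalities. For a phase it says that neighbouring rays do not
converge. -/
theorem ConvexOn.inner_gradient_sub_nonneg {f : E → ℝ} {p p' z z' : E}
    (hf : ConvexOn ℝ Set.univ f) (hp : HasGradientAt f p z) (hp' : HasGradientAt f p' z') :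
    0 ≤ inner ℝ (z - z') (p - p') := by
  have h1 := hf.add_inner_le hp z'
  have h2 := hf.add_inner_le hp' z
  have : inner ℝ (z - z') (p - p') = -inner ℝ p (z' - z) - inner ℝ p' (z - z') := by
    simp only [inner_sub_left, inner_sub_right, real_inner_comm]
    ring
  linarith

theorem hasGradientAt_norm_sub {z X : E} (h : X ≠ z) :
    HasGradientAt (fun Y => ‖Y - z‖) (‖X - z‖⁻¹ • (X - z)) X := by
  have h0 : ‖X - z‖ ≠ 0 := norm_ne_zero_iff.2 (sub_ne_zero.2 h)
  rw [hasGradientAt_iff_hasFDerivAt]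
  have h1 : HasFDerivAt (fun Y : E => ‖Y - z‖ ^ 2) (2 • (innerSL ℝ (X - z)).comp
      (ContinuousLinearMap.id ℝ E)) X := ((hasFDerivAt_id X).sub_const z).norm_sq
  have h2 := h1.sqrt (pow_ne_zero 2 h0)
  have h3 : (fun Y : E => √(‖Y - z‖ ^ 2)) = fun Y => ‖Y - z‖ := by
    funext Y; exact Real.sqrt_sq (norm_nonneg _)
  rw [h3, Real.sqrt_sq (norm_nonneg _)] at h2
  refine h2.congr_fderiv ?_
  ext v
  simp
  field_simp

/-- First order condition for the minimum of `M + ‖· - z‖` on a convex set. -/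
theorem first_order_of_isMinOn {M : E → ℝ} {K : Set E} {p z X Y : E} (hK : Convex ℝ K)
    (hX : X ∈ K) (hY : Y ∈ K) (hmin : ∀ W ∈ K, M X + ‖X - z‖ ≤ M W + ‖W - z‖)
    (hp : HasGradientAt M p X) (hz : X ≠ z) :
    0 ≤ inner ℝ (p - ‖z - X‖⁻¹ • (z - X)) (Y - X) := by
  have hg : HasFDerivAt (fun W => M W + ‖W - z‖) _ X :=
    hp.hasFDerivAt.add (hasGradientAt_norm_sub hz).hasFDerivAt
  have hm : IsLocalMinOn (fun W => M W + ‖W - z‖) K X :=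
    IsMinOn.localize (fun W hW => hmin W hW)
  have := hm.hasFDerivWithinAt_nonneg hg.hasFDerivWithinAt
    (sub_mem_posTangentConeAt_of_segment_subset (hK.segment_subset hX hY))
  have e : ‖z - X‖⁻¹ • (z - X) = -(‖X - z‖⁻¹ • (X - z)) := by
    rw [norm_sub_rev, ← smul_neg, neg_sub]
  rw [e, sub_neg_eq_add, inner_add_left]
  simpa [inner_smul_left, inner_sub_left] using this

end ConvexGradient

/-! ### The least optical length through an obstacle -/

section ValueThrough

variable {E : Type*} [NormedAddCommGroup E]

/-- The least optical length `M Y + ‖Y - z‖` of a path to `z` through a point `Y` of `Θ`. -/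
noncomputable def valueThrough (Θ : Set E) (M : E → ℝ) (z : E) : ℝ := ⨅ Y : Θ, (M Y + ‖Y.1 - z‖)

variable {Θ : Set E} {M : E → ℝ}

theorem bddBelow_valueThrough (hΘ : IsCompact Θ) (hM : Continuous M) (z : E) :
    BddBelow (Set.range fun Y : Θ => M Y + ‖Y.1 - z‖) := by
  have : BddBelow ((fun Y => M Y + ‖Y - z‖) '' Θ) :=
    hΘ.bddBelow_image (by fun_prop)
  rwa [Set.image_eq_range] at this

theorem valueThrough_le (hΘ : IsCompact Θ) (hM : Continuous M) (z : E) {Y : E} (hY : Y ∈ Θ) :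
    valueThrough Θ M z ≤ M Y + ‖Y - z‖ :=
  ciInf_le (bddBelow_valueThrough hΘ hM z) ⟨Y, hY⟩

theorem le_valueThrough (hne : Θ.Nonempty) {z : E} {s : ℝ}
    (h : ∀ Y ∈ Θ, s ≤ M Y + ‖Y - z‖) : s ≤ valueThrough Θ M z := by
  have := hne.to_subtype
  exact le_ciInf fun Y => h Y Y.2

theorem exists_eq_valueThrough (hne : Θ.Nonempty) (hΘ : IsCompact Θ) (hM : Continuous M) (z : E) :
    ∃ Y ∈ Θ, valueThrough Θ M z = M Y + ‖Y - z‖ := by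
  obtain ⟨Y, hY, hmin⟩ := hΘ.exists_isMinOn hne
    (by fun_prop : ContinuousOn (fun Y => M Y + ‖Y - z‖) Θ)
  exact ⟨Y, hY, le_antisymm (valueThrough_le hΘ hM z hY) (le_valueThrough hne fun W hW => hmin hW)⟩

/-- Partial minimisation of `(Y, z) ↦ M Y + ‖Y - z‖`, which is jointly convex, over a convex set:
convex combinations of the two minimisers are competitors. -/
theorem convexOn_valueThrough [NormedSpace ℝ E] (hne : Θ.Nonempty) (hΘ : IsCompact Θ) (hc : Convex ℝ Θ)
    (hM : Continuous M) (hMc : ConvexOn ℝ Set.univ M) :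
    ConvexOn ℝ Set.univ (valueThrough Θ M) := by
  refine ⟨convex_univ, fun z _ z' _ s t hs ht hst => ?_⟩
  obtain ⟨Y, hY, e⟩ := exists_eq_valueThrough hne hΘ hM z
  obtain ⟨Y', hY', e'⟩ := exists_eq_valueThrough hne hΘ hM z'
  refine (valueThrough_le hΘ hM _ (hc hY hY' hs ht hst)).trans ?_
  have h1 := hMc.2 (Set.mem_univ Y) (Set.mem_univ Y') hs ht hst
  have h2 : ‖s • Y + t • Y' - (s • z + t • z')‖ ≤ s * ‖Y - z‖ + t * ‖Y' - z'‖ := by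
    rw [show s • Y + t • Y' - (s • z + t • z') = s • (Y - z) + t • (Y' - z') by module]
    refine (norm_add_le _ _).trans ?_
    rw [norm_smul, norm_smul, Real.norm_of_nonneg hs, Real.norm_of_nonneg ht]
  rw [e, e']
  simp only [smul_eq_mul] at *
  linarith

theorem continuous_valueThrough (hne : Θ.Nonempty) (hΘ : IsCompact Θ) (hM : Continuous M) :
    Continuous (valueThrough Θ M) := by
  have : LipschitzWith 1 (valueThrough Θ M) := by
    refine LipschitzWith.of_le_add fun z z' => ?_
    obtain ⟨Y, hY, e⟩ := exists_eq_valueThrough hne hΘ hM z'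
    have := valueThrough_le hΘ hM z hY
    have h2 : ‖Y - z‖ ≤ ‖Y - z'‖ + dist z z' := by
      rw [dist_eq_norm, norm_sub_rev z z', show Y - z = (Y - z') + (z' - z) by abel]
      exact norm_add_le _ _
    linarith
  exact this.continuous

end ValueThrough

/-! ### Reflected directions and the geometry of reflected rays -/

section Reflection

variable {E : Type*} [NormedAddCommGroup E] [InnerProductSpace ℝ E]

/-- The direction `p` reflected in the hyperplane orthogonal to `ν`. -/
noncomputable def reflectDir (ν p : E) : E := p - (2 * inner ℝ ν p) • ν

theorem norm_reflectDir {ν p : E} (hν : ‖ν‖ = 1) : ‖reflectDir ν p‖ = ‖p‖ := by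
  have h : ‖reflectDir ν p‖ ^ 2 = ‖p‖ ^ 2 := by
    rw [reflectDir, norm_sub_sq_real, norm_smul, inner_smul_right, hν, real_inner_comm,
      Real.norm_eq_abs, mul_one, sq_abs]
    ring
  exact (sq_eq_sq₀ (norm_nonneg _) (norm_nonneg _)).1 h

/-- Two distinct unit vectors are mirror images of each other. -/
theorem reflectDir_eq {p u : E} (hp : ‖p‖ = 1) (hu : ‖u‖ = 1) (h : u ≠ p) :
    reflectDir (‖u - p‖⁻¹ • (u - p)) p = u := by
  have h0 : ‖u - p‖ ≠ 0 := norm_ne_zero_iff.2 (sub_ne_zero.2 h)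
  have h1 : ‖u - p‖ ^ 2 = -2 * inner ℝ (u - p) p := by
    rw [norm_sub_sq_real, inner_sub_left, real_inner_self_eq_norm_sq, hp, hu]; ring
  have h2 : 2 * inner ℝ (‖u - p‖⁻¹ • (u - p)) p = -‖u - p‖ := by
    rw [inner_smul_left]
    simp only [map_inv₀, conj_trivial]
    field_simp
    linarith
  rw [reflectDir, h2, smul_smul]
  field_simp
  simp

theorem norm_reflectDir_sub_le {ν ν' p p' : E} (hν : ‖ν‖ = 1) (hν' : ‖ν'‖ = 1)
    (hp' : ‖p'‖ = 1) : ‖reflectDir ν p - reflectDir ν' p'‖ ≤ 3 * ‖p - p'‖ + 4 * ‖ν - ν'‖ := by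
  have e : reflectDir ν p - reflectDir ν' p' =
      (p - p') - (2 * inner ℝ ν (p - p')) • ν - (2 * inner ℝ (ν - ν') p') • ν
        - (2 * inner ℝ ν' p') • (ν - ν') := by
    simp only [reflectDir, inner_sub_left, inner_sub_right]
    module
  rw [e]
  have a1 : |inner ℝ ν (p - p')| ≤ ‖p - p'‖ := by
    simpa [hν] using abs_real_inner_le_norm ν (p - p')
  have a2 : |inner ℝ (ν - ν') p'| ≤ ‖ν - ν'‖ := by
    simpa [hp'] using abs_real_inner_le_norm (ν - ν') p'
  have a3 : |inner ℝ ν' p'| ≤ 1 := by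
    simpa [hp', hν'] using abs_real_inner_le_norm ν' p'
  have b1 : ‖(2 * inner ℝ ν (p - p')) • ν‖ ≤ 2 * ‖p - p'‖ := by
    rw [norm_smul, hν, norm_mul]; simp; linarith
  have b2 : ‖(2 * inner ℝ (ν - ν') p') • ν‖ ≤ 2 * ‖ν - ν'‖ := by
    rw [norm_smul, hν, norm_mul]; simp; linarith
  have b3 : ‖(2 * inner ℝ ν' p') • (ν - ν')‖ ≤ 2 * ‖ν - ν'‖ := by
    rw [norm_smul, norm_mul]; simp; nlinarith [norm_nonneg (ν - ν')]
  have n1 := norm_sub_le ((p - p') - (2 * inner ℝ ν (p - p')) • ν - (2 * inner ℝ (ν - ν') p') • ν)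
    ((2 * inner ℝ ν' p') • (ν - ν'))
  have n2 := norm_sub_le ((p - p') - (2 * inner ℝ ν (p - p')) • ν) ((2 * inner ℝ (ν - ν') p') • ν)
  have n3 := norm_sub_le (p - p') ((2 * inner ℝ ν (p - p')) • ν)
  linarith

theorem norm_reflectDir_add_le {ν p e : E} (hν : ‖ν‖ = 1) (he : ‖e‖ = 1) :
    ‖reflectDir ν p + e‖ ≤ 3 * ‖p - e‖ + 4 * ‖ν + e‖ := by
  have h := norm_reflectDir_sub_le (p := p) hν (by rwa [norm_neg] : ‖-e‖ = 1) he
  have : reflectDir (-e) e = -e := by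
    rw [reflectDir, inner_neg_left, real_inner_self_eq_norm_sq, he]; module
  rwa [this, sub_neg_eq_add, sub_neg_eq_add] at h

/-- The slope of the distance to the axis increases along a straight line. -/
theorem slope_mono {u q : E} {η τ : ℝ} (hτ : 0 ≤ τ) (hη : 0 ≤ η)
    (h : -η * ‖u‖ ≤ inner ℝ u q) : -η * ‖u + τ • q‖ ≤ inner ℝ (u + τ • q) q := by
  by_cases hA : 0 ≤ inner ℝ (u + τ • q) q
  · nlinarith [norm_nonneg (u + τ • q)]
  push Not at hA
  set w := u + τ • q with hw
  have hu : u = w - τ • q := by rw [hw]; abel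
  set A := -inner ℝ w q with hAdef
  have hA0 : 0 < A := by linarith
  have cs : A ^ 2 ≤ ‖q‖ ^ 2 * ‖w‖ ^ 2 := by
    have := abs_real_inner_le_norm w q
    rw [← mul_pow, ← sq_abs]
    refine pow_le_pow_left₀ (abs_nonneg _) ?_ 2
    rw [hAdef, abs_neg, mul_comm]; exact this
  have e1 : inner ℝ u q = -(A + τ * ‖q‖ ^ 2) := by
    rw [hu, inner_sub_left, inner_smul_left, real_inner_self_eq_norm_sq]
    simp [hAdef]; ring
  have e2 : ‖u‖ ^ 2 = ‖w‖ ^ 2 + 2 * τ * A + τ ^ 2 * ‖q‖ ^ 2 := by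
    rw [hu, norm_sub_sq_real, inner_smul_right, norm_smul, Real.norm_of_nonneg hτ]
    simp [hAdef]; ring
  have h1 : A + τ * ‖q‖ ^ 2 ≤ η * ‖u‖ := by linarith
  have h2 : (A + τ * ‖q‖ ^ 2) ^ 2 ≤ η ^ 2 * ‖u‖ ^ 2 := by
    rw [← mul_pow]; exact pow_le_pow_left₀ (by positivity) h1 2
  have hupos : 0 < ‖u‖ ^ 2 := by
    rw [e2]
    have : 0 < ‖w‖ := by
      rw [norm_pos_iff]; rintro h; rw [h] at hA; simp at hA
    positivity
  have h3 : A ^ 2 * ‖u‖ ^ 2 ≤ (A + τ * ‖q‖ ^ 2) ^ 2 * ‖w‖ ^ 2 := by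
    have k1 : 0 ≤ τ * A * (‖q‖ ^ 2 * ‖w‖ ^ 2 - A ^ 2) :=
      mul_nonneg (by positivity) (by linarith)
    have k2 : 0 ≤ τ ^ 2 * ‖q‖ ^ 2 * (‖q‖ ^ 2 * ‖w‖ ^ 2 - A ^ 2) :=
      mul_nonneg (by positivity) (by linarith)
    rw [e2]; nlinarith
  have h4 : A ^ 2 * ‖u‖ ^ 2 ≤ (η * ‖w‖) ^ 2 * ‖u‖ ^ 2 := by
    nlinarith [mul_le_mul_of_nonneg_right h2 (sq_nonneg ‖w‖)]
  have h5 : A ≤ η * ‖w‖ :=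
    le_of_sq_le_sq (le_of_mul_le_mul_right h4 hupos) (by positivity)
  linarith

/-- Diverging rays that leave a hypersurface almost orthogonally determine their feet in a
Lipschitz way. -/
theorem foot_sub_le {e X X' q q' : E} {τ τ' T L E₀ ε₁ ε₂ : ℝ} (he : ‖e‖ = 1)
    (hq : ‖q‖ = 1) (hq' : ‖q'‖ = 1) (hqe : ‖q + e‖ ≤ ε₂) (hqe' : ‖q' + e‖ ≤ ε₂)
    (hε₂ : ε₂ ≤ 1 / 2) (hX : |inner ℝ e (X - X')| ≤ ε₁ * ‖X - X'‖)
    (hmono : -E₀ * ‖X - X'‖ ≤ inner ℝ (X - X') (q - q')) (hE : 0 ≤ E₀)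
    (hL : ‖q - q'‖ ≤ L * ‖X - X'‖ + 3 * E₀) (hτ : 0 ≤ τ) (hτT : τ ≤ T)
    (hsmall : 2 * ε₁ + 2 * T * ε₂ * L ≤ 1 / 2) :
    ‖X - X'‖ ≤ 6 * ‖(X + τ • q) - (X' + τ' • q')‖ + 16 * T * E₀ := by
  have hT : 0 ≤ T := hτ.trans hτT
  have hε₂0 : 0 ≤ ε₂ := (norm_nonneg _).trans hqe
  set D := X - X' with hD
  set x := (X + τ • q) - (X' + τ' • q') with hx
  set A := D + τ • (q - q') with hA
  have hxA : x = A + (τ - τ') • q' := by rw [hx, hA, hD]; module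
  -- Following both rays for the same time `τ` cannot bring them closer, up to the error `E₀` in the
  -- monotonicity.
  have hDA : ‖D‖ - 2 * T * E₀ ≤ ‖A‖ := by
    by_cases hc : ‖D‖ ≤ 2 * T * E₀
    · linarith [norm_nonneg A]
    push Not at hc
    refine le_of_sq_le_sq ?_ (norm_nonneg A)
    have h1 : ‖A‖ ^ 2 = ‖D‖ ^ 2 + 2 * τ * inner ℝ D (q - q') + τ ^ 2 * ‖q - q'‖ ^ 2 := by
      rw [hA, norm_add_sq_real, inner_smul_right, norm_smul, Real.norm_of_nonneg hτ]; ring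
    have h2 : -(T * E₀ * ‖D‖) ≤ τ * inner ℝ D (q - q') := by
      have := mul_le_mul_of_nonneg_left hmono hτ
      have h3 : τ * (E₀ * ‖D‖) ≤ T * (E₀ * ‖D‖) :=
        mul_le_mul_of_nonneg_right hτT (by positivity)
      nlinarith
    have h4 : 0 ≤ T * E₀ := by positivity
    have h5 : 0 ≤ (T * E₀) * (‖D‖ - 2 * T * E₀) := mul_nonneg h4 (by linarith)
    have h6 : 0 ≤ τ ^ 2 * ‖q - q'‖ ^ 2 := by positivity
    nlinarith
  -- For unit vectors `q - q'` is orthogonal to `q + q'`, which is close to `-2 e`. So `q - q'` is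
  -- almost orthogonal to `e`.
  have hqq : |inner ℝ e (q - q')| ≤ ε₂ * ‖q - q'‖ := by
    have h0 : inner ℝ (q + q') (q - q') = 0 := by
      rw [inner_add_left, inner_sub_right, inner_sub_right, real_inner_self_eq_norm_sq,
        real_inner_self_eq_norm_sq, hq, hq', real_inner_comm]; ring
    have h1 : 2 * inner ℝ e (q - q') = inner ℝ ((q + e) + (q' + e)) (q - q') := by
      rw [show (q + e) + (q' + e) = (q + q') + (2 : ℝ) • e by module, inner_add_left, h0,
        inner_smul_left]
      simp
    have h2 := abs_real_inner_le_norm ((q + e) + (q' + e)) (q - q')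
    have h3 : ‖(q + e) + (q' + e)‖ ≤ 2 * ε₂ := (norm_add_le _ _).trans (by linarith)
    have h4 := mul_le_mul_of_nonneg_right h3 (norm_nonneg (q - q'))
    rw [← h1, abs_mul, abs_two] at h2
    linarith
  have hq'e : 1 / 2 ≤ |inner ℝ e q'| := by
    have h1 : inner ℝ e q' = inner ℝ e (q' + e) - 1 := by
      rw [inner_add_right, real_inner_self_eq_norm_sq, he]; ring
    have h2 := abs_real_inner_le_norm e (q' + e)
    rw [he, one_mul] at h2
    have h3 := abs_le.1 h2
    rw [h1, abs_sub_comm]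
    exact le_trans (by linarith) (le_abs_self _)
  -- The component along `e` isolates the difference of the times: `D` and `q - q'` contribute
  -- little to it, while `⟪e, q'⟫` is at least `1 / 2` in absolute value.
  have hττ : |τ - τ'| ≤ 2 * (‖x‖ + ε₁ * ‖D‖ + T * (ε₂ * (L * ‖D‖ + 3 * E₀))) := by
    have h1 : (τ - τ') * inner ℝ e q' = inner ℝ e x - inner ℝ e D - τ * inner ℝ e (q - q') := by
      rw [hxA, hA, inner_add_right, inner_add_right, inner_smul_right, inner_smul_right]; ring
    have h2 : |(τ - τ') * inner ℝ e q'| ≤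
        ‖x‖ + ε₁ * ‖D‖ + T * (ε₂ * (L * ‖D‖ + 3 * E₀)) := by
      rw [h1]
      have k1 : |inner ℝ e x| ≤ ‖x‖ := by simpa [he] using abs_real_inner_le_norm e x
      have k2 : |τ * inner ℝ e (q - q')| ≤ T * (ε₂ * (L * ‖D‖ + 3 * E₀)) := by
        rw [abs_mul, abs_of_nonneg hτ]
        refine mul_le_mul hτT (hqq.trans ?_) (abs_nonneg _) hT
        exact mul_le_mul_of_nonneg_left hL hε₂0
      have k3 := abs_sub (inner ℝ e x - inner ℝ e D) (τ * inner ℝ e (q - q'))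
      have k4 := abs_sub (inner ℝ e x) (inner ℝ e D)
      linarith
    rw [abs_mul] at h2
    nlinarith [abs_nonneg (τ - τ')]
  have hAx : ‖A‖ ≤ ‖x‖ + |τ - τ'| := by
    have : A = x - (τ - τ') • q' := by rw [hxA]; abel
    rw [this]
    refine (norm_sub_le _ _).trans ?_
    rw [norm_smul, hq', mul_one, Real.norm_eq_abs]
  have hfin : ‖D‖ ≤ 3 * ‖x‖ + (2 * ε₁ + 2 * T * ε₂ * L) * ‖D‖ + 2 * T * E₀ + 6 * T * ε₂ * E₀ := by
    nlinarith
  have h7 : (2 * ε₁ + 2 * T * ε₂ * L) * ‖D‖ ≤ 1 / 2 * ‖D‖ :=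
    mul_le_mul_of_nonneg_right hsmall (norm_nonneg _)
  have h8 : T * E₀ * ε₂ ≤ T * E₀ * (1 / 2) := mul_le_mul_of_nonneg_left hε₂ (by positivity)
  have h9 : 0 ≤ T * E₀ := by positivity
  nlinarith

end Reflection

/-! ### Reflected phases as values of convex functions -/

section Phase

variable {Θ : Set E3} {M : E3 → ℝ}

/-- The value at a reflected point is the optical length of the reflected path. -/
theorem valueThrough_reflected (hΘ : IsCompact Θ) (hM : Continuous M)
    (hMc : ConvexOn ℝ Set.univ M) {X ν p : E3} {τ : ℝ} (hX : X ∈ Θ) (hν : ‖ν‖ = 1)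
    (hn : ∀ Y ∈ Θ, inner ℝ ν (Y - X) ≤ 0) (hp : HasGradientAt M p X) (hp1 : ‖p‖ = 1)
    (hνp : inner ℝ ν p ≤ 0) (hτ : 0 ≤ τ) :
    valueThrough Θ M (X + τ • reflectDir ν p) = M X + τ := by
  have hq : ‖reflectDir ν p‖ = 1 := by rw [norm_reflectDir hν, hp1]
  refine le_antisymm ((valueThrough_le hΘ hM _ hX).trans (le_of_eq ?_))
    (le_valueThrough ⟨X, hX⟩ fun Y hY => ?_)
  · rw [sub_add_cancel_left, norm_neg, norm_smul, hq, Real.norm_of_nonneg hτ, mul_one]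
  · have h1 := hMc.add_inner_le hp Y
    set q := reflectDir ν p with hqd
    have h2 : inner ℝ q (X + τ • q - Y) ≤ ‖Y - (X + τ • q)‖ := by
      have := real_inner_le_norm q (X + τ • q - Y)
      rwa [hq, one_mul, norm_sub_rev] at this
    have h3 : inner ℝ q (X + τ • q - Y) = τ - inner ℝ q (Y - X) := by
      rw [show X + τ • q - Y = τ • q - (Y - X) by abel, inner_sub_right, inner_smul_right,
        real_inner_self_eq_norm_sq, hq]; ring
    -- Both `⟪ν, p⟫` and `⟪ν, Y - X⟫` are nonpositive, so `⟪q, Y - X⟫ ≤ ⟪p, Y - X⟫`: no detour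
    -- through another point of `Θ` beats the reflected path.
    have h4 : inner ℝ q (Y - X) = inner ℝ p (Y - X) - 2 * inner ℝ ν p * inner ℝ ν (Y - X) := by
      rw [hqd, reflectDir, inner_sub_left, inner_smul_left]; simp
    have h5 := mul_nonneg_of_nonpos_of_nonpos hνp (hn Y hY)
    linarith

/-- The function `z ↦ M X + ‖z - X‖` lies above the convex function `valueThrough Θ M` and touches
it at this point. It is differentiable there because `τ > 0`, and a convex function touched from
above inherits the gradient. -/
theorem hasGradientAt_valueThrough (hne : Θ.Nonempty) (hΘ : IsCompact Θ) (hc : Convex ℝ Θ)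
    (hM : Continuous M) (hMc : ConvexOn ℝ Set.univ M) {X q : E3} {τ : ℝ} (hX : X ∈ Θ)
    (hq : ‖q‖ = 1) (hτ : 0 < τ) (hval : valueThrough Θ M (X + τ • q) = M X + τ) :
    HasGradientAt (valueThrough Θ M) q (X + τ • q) := by
  have hne' : X + τ • q ≠ X := by
    intro h
    have : τ • q = 0 := by simpa using h
    have h2 : ‖τ • q‖ = 0 := by rw [this, norm_zero]
    rw [norm_smul, hq, Real.norm_of_nonneg hτ.le] at h2
    linarith
  have hg : HasGradientAt (fun z => M X + ‖z - X‖) q (X + τ • q) := by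
    have h1 := (hasGradientAt_norm_sub hne').hasFDerivAt.const_add (M X)
    rw [hasGradientAt_iff_hasFDerivAt]
    rwa [add_sub_cancel_left, norm_smul, hq, Real.norm_of_nonneg hτ.le, smul_smul, mul_one,
      inv_mul_cancel₀ hτ.ne', one_smul] at h1
  refine (convexOn_valueThrough hne hΘ hc hM hMc).hasGradientAt_of_le hg (fun w => ?_) ?_
  · rw [norm_sub_rev]; exact valueThrough_le hΘ hM w hX
  · rw [hval, add_sub_cancel_left, norm_smul, hq, Real.norm_of_nonneg hτ.le, mul_one]

/-- `M` is a global convex function that gives the values of the phase `φ`, and has unit gradients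
at the points of `Θ` in the domain of `φ`. -/
structure IsValueOf (Θ : Set E3) (φ : LocalPhase) (M : E3 → ℝ) : Prop where
  continuous : Continuous M
  convex : ConvexOn ℝ Set.univ M
  eq_on : ∀ z ∈ φ.dom, φ.toFun z = M z
  exists_gradient : ∀ X ∈ Θ, X ∈ φ.dom → ∃ p, ‖p‖ = 1 ∧ HasGradientAt M p X

theorem IsValueOf.gradient_eq {φ : LocalPhase} (h : IsValueOf Θ φ M) {X p : E3}
    (hX : X ∈ interior φ.dom) (hp : HasGradientAt M p X) : gradient φ.toFun X = p := by
  have : HasGradientAt φ.toFun p X := by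
    refine HasGradientAt.congr_of_eventuallyEq hp ?_
    filter_upwards [mem_interior_iff_mem_nhds.1 hX] with z hz using h.eq_on z hz
  exact this.gradient

theorem IsValueOf.reflectsAt {φ : LocalPhase} {δ : ℝ} (h : IsValueOf Θ φ M) (hδ : 0 < δ)
    (hΘ : IsCompact Θ) {X p : E3} (hr : ReflectsAt Θ δ φ X p) :
    X ∈ Θ ∧ ‖p‖ = 1 ∧ (∀ τ : ℝ, 0 ≤ τ → valueThrough Θ M (X + τ • p) = M X + τ) := by
  obtain ⟨hX, ν, ⟨hν, hXf, hn⟩, hd, rfl⟩ := hr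
  have hXΘ : X ∈ Θ := hΘ.isClosed.frontier_subset hXf
  obtain ⟨p, hp1, hp⟩ := h.exists_gradient X hXΘ (interior_subset hX)
  rw [h.gradient_eq hX hp] at hd ⊢
  refine ⟨hXΘ, ?_, fun τ hτ => ?_⟩
  · exact (norm_reflectDir hν).trans hp1
  · exact valueThrough_reflected hΘ h.continuous h.convex hXΘ hν hn hp hp1 (by linarith) hτ

/-- Whichever half-ray the choice in `reflectPhase` selects, its value is the minimum defining
`valueThrough`. The choice is therefore immaterial. -/
theorem IsValueOf.reflectPhase_eq {φ : LocalPhase} {δ : ℝ} (h : IsValueOf Θ φ M) (hδ : 0 < δ)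
    (hΘ : IsCompact Θ) : ∀ z ∈ (reflectPhase Θ δ φ).dom,
      (reflectPhase Θ δ φ).toFun z = valueThrough Θ M z := by
  rintro z ⟨X, p, τ, hr, hτ, rfl⟩
  have hex : ∃ s : ℝ, ∃ X' p' : E3, ∃ τ' : ℝ, ReflectsAt Θ δ φ X' p' ∧ 0 ≤ τ' ∧
      X + τ • p = X' + τ' • p' ∧ s = φ.toFun X' + τ' := ⟨_, X, p, τ, hr, hτ, rfl, rfl⟩
  have e : (reflectPhase Θ δ φ).toFun (X + τ • p) = hex.choose := dif_pos hex
  obtain ⟨X', p', τ', hr', hτ', e1, e2⟩ := hex.choose_spec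
  rw [e, e2, e1, (h.reflectsAt hδ hΘ hr').2.2 τ' hτ', h.eq_on _ (interior_subset hr'.1)]

theorem IsValueOf.isReflectionOf {φ : LocalPhase} {δ : ℝ} (h : IsValueOf Θ φ M) (hδ : 0 < δ)
    (hΘ : IsCompact Θ) : IsReflectionOf Θ δ φ (reflectPhase Θ δ φ) := by
  intro X p τ hr hτ
  rw [h.reflectPhase_eq hδ hΘ _ ⟨X, p, τ, hr, hτ, rfl⟩, (h.reflectsAt hδ hΘ hr).2.2 τ hτ,
    h.eq_on _ (interior_subset hr.1)]

theorem IsValueOf.reflect {Θ' : Set E3} {φ : LocalPhase} {δ : ℝ} (h : IsValueOf Θ φ M)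
    (hδ : 0 < δ) (hne : Θ.Nonempty) (hΘ : IsCompact Θ) (hc : Convex ℝ Θ) (hd : Disjoint Θ Θ') :
    IsValueOf Θ' (reflectPhase Θ δ φ) (valueThrough Θ M) where
  continuous := continuous_valueThrough hne hΘ h.continuous
  convex := convexOn_valueThrough hne hΘ hc h.continuous h.convex
  eq_on := h.reflectPhase_eq hδ hΘ
  exists_gradient := by
    rintro _ hX' ⟨X, p, τ, hr, hτ, rfl⟩
    obtain ⟨hX, hp, hv⟩ := h.reflectsAt hδ hΘ hr
    refine ⟨p, hp, hasGradientAt_valueThrough hne hΘ hc h.continuous h.convex hX hp ?_ (hv τ hτ)⟩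
    -- A ray of length zero would end on `Θ`, which is disjoint from the next obstacle `Θ'`.
    refine lt_of_le_of_ne hτ fun h0 => ?_
    rw [← h0, zero_smul, add_zero] at hX'
    exact Set.disjoint_left.1 hd hX hX'

theorem hasGradientAt_planePhase (y ξ z : E3) :
    HasGradientAt (planePhase y ξ).toFun (‖ξ‖⁻¹ • ξ) z := by
  rw [hasGradientAt_iff_hasFDerivAt]
  have h : HasFDerivAt (fun x : E3 => inner ℝ (‖ξ‖⁻¹ • ξ) (x - y))
      (InnerProductSpace.toDual ℝ E3 (‖ξ‖⁻¹ • ξ)) z := by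
    have := (InnerProductSpace.toDual ℝ E3 (‖ξ‖⁻¹ • ξ)).hasFDerivAt (x := z - y)
    exact (this.comp z ((hasFDerivAt_id z).sub_const y)).congr_fderiv
      (ContinuousLinearMap.comp_id _)
  refine h.congr_of_eventuallyEq (Filter.Eventually.of_forall fun x => ?_)
  change inner ℝ (x - y) ξ / ‖ξ‖ = inner ℝ (‖ξ‖⁻¹ • ξ) (x - y)
  rw [inner_smul_left, real_inner_comm]
  simp [div_eq_inv_mul]

theorem convexOn_planePhase (y ξ : E3) : ConvexOn ℝ Set.univ (planePhase y ξ).toFun := by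
  refine ⟨convex_univ, fun x _ x' _ s t _ _ hst => le_of_eq ?_⟩
  change inner ℝ (s • x + t • x' - y) ξ / ‖ξ‖ =
    s • (inner ℝ (x - y) ξ / ‖ξ‖) + t • (inner ℝ (x' - y) ξ / ‖ξ‖)
  have : s • x + t • x' - y = s • (x - y) + t • (x' - y) := by
    have : y = (s + t) • y := by rw [hst, one_smul]
    nth_rewrite 1 [this]; module
  rw [this, inner_add_left, inner_smul_left, inner_smul_left]
  simp; ring

theorem norm_normalize {ξ : E3} (hξ : ξ ≠ 0) : ‖‖ξ‖⁻¹ • ξ‖ = 1 := by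
  rw [norm_smul, norm_inv, norm_norm, inv_mul_cancel₀ (norm_ne_zero_iff.2 hξ)]

theorem isValueOf_planePhase (Θ : Set E3) (y : E3) {ξ : E3} (hξ : ξ ≠ 0) :
    IsValueOf Θ (planePhase y ξ) (planePhase y ξ).toFun where
  continuous := by
    change Continuous fun x : E3 => inner ℝ (x - y) ξ / ‖ξ‖
    fun_prop
  convex := convexOn_planePhase y ξ
  eq_on _ _ := rfl
  exists_gradient X _ _ := ⟨_, norm_normalize hξ, hasGradientAt_planePhase y ξ X⟩

/-- The least optical length of the paths that meet successively the obstacles of the story `J`. -/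
noncomputable def storyValue (Θ : Fin 2 → Set E3) (y ξ : E3) (J : List (Fin 2)) : E3 → ℝ :=
  J.foldl (fun M j => valueThrough (Θ j) M) (planePhase y ξ).toFun

theorem storyPhase_append (Θ : Fin 2 → Set E3) (δ : ℝ) (y ξ : E3) (J : List (Fin 2)) (k : Fin 2) :
    storyPhase Θ δ y ξ (J ++ [k]) = reflectPhase (Θ k) δ (storyPhase Θ δ y ξ J) := by
  simp [storyPhase]

theorem storyValue_append (Θ : Fin 2 → Set E3) (y ξ : E3) (J : List (Fin 2)) (k : Fin 2) :
    storyValue Θ y ξ (J ++ [k]) = valueThrough (Θ k) (storyValue Θ y ξ J) := by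
  simp [storyValue]

end Phase

/-! ### Normals and curvature of an obstacle -/

section ObstacleGeometry

/-- The normalised gradient of a defining function. -/
noncomputable def unitNormal (g : E3 → ℝ) (x : E3) : E3 := ‖gradient g x‖⁻¹ • gradient g x

theorem norm_unitNormal {g : E3 → ℝ} {x : E3} (h : gradient g x ≠ 0) : ‖unitNormal g x‖ = 1 :=
  norm_normalize h

theorem gradient_eq_smul_unitNormal {g : E3 → ℝ} {x : E3} (h : gradient g x ≠ 0) :
    gradient g x = ‖gradient g x‖ • unitNormal g x := by
  rw [unitNormal, smul_smul, mul_inv_cancel₀ (norm_ne_zero_iff.2 h), one_smul]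

theorem ContDiff.hasGradientAt {g : E3 → ℝ} (hg : ContDiff ℝ ∞ g) (x : E3) :
    HasGradientAt g (gradient g x) x :=
  (hg.differentiable (by simp) x).hasGradientAt

theorem fderiv_eq_inner_gradient {g : E3 → ℝ} (hg : ContDiff ℝ ∞ g) (x v : E3) :
    fderiv ℝ g x v = inner ℝ (gradient g x) v := by
  rw [(hg.hasGradientAt x).hasFDerivAt.fderiv]; rfl

theorem ContDiff.gradient {g : E3 → ℝ} (hg : ContDiff ℝ ∞ g) : ContDiff ℝ ∞ (gradient g) := by
  have h : ContDiff ℝ ∞ (fderiv ℝ g) := hg.fderiv_right (by simp)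
  exact (InnerProductSpace.toDual ℝ E3).symm.contDiff.comp h

theorem contDiffAt_unitNormal {g : E3 → ℝ} (hg : ContDiff ℝ ∞ g) {x : E3}
    (h : gradient g x ≠ 0) : ContDiffAt ℝ ∞ (unitNormal g) x :=
  ((hg.gradient.contDiffAt.norm ℝ h).inv (norm_ne_zero_iff.2 h)).smul hg.gradient.contDiffAt

variable {Θ : Set E3} {g : E3 → ℝ}

theorem mem_interior_of_neg (hg : ContDiff ℝ ∞ g) (hΘ : Θ = {x | g x ≤ 0}) {x : E3}
    (hx : g x < 0) : x ∈ interior Θ := by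
  refine mem_interior.2 ⟨{x | g x < 0}, ?_, isOpen_lt hg.continuous continuous_const, hx⟩
  rw [hΘ]; exact fun y (hy : g y < 0) => hy.le

theorem eq_zero_of_mem_frontier (hg : ContDiff ℝ ∞ g) (hΘ : Θ = {x | g x ≤ 0}) {x : E3}
    (hx : x ∈ frontier Θ) : g x = 0 := by
  have hcl : IsClosed Θ := by rw [hΘ]; exact isClosed_le hg.continuous continuous_const
  have h1 : x ∈ Θ := hcl.frontier_subset hx
  rw [hΘ] at h1
  refine le_antisymm h1 (not_lt.1 fun h => hx.2 (mem_interior_of_neg hg hΘ h))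

theorem isOutwardUnitNormal_unitNormal (hg : ContDiff ℝ ∞ g) (hΘ : Θ = {x | g x ≤ 0})
    (hc : Convex ℝ Θ) (hgrad : ∀ x, g x = 0 → gradient g x ≠ 0) {X : E3} (hX : X ∈ frontier Θ) :
    IsOutwardUnitNormal Θ X (unitNormal g X) := by
  have h0 := eq_zero_of_mem_frontier hg hΘ hX
  have hXΘ : X ∈ Θ := by rw [hΘ]; exact h0.le
  refine ⟨norm_unitNormal (hgrad X h0), hX, fun Y hY => ?_⟩
  have hm : IsLocalMaxOn g Θ X := by
    refine IsMaxOn.localize fun W hW => ?_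
    have : g W ≤ 0 := by rw [hΘ] at hW; exact hW
    simpa [h0] using this
  have h1 := hm.hasFDerivWithinAt_nonpos (hg.hasGradientAt X).hasFDerivAt.hasFDerivWithinAt
    (sub_mem_posTangentConeAt_of_segment_subset (hc.segment_subset hXΘ hY))
  have h2 : inner ℝ (gradient g X) (Y - X) ≤ 0 := h1
  rw [unitNormal, inner_smul_left]
  exact mul_nonpos_of_nonneg_of_nonpos (by simp) h2

theorem IsOutwardUnitNormal.eq_unitNormal (hg : ContDiff ℝ ∞ g) (hΘ : Θ = {x | g x ≤ 0})
    (hgrad : ∀ x, g x = 0 → gradient g x ≠ 0) {X ν : E3}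
    (hν : IsOutwardUnitNormal Θ X ν) : ν = unitNormal g X := by
  obtain ⟨hν1, hX, hn⟩ := hν
  have h0 := eq_zero_of_mem_frontier hg hΘ hX
  have hG := hgrad X h0
  set n := unitNormal g X with hnd
  have hn1 : ‖n‖ = 1 := norm_unitNormal hG
  -- A direction in which `g` decreases enters `Θ`, so it must point into the half-space of `ν`.
  have key : ∀ v, inner ℝ n v < 0 → inner ℝ ν v ≤ 0 := by
    intro v hv
    have hd : HasDerivAt (fun t : ℝ => g (X + t • v)) (inner ℝ (gradient g X) v) 0 := by
      have h1 : HasDerivAt (fun t : ℝ => X + t • v) v 0 := by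
        simpa using ((hasDerivAt_id (0 : ℝ)).smul_const v).const_add X
      have h2 : HasFDerivAt g (InnerProductSpace.toDual ℝ E3 (gradient g X)) (X + (0 : ℝ) • v) := by
        simpa using (hg.hasGradientAt X).hasFDerivAt
      exact (h2.comp_hasDerivAt (0 : ℝ) h1).congr_deriv (by simp)
    have hneg : inner ℝ (gradient g X) v < 0 := by
      rw [gradient_eq_smul_unitNormal hG, inner_smul_left]
      exact mul_neg_of_pos_of_neg (by simpa using hG) hv
    have hev := (hd.tendsto_slope_zero_right).eventually_lt_const hneg
    obtain ⟨t, ht, ht0⟩ := (hev.and self_mem_nhdsWithin).exists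
    simp only [zero_add, zero_smul, add_zero, h0, sub_zero, smul_eq_mul] at ht ht0
    have hgt : g (X + t • v) < 0 := by
      by_contra hcon
      push Not at hcon
      exact absurd ht (not_lt.2 (mul_nonneg (inv_nonneg.2 ht0.le) hcon))
    have := hn (X + t • v) (by rw [hΘ]; exact hgt.le)
    rw [add_sub_cancel_left, inner_smul_right] at this
    by_contra hcon
    push Not at hcon
    exact absurd this (not_le.2 (mul_pos ht0 hcon))
  set s := inner ℝ ν n with hs
  have hsn : inner ℝ n ν = s := real_inner_comm _ _
  have hnn : inner ℝ n n = 1 := by rw [real_inner_self_eq_norm_sq, hn1]; norm_num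
  have hνν : inner ℝ ν ν = 1 := by rw [real_inner_self_eq_norm_sq, hν1]; norm_num
  -- Tested on `v = -n + l (ν - s n)`, which satisfies `⟪n, v⟫ = -1` for every `l`. Letting `l` vary
  -- forces `s = 1`.
  have hall : ∀ l : ℝ, -s + l * (1 - s ^ 2) ≤ 0 := by
    intro l
    have h1 := key (-n + l • (ν - s • n)) (by
      simp only [inner_add_right, inner_neg_right, inner_smul_right, inner_sub_right, hnn, hsn]
      linarith)
    simp only [inner_add_right, inner_neg_right, inner_smul_right, inner_sub_right, hνν] at h1
    rw [← hs] at h1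
    linarith
  have hs0 : 0 ≤ s := by linarith [hall 0]
  have hs1 : s = 1 := by
    have hle : s ≤ 1 := by
      have := real_inner_le_norm ν n
      rwa [hν1, hn1, mul_one] at this
    by_contra hne
    have hlt : s < 1 := lt_of_le_of_ne hle hne
    have hpos : 0 < 1 - s ^ 2 := by nlinarith
    have := hall ((s + 1) / (1 - s ^ 2))
    rw [div_mul_cancel₀ _ hpos.ne'] at this
    linarith
  exact (inner_eq_one_iff_of_norm_eq_one hν1 hn1).1 hs1

theorem ContDiff.exists_norm_sub_lt {E F : Type*} [NormedAddCommGroup E] [NormedSpace ℝ E]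
    [NormedAddCommGroup F] [NormedSpace ℝ F] {f : E → F} (hf : ContDiff ℝ ∞ f) (a : E) {r : ℝ}
    (hr : 0 < r) : ∃ ε > 0, ∀ x, ‖x - a‖ < ε → ‖f x - f a‖ < r := by
  obtain ⟨ε, hε, h⟩ := (Metric.continuousAt_iff (a := a)).1 hf.continuous.continuousAt r hr
  refine ⟨ε, hε, fun x hx => ?_⟩
  have h1 := @h x (by rwa [dist_eq_norm])
  rwa [dist_eq_norm] at h1

/-- Lower Taylor estimate of second order. -/
theorem taylor_lower_bound (hg : ContDiff ℝ ∞ g) (a v : E3) {σ : ℝ}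
    (hσ : ∀ t ∈ Set.Icc (0 : ℝ) 1,
      ‖fderiv ℝ (fderiv ℝ g) (a + t • v) - fderiv ℝ (fderiv ℝ g) a‖ ≤ σ) :
    g a + fderiv ℝ g a v + (fderiv ℝ (fderiv ℝ g) a v v - σ * ‖v‖ ^ 2) / 2 ≤ g (a + v) := by
  have hl : ∀ t : ℝ, HasDerivAt (fun t : ℝ => a + t • v) v t := fun t => by
    simpa using ((hasDerivAt_id t).smul_const v).const_add a
  have hg1 : ContDiff ℝ ∞ (fderiv ℝ g) := hg.fderiv_right (by simp)
  have d1 : ∀ t : ℝ, HasDerivAt (fun t : ℝ => g (a + t • v)) (fderiv ℝ g (a + t • v) v) t :=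
    fun t => (hg.differentiable (by simp) _).hasFDerivAt.comp_hasDerivAt t (hl t)
  have d2 : ∀ t : ℝ, HasDerivAt (fun t : ℝ => fderiv ℝ g (a + t • v) v)
      (fderiv ℝ (fderiv ℝ g) (a + t • v) v v) t := fun t => by
    have := (hg1.differentiable (by simp) (a + t • v)).hasFDerivAt.comp_hasDerivAt t (hl t)
    simpa using this.clm_apply (hasDerivAt_const t v)
  have d3 : ∀ t : ℝ, HasDerivAt (fun t : ℝ => g (a + t • v) - t * fderiv ℝ g a v)
      (fderiv ℝ g (a + t • v) v - fderiv ℝ g a v) t := fun t => by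
    exact ((d1 t).sub ((hasDerivAt_id t).mul_const (fderiv ℝ g a v))).congr_deriv (by simp)
  -- Cauchy's mean value theorem against `t ^ 2`, followed by the ordinary one for the first
  -- derivative, yields the second order remainder at an intermediate point.
  obtain ⟨c, hc, ec⟩ := exists_ratio_hasDerivAt_eq_ratio_slope
    (fun t : ℝ => g (a + t • v) - t * fderiv ℝ g a v) _ one_pos
    (fun t _ => (d3 t).continuousAt.continuousWithinAt) (fun t _ => d3 t)
    (fun t : ℝ => t ^ 2) (fun t => 2 * t)
    (by fun_prop) (fun t _ => by simpa using hasDerivAt_pow 2 t)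
  obtain ⟨c', hc', ec'⟩ := exists_hasDerivAt_eq_slope (fun t : ℝ => fderiv ℝ g (a + t • v) v) _ hc.1
    (fun t _ => (d2 t).continuousAt.continuousWithinAt) (fun t _ => d2 t)
  have h1 := hσ c' ⟨hc'.1.le, (hc'.2.trans hc.2).le⟩
  have h2 := (fderiv ℝ (fderiv ℝ g) (a + c' • v) - fderiv ℝ (fderiv ℝ g) a).le_opNorm v
  have h3 : |fderiv ℝ (fderiv ℝ g) (a + c' • v) v v - fderiv ℝ (fderiv ℝ g) a v v| ≤
      ‖(fderiv ℝ (fderiv ℝ g) (a + c' • v) - fderiv ℝ (fderiv ℝ g) a) v‖ * ‖v‖ :=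
    ((fderiv ℝ (fderiv ℝ g) (a + c' • v) - fderiv ℝ (fderiv ℝ g) a) v).le_opNorm v
  have h4 : |fderiv ℝ (fderiv ℝ g) (a + c' • v) v v - fderiv ℝ (fderiv ℝ g) a v v|
      ≤ σ * ‖v‖ ^ 2 := by
    have : ‖fderiv ℝ (fderiv ℝ g) (a + c' • v) - fderiv ℝ (fderiv ℝ g) a‖ * ‖v‖ * ‖v‖
        ≤ σ * ‖v‖ * ‖v‖ := by gcongr
    have h5 := mul_le_mul_of_nonneg_right h2 (norm_nonneg v)
    nlinarith
  have hc0 : (0 : ℝ) < c := hc.1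
  simp only [zero_smul, add_zero, one_smul, sub_zero, zero_mul, one_mul, one_pow,
    zero_pow two_ne_zero] at ec ec'
  rw [eq_div_iff hc0.ne'] at ec'
  rw [← ec'] at ec
  have h6 : fderiv ℝ (fderiv ℝ g) (a + c' • v) v v =
      2 * (g (a + v) - fderiv ℝ g a v - g a) := by
    have : (fderiv ℝ (fderiv ℝ g) (a + c' • v) v v -
      2 * (g (a + v) - fderiv ℝ g a v - g a)) * c = 0 := by linarith
    rcases mul_eq_zero.1 this with h | h
    · linarith
    · exact absurd h hc0.ne'
  have := (abs_le.1 h4).1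
  linarith

/-- The error is linear in `b`, the height above the tangent plane in the application, so it can be
absorbed into the linear term of the Taylor estimate. -/
theorem apply_add_smul_lower_bound {E : Type*} [NormedAddCommGroup E] [NormedSpace ℝ E]
    (B : E →L[ℝ] E →L[ℝ] ℝ) {w e : E} {b : ℝ} (hw : ‖w‖ ≤ 1) (he : ‖e‖ = 1) (hb0 : 0 ≤ b)
    (hb1 : b ≤ 1) : B w w - 3 * (b * ‖B‖) ≤ B (w + b • e) (w + b • e) := by
  have bB : ∀ x y : E, ‖x‖ ≤ 1 → ‖y‖ ≤ 1 → -‖B‖ ≤ B x y := fun x y hx hy => by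
    have h1 := B.le_opNorm₂ x y
    have h2 : ‖B‖ * ‖x‖ * ‖y‖ ≤ ‖B‖ * 1 * 1 := by gcongr
    rw [Real.norm_eq_abs] at h1
    linarith [(abs_le.1 h1).1]
  have e1 : B (w + b • e) (w + b • e) = B w w + b * B w e + b * B e w + b ^ 2 * B e e := by
    simp only [map_add, map_smul, add_apply, smul_apply, smul_eq_mul]
    ring
  have m1 := mul_le_mul_of_nonneg_left (bB w e hw he.le) hb0
  have m2 := mul_le_mul_of_nonneg_left (bB e w he.le hw) hb0
  have m3 := mul_le_mul_of_nonneg_left (bB e e he.le he.le) (sq_nonneg b)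
  have m4 : b ^ 2 * ‖B‖ ≤ b * ‖B‖ :=
    mul_le_mul_of_nonneg_right (pow_le_of_le_one hb0 hb1 two_ne_zero) (norm_nonneg B)
  linarith

/-- A convex body with positive second fundamental form at `a` lies quadratically behind its tangent
plane. -/
theorem exists_quadratic_bound (hg : ContDiff ℝ ∞ g) (hΘ : Θ = {x | g x ≤ 0})
    (hgrad : ∀ x, g x = 0 → gradient g x ≠ 0) {c₀ : ℝ} (hc₀ : 0 < c₀)
    (hcurv : ∀ x, g x = 0 → ∀ v : E3, inner ℝ (gradient g x) v = 0 →
        c₀ * ‖v‖ ^ 2 ≤ fderiv ℝ (fderiv ℝ g) x v v / ‖gradient g x‖)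
    {a e : E3} (ha : IsOutwardUnitNormal Θ a (-e)) :
    ∃ c ε : ℝ, 0 < c ∧ 0 < ε ∧ ∀ X ∈ Θ, ‖X - a‖ < ε → c * ‖X - a‖ ^ 2 ≤ inner ℝ e (X - a) := by
  have h0 := eq_zero_of_mem_frontier hg hΘ ha.2.1
  have hG := hgrad a h0
  have hn := ha.eq_unitNormal hg hΘ hgrad
  have he1 : ‖e‖ = 1 := by simpa using ha.1
  set G := ‖gradient g a‖ with hGd
  have hG0 : 0 < G := norm_pos_iff.2 hG
  have hga : gradient g a = -(G • e) := by
    rw [gradient_eq_smul_unitNormal hG, ← hn, smul_neg]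
  set B := fderiv ℝ (fderiv ℝ g) a with hB
  obtain ⟨ε, hε, hball⟩ := ContDiff.exists_norm_sub_lt (f := fderiv ℝ (fderiv ℝ g))
    ((hg.fderiv_right (m := ∞) (by simp)).fderiv_right (by simp)) a (by positivity : 0 < c₀ * G / 2)
  set K := ‖B‖ with hK
  have hK0 : 0 ≤ K := norm_nonneg B
  have hD : 0 < G + 3 / 2 * K + c₀ * G / 2 := by positivity
  -- With `b = ⟪e, v⟫`, the Taylor bound and `g X ≤ 0` give `(G + 3K/2 + c₀G/2) b ≥ (c₀G/4) ‖v‖²`.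
  -- The radius is at most `1` so that `b² ≤ b`.
  refine ⟨c₀ * G / 4 / (G + 3 / 2 * K + c₀ * G / 2), min ε 1, by positivity, by positivity,
    fun X hX hXa => ?_⟩
  set v := X - a with hv
  have hvε := lt_of_lt_of_le hXa (min_le_left _ _)
  have hv1 := lt_of_lt_of_le hXa (min_le_right _ _)
  have ht := taylor_lower_bound hg a v (σ := c₀ * G / 2) (fun t ht => by
    have : dist (a + t • v) a < ε := by
      rw [dist_eq_norm, add_sub_cancel_left, norm_smul, Real.norm_of_nonneg ht.1]
      exact lt_of_le_of_lt (mul_le_of_le_one_left (norm_nonneg v) ht.2) hvε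
    rw [dist_eq_norm] at this
    exact (hball _ this).le)
  rw [hv, add_sub_cancel, ← hv, h0, fderiv_eq_inner_gradient hg, hga, inner_neg_left,
    inner_smul_left] at ht
  simp only [conj_trivial] at ht
  have hXg : g X ≤ 0 := by rw [hΘ] at hX; exact hX
  set b := inner ℝ e v with hb
  have hb0 : 0 ≤ b := by
    have := ha.2.2 X hX
    rw [inner_neg_left] at this
    linarith
  have hbv : b ≤ ‖v‖ := by simpa [he1] using real_inner_le_norm e v
  set w := v - b • e with hw
  have hee : inner ℝ e e = 1 := by rw [real_inner_self_eq_norm_sq, he1]; norm_num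
  have hwe : inner ℝ e w = 0 := by
    rw [hw, inner_sub_right, inner_smul_right, hee]; linarith
  have hvw : v = w + b • e := by rw [hw]; abel
  have hnv : ‖v‖ ^ 2 = ‖w‖ ^ 2 + b ^ 2 := by
    rw [hvw, norm_add_sq_real, inner_smul_right, real_inner_comm, hwe, norm_smul, he1,
      Real.norm_of_nonneg hb0]; ring
  have hcw := hcurv a h0 w (by rw [hga, inner_neg_left, inner_smul_left, hwe]; simp)
  rw [le_div_iff₀ hG0] at hcw
  have hwv : ‖w‖ ≤ ‖v‖ := by
    refine le_of_sq_le_sq ?_ (norm_nonneg v)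
    nlinarith
  have hw1 : ‖w‖ ≤ 1 := hwv.trans hv1.le
  have hb1 : b ≤ 1 := hbv.trans hv1.le
  have m1 := apply_add_smul_lower_bound B hw1 he1 hb0 hb1
  rw [← hvw] at m1
  have m4 : b ^ 2 * (c₀ * G) ≤ b * (c₀ * G) :=
    mul_le_mul_of_nonneg_right (pow_le_of_le_one hb0 hb1 two_ne_zero) (by positivity)
  have m5 : c₀ * ‖w‖ ^ 2 * G = c₀ * G * ‖v‖ ^ 2 - c₀ * G * b ^ 2 := by rw [hnv]; ring
  rw [div_mul_eq_mul_div, div_le_iff₀ hD]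
  linarith

end ObstacleGeometry

/-! ### Components orthogonal to the axis -/

section Perp

variable {E : Type*} [NormedAddCommGroup E] [InnerProductSpace ℝ E]

/-- The component of `v` orthogonal to the unit vector `e`. -/
noncomputable def perp (e v : E) : E := v - inner ℝ e v • e

theorem perp_neg_left (e v : E) : perp (-e) v = perp e v := by
  simp [perp]

theorem perp_add (e v w : E) : perp e (v + w) = perp e v + perp e w := by
  simp only [perp, inner_add_right]; module

theorem perp_smul (e v : E) (t : ℝ) : perp e (t • v) = t • perp e v := by
  simp only [perp, inner_smul_right]; module

theorem inner_perp {e : E} (he : ‖e‖ = 1) (v : E) : inner ℝ e (perp e v) = 0 := by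
  rw [perp, inner_sub_right, inner_smul_right, real_inner_self_eq_norm_sq, he]; ring

theorem inner_perp_perp {e : E} (he : ‖e‖ = 1) (v w : E) :
    inner ℝ (perp e v) (perp e w) = inner ℝ (perp e v) w := by
  nth_rewrite 2 [perp]
  rw [inner_sub_right, inner_smul_right, real_inner_comm e (perp e v), inner_perp he]; ring

theorem perp_add_inner_smul (e v : E) : perp e v + inner ℝ e v • e = v := by
  rw [perp]; abel

theorem norm_sq_eq_perp {e : E} (he : ‖e‖ = 1) (v : E) :
    ‖v‖ ^ 2 = ‖perp e v‖ ^ 2 + inner ℝ e v ^ 2 := by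
  nth_rewrite 1 [← perp_add_inner_smul e v]
  rw [norm_add_sq_real, inner_smul_right, real_inner_comm e (perp e v), inner_perp he, norm_smul,
    he, Real.norm_eq_abs, mul_one, sq_abs]
  ring

theorem norm_perp_le {e : E} (he : ‖e‖ = 1) (v : E) : ‖perp e v‖ ≤ ‖v‖ := by
  refine le_of_sq_le_sq ?_ (norm_nonneg v)
  rw [norm_sq_eq_perp he v]; nlinarith [sq_nonneg (inner ℝ e v : ℝ)]

theorem norm_le_perp_add {e : E} (he : ‖e‖ = 1) (v : E) : ‖v‖ ≤ ‖perp e v‖ + |inner ℝ e v| := by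
  nth_rewrite 1 [← perp_add_inner_smul e v]
  refine (norm_add_le _ _).trans ?_
  rw [norm_smul, he, Real.norm_eq_abs, mul_one]

theorem continuous_perp (e : E) : Continuous (perp e) := by unfold perp; fun_prop

end Perp

/-! ### Quantitative charts of the obstacles and incoming phases -/

/-- Quantitative description of a strictly convex body `Θ` with unit normal field `n` at distance
less than `ε` from a boundary point `a` with inward normal `e`. -/
structure ObstacleChart (Θ : Set E3) (a e : E3) (n : E3 → E3) (ε ε₁ c Ln : ℝ) : Prop where
  isCompact : IsCompact Θ
  convex : Convex ℝ Θ
  mem : a ∈ Θ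
  norm_dir : ‖e‖ = 1
  normal : ∀ X ∈ frontier Θ, IsOutwardUnitNormal Θ X (n X)
  unique : ∀ X ν, IsOutwardUnitNormal Θ X ν → ν = n X
  norm_normal : ∀ x, ‖x - a‖ < 2 * ε → ‖n x‖ = 1
  near : ∀ x, ‖x - a‖ < 2 * ε → ‖n x + e‖ ≤ ε₁
  lip : ∀ x x', ‖x - a‖ < ε → ‖x' - a‖ < ε → ‖n x - n x'‖ ≤ Ln * ‖x - x'‖
  nonneg : ∀ X ∈ Θ, 0 ≤ inner ℝ e (X - a)
  quad : ∀ X ∈ Θ, ‖X - a‖ < ε → c * ‖X - a‖ ^ 2 ≤ inner ℝ e (X - a)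
  linear : ∀ X ∈ Θ, ε ≤ ‖X - a‖ → c * ε * ‖X - a‖ ≤ inner ℝ e (X - a)
  cone : ∀ X ∈ Θ, ∀ z ∉ interior Θ, ‖X - a‖ < 2 * ε → ‖z - a‖ < 2 * ε →
    inner ℝ e (z - X) ≤ ‖z - X‖ / 4

/-- The order of the quantifiers matters: `c` and `Ln` come before `ε₁`, which is later taken small
in terms of `Ln`, and every sufficiently small `ε` is allowed. -/
theorem exists_obstacleChart {Θ : Set E3} {g : E3 → ℝ} (hg : ContDiff ℝ ∞ g)
    (hΘ : Θ = {x | g x ≤ 0}) (hcomp : IsCompact Θ) (hconv : Convex ℝ Θ)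
    (hgrad : ∀ x, g x = 0 → gradient g x ≠ 0) {c₀ : ℝ} (hc₀ : 0 < c₀)
    (hcurv : ∀ x, g x = 0 → ∀ v : E3, inner ℝ (gradient g x) v = 0 →
        c₀ * ‖v‖ ^ 2 ≤ fderiv ℝ (fderiv ℝ g) x v v / ‖gradient g x‖)
    {a e : E3} (ha : IsOutwardUnitNormal Θ a (-e)) :
    ∃ c Ln : ℝ, 0 < c ∧ 0 ≤ Ln ∧ ∀ ε₁ : ℝ, 0 < ε₁ → ε₁ ≤ 1 / 4 → ∃ ε₀ : ℝ, 0 < ε₀ ∧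
      ∀ ε, 0 < ε → ε ≤ ε₀ → ObstacleChart Θ a e (unitNormal g) ε ε₁ c Ln := by
  obtain ⟨c, r₁, hc, hr₁, hquad⟩ := exists_quadratic_bound hg hΘ hgrad hc₀ hcurv ha
  have h0 := eq_zero_of_mem_frontier hg hΘ ha.2.1
  have hn := ha.eq_unitNormal hg hΘ hgrad
  have he1 : ‖e‖ = 1 := by simpa using ha.1
  have hsm := contDiffAt_unitNormal hg (hgrad a h0)
  obtain ⟨K, t, ht, hlip⟩ := (hsm.of_le (m := 1) (by simp)).exists_lipschitzOnWith
  obtain ⟨r₂, hr₂, hball⟩ := Metric.mem_nhds_iff.1 ht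
  obtain ⟨r₃, hr₃, hne⟩ := Metric.eventually_nhds_iff.1
    (hg.gradient.continuous.continuousAt.eventually_ne (hgrad a h0))
  have haΘ : a ∈ Θ := hcomp.isClosed.frontier_subset ha.2.1
  have hnonneg : ∀ X ∈ Θ, 0 ≤ inner ℝ e (X - a) := fun X hX => by
    have := ha.2.2 X hX
    rw [inner_neg_left] at this
    linarith
  refine ⟨c, K, hc, K.2, fun ε₁ hε₁ hε₁' => ?_⟩
  obtain ⟨r₄, hr₄, hnear⟩ := Metric.continuousAt_iff.1 hsm.continuousAt ε₁ hε₁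
  refine ⟨min (min r₁ r₂) (min r₃ r₄) / 2, by positivity, fun ε hε hle => ?_⟩
  have l1 : 2 * ε ≤ min (min r₁ r₂) (min r₃ r₄) := by linarith
  have l2 := l1.trans (min_le_left _ _)
  have l3 := l1.trans (min_le_right _ _)
  have hnear' : ∀ x, ‖x - a‖ < 2 * ε → ‖unitNormal g x + e‖ ≤ ε₁ := fun x hx => by
    have := @hnear x (by rw [dist_eq_norm]; exact hx.trans_le (l3.trans (min_le_right _ _)))
    rw [← hn, dist_eq_norm, sub_neg_eq_add] at this
    exact this.le
  have hne' : ∀ x, ‖x - a‖ < 2 * ε → gradient g x ≠ 0 := fun x hx =>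
    hne (by rw [dist_eq_norm]; exact hx.trans_le (l3.trans (min_le_left _ _)))
  have hquad' : ∀ X ∈ Θ, ‖X - a‖ < 2 * ε → c * ‖X - a‖ ^ 2 ≤ inner ℝ e (X - a) := fun X hX h =>
    hquad X hX (h.trans_le (l2.trans (min_le_left _ _)))
  refine ⟨hcomp, hconv, haΘ, he1, fun X hX => isOutwardUnitNormal_unitNormal hg hΘ hconv hgrad hX,
    fun X ν hν => hν.eq_unitNormal hg hΘ hgrad, fun x hx => norm_unitNormal (hne' x hx), hnear',
    ?_, hnonneg, fun X hX h => hquad' X hX (by linarith), ?_, ?_⟩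
  · intro x x' hx hx'
    have hin : ∀ y, ‖y - a‖ < ε → y ∈ t := fun y hy => hball (by
      rw [Metric.mem_ball, dist_eq_norm]
      have := l2.trans (min_le_right _ _)
      linarith)
    simpa [dist_eq_norm] using hlip.dist_le_mul x (hin x hx) x' (hin x' hx')
  · intro X hX hXε
    have hpos : 0 < ‖X - a‖ := hε.trans_le hXε
    -- The point of the segment `[a, X]` at distance `ε` from `a` lies in `Θ`. The quadratic bound
    -- there, scaled back to `X`, is the linear bound.
    set s := ε / ‖X - a‖ with hs
    have hs0 : 0 < s := by positivity
    have hs1 : s ≤ 1 := (div_le_one hpos).2 hXε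
    have hZ : a + s • (X - a) ∈ Θ := by
      have := hconv haΘ hX (sub_nonneg.2 hs1) hs0.le (by ring)
      rwa [show (1 - s) • a + s • X = a + s • (X - a) by module] at this
    have hnorm : ‖s • (X - a)‖ = ε := by
      rw [norm_smul, Real.norm_of_nonneg hs0.le, hs, div_mul_cancel₀ _ hpos.ne']
    have := hquad' _ hZ (by rw [add_sub_cancel_left, hnorm]; linarith)
    rw [add_sub_cancel_left, hnorm, inner_smul_right, hs, div_mul_eq_mul_div, le_div_iff₀ hpos]
      at this
    have h2 : ε * (c * ε * ‖X - a‖) ≤ ε * inner ℝ e (X - a) := by linarith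
    exact le_of_mul_le_mul_left h2 hε
  · intro X hX z hz hXa hza
    have hgX : g X ≤ 0 := by rw [hΘ] at hX; exact hX
    have hgz : 0 ≤ g z := not_lt.1 fun h => hz (mem_interior_of_neg hg hΘ h)
    -- Since `g X ≤ 0 ≤ g z`, some normal at an intermediate point has nonnegative product with `z -
    -- X`, and this normal is close to `-e`.
    obtain ⟨ζ, hζ, eζ⟩ := domain_mvt (f := g) (s := Metric.ball a (2 * ε)) (x := X) (y := z)
      (f' := fun x => InnerProductSpace.toDual ℝ E3 (gradient g x))
      (fun x _ => (hg.hasGradientAt x).hasFDerivAt.hasFDerivWithinAt) (convex_ball a (2 * ε))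
      (by rwa [Metric.mem_ball, dist_eq_norm]) (by rwa [Metric.mem_ball, dist_eq_norm])
    have hζa : ‖ζ - a‖ < 2 * ε := by
      rw [← dist_eq_norm, ← Metric.mem_ball]
      exact (convex_ball a (2 * ε)).segment_subset (by rwa [Metric.mem_ball, dist_eq_norm])
        (by rwa [Metric.mem_ball, dist_eq_norm]) hζ
    have h1 : 0 ≤ inner ℝ (unitNormal g ζ) (z - X) := by
      rw [unitNormal, inner_smul_left]
      refine mul_nonneg (by simp) ?_
      have : inner ℝ (gradient g ζ) (z - X) = g z - g X := eζ.symm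
      rw [this]; linarith
    have h2 := real_inner_le_norm (unitNormal g ζ + e) (z - X)
    have h3 : ‖unitNormal g ζ + e‖ * ‖z - X‖ ≤ 1 / 4 * ‖z - X‖ :=
      mul_le_mul_of_nonneg_right ((hnear' ζ hζa).trans hε₁') (norm_nonneg _)
    rw [inner_add_left] at h2
    linarith

/-- The part of the tube of radius `R` around the axis at distance less than `ε` from `a`. -/
def tubeBall (a e : E3) (ε R : ℝ) : Set E3 := {z | ‖z - a‖ < ε ∧ ‖perp e (z - a)‖ < R}

theorem isOpen_tubeBall (a e : E3) (ε R : ℝ) : IsOpen (tubeBall a e ε R) := by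
  have := continuous_perp e
  have h1 : Continuous fun z => ‖z - a‖ := by fun_prop
  have h2 : Continuous fun z => ‖perp e (z - a)‖ := by fun_prop
  exact (isOpen_lt h1 continuous_const).inter (isOpen_lt h2 continuous_const)

/-- A convex phase whose rays `p` arrive near `a` almost in the direction `e`, and almost diverge
from the axis. -/
structure IncomingPhase (a e : E3) (ε ε₁ κ R η : ℝ) (M : E3 → ℝ) (p : E3 → E3) : Prop where
  continuous : Continuous M
  convex : ConvexOn ℝ Set.univ M
  grad : ∀ z ∈ tubeBall a e ε R, HasGradientAt M (p z) z
  norm_eq : ∀ z ∈ tubeBall a e ε R, ‖p z‖ = 1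
  near : ∀ z ∈ tubeBall a e ε R, ‖p z - e‖ ≤ ε₁
  slope : ∀ z ∈ tubeBall a e ε R, -η * ‖perp e (z - a)‖ ≤ inner ℝ (perp e (z - a)) (p z)
  center : ‖p a - e‖ ≤ κ

/-! ### One reflection -/

section OneStep

variable {Θ : Set E3} {a e : E3} {n : E3 → E3} {ε ε₁ c Ln κ R η ρ : ℝ} {M : E3 → ℝ} {p : E3 → E3}

theorem le_neg_inner_of_near {ν p e : E3} (hp : ‖p‖ = 1) (he : ‖e‖ = 1) (hν : ‖ν + e‖ ≤ ε₁)
    (hpe : ‖p - e‖ ≤ ε₁) : 1 - 2 * ε₁ ≤ -inner ℝ ν p := by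
  have h1 := real_inner_le_norm (ν + e) p
  rw [hp, mul_one, inner_add_left] at h1
  have h2 := real_inner_le_norm e (e - p)
  rw [he, one_mul, inner_sub_right, real_inner_self_eq_norm_sq, he, norm_sub_rev] at h2
  linarith

theorem ObstacleChart.le_neg_inner (hch : ObstacleChart Θ a e n ε ε₁ c Ln)
    (hin : IncomingPhase a e ε ε₁ κ R η M p) {X : E3} (hX : X ∈ tubeBall a e ε R) :
    1 - 2 * ε₁ ≤ -inner ℝ (n X) (p X) :=
  le_neg_inner_of_near (hin.norm_eq X hX) hch.norm_dir
    (hch.near X (by linarith [hX.1, norm_nonneg (X - a)])) (hin.near X hX)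

/-- Every point behind the obstacle, near the axis, is reached by a reflected ray. -/
theorem ObstacleChart.exists_foot (hch : ObstacleChart Θ a e n ε ε₁ c Ln)
    (hin : IncomingPhase a e ε ε₁ (c * ε) R η M p) (hε : 0 < ε) (hc : 0 < c) (hε₁ : ε₁ ≤ 1 / 4)
    (hη : 0 ≤ η) (hηR : 4 * η < c * R) (hρ : 0 ≤ ρ) (hR : 0 < R)
    (hκ : 2 * ρ + R < c * ε * ε) (hρε : ρ ≤ ε / 4) {z : E3} (hz : z ∉ interior Θ)
    (hzR : ‖perp e (z - a)‖ < R) (hzρ : inner ℝ e (z - a) ≤ ρ) :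
    ∃ X ∈ frontier Θ, X ∈ tubeBall a e ε R ∧
      ∃ τ : ℝ, 0 ≤ τ ∧ z = X + τ • reflectDir (n X) (p X) ∧
        (z ∉ Θ → ‖perp e (z - a)‖ ≤ ‖perp e (X - a)‖ → c * ‖X - a‖ ≤ 2 * η) := by
  have he := hch.norm_dir
  -- A boundary point is its own foot, with `τ = 0`. The linear growth bound and `energy` smallness
  -- place it within `ε` of `a`.
  by_cases hzΘ : z ∈ Θ
  · have hzf : z ∈ frontier Θ := ⟨subset_closure hzΘ, hz⟩
    refine ⟨z, hzf, ⟨?_, hzR⟩, 0, le_rfl, by simp, fun h => absurd hzΘ h⟩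
    by_contra hcon
    push Not at hcon
    have h1 := hch.linear z hzΘ hcon
    have h2 : c * ε * ε ≤ c * ε * ‖z - a‖ := mul_le_mul_of_nonneg_left hcon (by positivity)
    linarith
  have hat : a ∈ tubeBall a e ε R := by
    have : perp e (0 : E3) = 0 := by simp [perp]
    simp [tubeBall, this, hε, hR]
  -- The gradient of `M` is known only in the tube of radius `R`, so the minimum is first taken over
  -- a thinner tube. It is then shown not to lie on the lateral boundary of that tube.
  set R' := max ‖perp e (z - a)‖ (R / 2) with hR'
  have hR'R : R' < R := max_lt hzR (by linarith)
  have hR'0 : R / 2 ≤ R' := le_max_right _ _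
  have hcp := continuous_perp e
  have hconvN : Convex ℝ {Y : E3 | ‖perp e (Y - a)‖ ≤ R'} := by
    intro Y hY Y' hY' s t hs ht hst
    have : s • Y + t • Y' - a = s • (Y - a) + t • (Y' - a) := by
      have : a = (s + t) • a := by rw [hst, one_smul]
      nth_rewrite 1 [this]; module
    simp only [Set.mem_ofPred_eq] at *
    rw [this, perp_add, perp_smul, perp_smul]
    refine (norm_add_le _ _).trans ?_
    rw [norm_smul, norm_smul, Real.norm_of_nonneg hs, Real.norm_of_nonneg ht]
    nlinarith
  set K := Θ ∩ {Y : E3 | ‖perp e (Y - a)‖ ≤ R'} with hK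
  have hKc : IsCompact K :=
    hch.isCompact.inter_right (isClosed_le (by fun_prop) continuous_const)
  have hKconv : Convex ℝ K := hch.convex.inter hconvN
  have haK : a ∈ K := ⟨hch.mem, by
    simp only [Set.mem_ofPred_eq, sub_self]
    rw [show perp e (0 : E3) = 0 by simp [perp], norm_zero]; linarith⟩
  have hMcont := hin.continuous
  obtain ⟨X, hXK, hmin⟩ := hKc.exists_isMinOn ⟨a, haK⟩
    (by fun_prop : ContinuousOn (fun Y => M Y + ‖Y - z‖) K)
  have hmin' : ∀ W ∈ K, M X + ‖X - z‖ ≤ M W + ‖W - z‖ := fun W hW => hmin hW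
  have hXz : X ≠ z := fun h => hzΘ (h ▸ hXK.1)
  -- Compare with the competitor `a`. Away from `a` the optical length exceeds the one through `a`
  -- by at least `2 ⟪e, X - a⟫ - c ε ‖X - a‖` minus `2 ρ + R`. The linear bound makes the first
  -- difference at least `c ε ‖X - a‖`, which is too large.
  have hXa : ‖X - a‖ < ε := by
    by_contra hcon
    push Not at hcon
    have h1 := hmin' a haK
    have h2 := hin.convex.add_inner_le (hin.grad a hat) X
    have h3 : -(c * ε * ‖X - a‖) ≤ inner ℝ (p a - e) (X - a) := by
      have := abs_real_inner_le_norm (p a - e) (X - a)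
      have h4 := mul_le_mul_of_nonneg_right hin.center (norm_nonneg (X - a))
      linarith [(abs_le.1 this).1]
    rw [inner_sub_left] at h3
    have h4 := hch.linear X hXK.1 hcon
    have h5 : inner ℝ e (X - z) ≤ ‖X - z‖ := by
      simpa [he] using real_inner_le_norm e (X - z)
    have h6 : inner ℝ e (X - z) = inner ℝ e (X - a) - inner ℝ e (z - a) := by
      rw [← inner_sub_right]; congr 1; abel
    have h7 := norm_le_perp_add he (z - a)
    rw [norm_sub_rev a z] at h1
    have h8 : |inner ℝ e (z - a)| ≤ -inner ℝ e (z - a) + 2 * ρ := by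
      rw [abs_le]; constructor <;> linarith
    have h9 : c * ε * ε ≤ c * ε * ‖X - a‖ := mul_le_mul_of_nonneg_left hcon (by positivity)
    linarith
  have hXW : X ∈ tubeBall a e ε R := ⟨hXa, lt_of_le_of_lt hXK.2 hR'R⟩
  set u := ‖z - X‖⁻¹ • (z - X) with hu
  have hzX : 0 < ‖z - X‖ := norm_pos_iff.2 (sub_ne_zero.2 hXz.symm)
  have hu1 : ‖u‖ = 1 := by
    rw [hu, norm_smul, norm_inv, norm_norm, inv_mul_cancel₀ hzX.ne']
  have hfo : ∀ Y ∈ K, 0 ≤ inner ℝ (p X - u) (Y - X) := fun Y hY =>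
    first_order_of_isMinOn hKconv hXK hY hmin' (hin.grad X hXW) hXz
  -- The outgoing direction differs from the incoming one, which is nearly `e`. This excludes a path
  -- that passes straight through the obstacle.
  have hue : inner ℝ e u ≤ 1 / 4 := by
    have : inner ℝ e (z - X) ≤ ‖z - X‖ / 4 := by
      by_cases hza : ‖z - a‖ < 2 * ε
      · exact hch.cone X hXK.1 z hz (by linarith) hza
      · push Not at hza
        have h1 : ‖z - a‖ ≤ ‖z - X‖ + ‖X - a‖ := by
          rw [show z - a = (z - X) + (X - a) by abel]; exact norm_add_le _ _
        have h2 := hch.nonneg X hXK.1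
        have h3 : inner ℝ e (z - X) = inner ℝ e (z - a) - inner ℝ e (X - a) := by
          rw [← inner_sub_right]; congr 1; abel
        linarith
    rw [hu, inner_smul_right, inv_mul_le_iff₀ hzX]; linarith
  have hpe : 3 / 4 ≤ inner ℝ e (p X) := by
    have h2 := real_inner_le_norm e (e - p X)
    rw [he, one_mul, inner_sub_right, real_inner_self_eq_norm_sq, he, norm_sub_rev] at h2
    linarith [hin.near X hXW]
  have hup : u ≠ p X := fun h => by rw [h] at hue; linarith
  -- The first order condition is tested at `Y = a`. If the outgoing ray does not move away from the
  -- axis, the only possible gain is the slope error `η ‖X - a‖`, whereas the curvature costs at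
  -- least `c ‖X - a‖² / 2`.
  have htest : ‖perp e (z - a)‖ ≤ ‖perp e (X - a)‖ → c * ‖X - a‖ ≤ 2 * η := by
    intro hle
    have h1 := hfo a haK
    set w := perp e (X - a) with hw
    set b : ℝ := inner ℝ e (X - a) with hb
    have hdec : a - X = -(w + b • e) := by rw [hw, hb, perp_add_inner_smul]; abel
    rw [hdec, inner_neg_right, inner_add_right, inner_smul_right, inner_sub_left, inner_sub_left,
      real_inner_comm w (p X), real_inner_comm w u, real_inner_comm e (p X),
      real_inner_comm e u] at h1
    have h2 := hin.slope X hXW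
    rw [← hw] at h2
    have h3 : inner ℝ w u ≤ 0 := by
      rw [hu, inner_smul_right]
      refine mul_nonpos_of_nonneg_of_nonpos (by positivity) ?_
      have e1 : z - X = (z - a) + (-1 : ℝ) • (X - a) := by module
      rw [hw, ← inner_perp_perp he, e1, perp_add, perp_smul, ← hw, inner_add_right,
        inner_smul_right, real_inner_self_eq_norm_sq]
      have := real_inner_le_norm w (perp e (z - a))
      have h4 := mul_le_mul_of_nonneg_left hle (norm_nonneg w)
      nlinarith
    have hb0 : 0 ≤ b := hch.nonneg X hXK.1
    have h4 := hch.quad X hXK.1 hXa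
    have h5 : ‖w‖ ≤ ‖X - a‖ := norm_perp_le he _
    have h6 : b * (1 / 2) ≤ b * (inner ℝ e (p X) - inner ℝ e u) :=
      mul_le_mul_of_nonneg_left (by linarith) hb0
    have h7 : η * ‖w‖ ≤ η * ‖X - a‖ := mul_le_mul_of_nonneg_left h5 hη
    have h8 : (c * ‖X - a‖) * ‖X - a‖ ≤ (2 * η) * ‖X - a‖ := by linarith
    rcases (norm_nonneg (X - a)).eq_or_lt with h9 | h9
    · rw [← h9]; linarith
    · exact le_of_mul_le_mul_right h8 h9
  -- Either the foot is closer to the axis than `z`, or its distance to the axis is at most `2 η / c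
  -- < R / 2`.
  have hXR' : ‖perp e (X - a)‖ < R' := by
    by_cases hle : ‖perp e (z - a)‖ ≤ ‖perp e (X - a)‖
    · have h1 := htest hle
      have h2 : c * ‖perp e (X - a)‖ ≤ c * ‖X - a‖ :=
        mul_le_mul_of_nonneg_left (norm_perp_le he _) hc.le
      have h3 : c * ‖perp e (X - a)‖ < c * (R / 2) := by linarith
      exact (lt_of_mul_lt_mul_left h3 hc.le).trans_le hR'0
    · push Not at hle
      exact hle.trans_le (le_max_left _ _)
  -- As the lateral constraint is inactive at `X`, a short step towards any `Y ∈ Θ` stays in `K`.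
  have hfoΘ : ∀ Y ∈ Θ, 0 ≤ inner ℝ (p X - u) (Y - X) := by
    intro Y hY
    have hcont : Continuous fun t : ℝ => ‖perp e (X + t • (Y - X) - a)‖ := by fun_prop
    have hev : ∀ᶠ t : ℝ in nhdsWithin 0 (Set.Ioi 0), ‖perp e (X + t • (Y - X) - a)‖ < R' :=
      nhdsWithin_le_nhds (hcont.continuousAt.eventually_lt_const (by simpa using hXR'))
    obtain ⟨t, ht, ht01⟩ := (hev.and (Ioo_mem_nhdsGT one_pos)).exists
    have hmem : X + t • (Y - X) ∈ K := by
      refine ⟨?_, ht.le⟩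
      have := hch.convex hXK.1 hY (sub_nonneg.2 ht01.2.le) ht01.1.le (by ring)
      rwa [show (1 - t) • X + t • Y = X + t • (Y - X) by module] at this
    have h1 := hfo _ hmem
    rw [add_sub_cancel_left, inner_smul_right] at h1
    exact nonneg_of_mul_nonneg_right h1 ht01.1
  set ν := ‖u - p X‖⁻¹ • (u - p X) with hν
  have hν1 : ‖ν‖ = 1 := norm_normalize (sub_ne_zero.2 hup)
  have hνY : ∀ Y ∈ Θ, inner ℝ ν (Y - X) ≤ 0 := fun Y hY => by
    rw [hν, inner_smul_left]
    refine mul_nonpos_of_nonneg_of_nonpos (by simp) ?_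
    have := hfoΘ Y hY
    rw [inner_sub_left] at this ⊢
    linarith
  have hXf : X ∈ frontier Θ := by
    refine ⟨subset_closure hXK.1, fun hint => ?_⟩
    obtain ⟨r, hr, hball⟩ := Metric.isOpen_iff.1 isOpen_interior X hint
    have hmem : X + (r / 2) • ν ∈ Θ := interior_subset (hball (by
      rw [Metric.mem_ball, dist_eq_norm, add_sub_cancel_left, norm_smul, hν1,
        Real.norm_of_nonneg (by positivity)]; linarith))
    have := hνY _ hmem
    rw [add_sub_cancel_left, inner_smul_right, real_inner_self_eq_norm_sq, hν1] at this
    linarith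
  have hνn : ν = n X := hch.unique X ν ⟨hν1, hXf, hνY⟩
  refine ⟨X, hXf, hXW, ‖z - X‖, hzX.le, ?_, fun _ => htest⟩
  rw [← hνn, hν, reflectDir_eq (hin.norm_eq X hXW) hu1 hup, hu, smul_smul,
    mul_inv_cancel₀ hzX.ne', one_smul]
  abel

/-- Outgoing rays still almost diverge from the axis. -/
theorem ObstacleChart.slope_reflected (hch : ObstacleChart Θ a e n ε ε₁ c Ln)
    (hin : IncomingPhase a e ε ε₁ κ R η M p) (hε₁ : ε₁ ≤ 1 / 4) (hη : 0 ≤ η) {X : E3} {τ : ℝ}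
    (hXf : X ∈ frontier Θ) (hX : X ∈ tubeBall a e ε R) (hτ : 0 ≤ τ) :
    -η * ‖perp e (X + τ • reflectDir (n X) (p X) - a)‖ ≤
      inner ℝ (perp e (X + τ • reflectDir (n X) (p X) - a)) (reflectDir (n X) (p X)) := by
  have he := hch.norm_dir
  set q := reflectDir (n X) (p X) with hq
  have e1 : perp e (X + τ • q - a) = perp e (X - a) + τ • perp e q := by
    rw [show X + τ • q - a = (X - a) + τ • q by abel, perp_add, perp_smul]
  rw [← inner_perp_perp he, e1]
  refine slope_mono hτ hη ?_
  rw [inner_perp_perp he, hq, reflectDir, inner_sub_right, inner_smul_right]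
  have h1 := hin.slope X hX
  have h2 := hch.le_neg_inner hin hX
  have hXΘ : X ∈ Θ := hch.isCompact.isClosed.frontier_subset hXf
  -- Convexity with `a ∈ Θ` makes the normal at `X` lean away from the axis, so reflection can only
  -- increase the slope.
  have h3 : 0 ≤ inner ℝ (perp e (X - a)) (n X) := by
    have hb := hch.nonneg X hXΘ
    have h4 := (hch.normal X hXf).2.2 a hch.mem
    have h5 := hch.near X (by linarith [hX.1, norm_nonneg (X - a)])
    have h6 : inner ℝ (n X) e ≤ 0 := by
      have := real_inner_le_norm (n X + e) e
      rw [he, mul_one, inner_add_left, real_inner_self_eq_norm_sq, he] at this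
      linarith
    have h7 : inner ℝ (n X) (a - X) =
        -(inner ℝ (perp e (X - a)) (n X) + inner ℝ e (X - a) * inner ℝ (n X) e) := by
      rw [show a - X = -(X - a) by abel, inner_neg_right]
      nth_rewrite 1 [← perp_add_inner_smul e (X - a)]
      rw [inner_add_right, inner_smul_right, real_inner_comm (perp e (X - a))]
    have := mul_nonpos_of_nonneg_of_nonpos hb h6
    linarith
  have h8 : 0 ≤ -inner ℝ (n X) (p X) * inner ℝ (perp e (X - a)) (n X) :=
    mul_nonneg (by linarith) h3
  linarith

theorem ObstacleChart.norm_reflected_add_le (hch : ObstacleChart Θ a e n ε ε₁ c Ln)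
    (hin : IncomingPhase a e ε ε₁ κ R η M p) {X : E3} (hX : X ∈ tubeBall a e ε R) :
    ‖reflectDir (n X) (p X) + e‖ ≤ 7 * ε₁ := by
  have h2 : ‖X - a‖ < 2 * ε := by linarith [hX.1, norm_nonneg (X - a)]
  have := norm_reflectDir_add_le (p := p X) (hch.norm_normal X h2) hch.norm_dir
  linarith [hin.near X hX, hch.near X h2]

/-- Points on an outgoing ray lie outside the obstacle. -/
theorem ObstacleChart.reflected_notMem (hch : ObstacleChart Θ a e n ε ε₁ c Ln)
    (hin : IncomingPhase a e ε ε₁ κ R η M p) (hε₁ : ε₁ ≤ 1 / 4) {X : E3} {τ : ℝ}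
    (hXf : X ∈ frontier Θ) (hX : X ∈ tubeBall a e ε R) (hτ : 0 < τ) :
    X + τ • reflectDir (n X) (p X) ∉ Θ := by
  intro hmem
  have h1 := (hch.normal X hXf).2.2 _ hmem
  have h2 := hch.le_neg_inner hin hX
  rw [add_sub_cancel_left, inner_smul_right, reflectDir, inner_sub_right, inner_smul_right,
    real_inner_self_eq_norm_sq, (hch.normal X hXf).1] at h1
  nlinarith

/-- Lipschitz dependence of the reflection point. -/
theorem ObstacleChart.foot_sub_le (hch : ObstacleChart Θ a e n ε ε₁ c Ln)
    {M' : E3 → ℝ} {p' : E3 → E3} {T Lp E₀ : ℝ}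
    (hin : IncomingPhase a e ε ε₁ κ R η M p) (hin' : IncomingPhase a e ε ε₁ κ R η M' p')
    (hε₁ : ε₁ ≤ 1 / 14) {X X' : E3} {τ τ' : ℝ} (hXf : X ∈ frontier Θ) (hX : X ∈ tubeBall a e ε R)
    (hX'f : X' ∈ frontier Θ) (hX' : X' ∈ tubeBall a e ε R) (hτ : 0 ≤ τ) (hτT : τ ≤ T)
    (hE : ‖p X - p' X‖ ≤ E₀) (hLp : ‖p' X - p' X'‖ ≤ Lp * ‖X - X'‖)
    (hsmall : 2 * ε₁ + 2 * T * (7 * ε₁) * (3 * Lp + 4 * Ln) ≤ 1 / 2) :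
    ‖X - X'‖ ≤ 6 * ‖(X + τ • reflectDir (n X) (p X)) - (X' + τ' • reflectDir (n X') (p' X'))‖
      + 16 * T * E₀ := by
  have he := hch.norm_dir
  have hXΘ : X ∈ Θ := hch.isCompact.isClosed.frontier_subset hXf
  have hX'Θ : X' ∈ Θ := hch.isCompact.isClosed.frontier_subset hX'f
  have hn := (hch.normal X hXf).1
  have hn' := (hch.normal X' hX'f).1
  have o1 := (hch.normal X hXf).2.2 X' hX'Θ
  have o2 := (hch.normal X' hX'f).2.2 X hXΘ
  have hpp : ‖p X - p' X'‖ ≤ E₀ + Lp * ‖X - X'‖ := by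
    rw [show p X - p' X' = (p X - p' X) + (p' X - p' X') by abel]
    exact (norm_add_le _ _).trans (by linarith)
  have hneg : X' - X = -(X - X') := by abel
  rw [hneg, inner_neg_right] at o1
  have nr1 := hch.near X (by linarith [hX.1, norm_nonneg (X - a)])
  have nr2 := hch.near X' (by linarith [hX'.1, norm_nonneg (X' - a)])
  refine _root_.foot_sub_le (e := e) (L := 3 * Lp + 4 * Ln) he ?_ ?_
    (hch.norm_reflected_add_le hin hX) (hch.norm_reflected_add_le hin' hX') (by linarith) ?_ ?_
    ((norm_nonneg _).trans hE) ?_ hτ hτT hsmall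
  · rw [norm_reflectDir hn, hin.norm_eq X hX]
  · rw [norm_reflectDir hn', hin'.norm_eq X' hX']
  · have b1 := real_inner_le_norm (n X + e) (X - X')
    have b2 := abs_real_inner_le_norm (n X' + e) (X - X')
    have b3 := (abs_le.1 b2).1
    have c1 := mul_le_mul_of_nonneg_right nr1 (norm_nonneg (X - X'))
    have c2 := mul_le_mul_of_nonneg_right nr2 (norm_nonneg (X - X'))
    rw [inner_add_left] at b1 b3
    rw [abs_le]; constructor <;> linarith
  · have m1 := hin'.convex.inner_gradient_sub_nonneg (hin'.grad X hX) (hin'.grad X' hX')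
    have m2 := abs_real_inner_le_norm (X - X') (p X - p' X)
    have m3 := (abs_le.1 m2).1
    have m4 := mul_le_mul_of_nonneg_left hE (norm_nonneg (X - X'))
    have k1 := hch.le_neg_inner hin hX
    have k2 := hch.le_neg_inner hin' hX'
    have e1 : inner ℝ (X - X') (reflectDir (n X) (p X) - reflectDir (n X') (p' X')) =
        inner ℝ (X - X') (p X - p' X) + inner ℝ (X - X') (p' X - p' X')
        + 2 * (-inner ℝ (n X) (p X)) * inner ℝ (n X) (X - X')
        - 2 * (-inner ℝ (n X') (p' X')) * inner ℝ (n X') (X - X') := by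
      rw [real_inner_comm (X - X') (n X), real_inner_comm (X - X') (n X')]
      simp only [reflectDir, inner_sub_right, inner_smul_right]
      ring
    rw [e1]
    have s1 : 0 ≤ 2 * (-inner ℝ (n X) (p X)) * inner ℝ (n X) (X - X') :=
      mul_nonneg (by linarith) (by linarith)
    have s2 : 2 * (-inner ℝ (n X') (p' X')) * inner ℝ (n X') (X - X') ≤ 0 :=
      mul_nonpos_of_nonneg_of_nonpos (by linarith) o2
    linarith
  · have h1 := norm_reflectDir_sub_le (p := p X) hn hn' (hin'.norm_eq X' hX')
    have h2 := hch.lip X X' hX.1 hX'.1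
    linarith

end OneStep

/-! ### Tools for smoothness -/

section Smoothness

/-- A function solving a smooth equation that is nondegenerate in the unknown is smooth as soon as
it is continuous. -/
theorem contDiffAt_of_implicit {E₁ E₂ F : Type*} [NormedAddCommGroup E₁] [NormedSpace ℝ E₁]
    [CompleteSpace E₁] [NormedAddCommGroup E₂] [NormedSpace ℝ E₂] [CompleteSpace E₂]
    [NormedAddCommGroup F] [NormedSpace ℝ F] [CompleteSpace F] {f : E₁ × E₂ → F} {u : E₁ → E₂}
    {x : E₁} (hf : ContDiffAt ℝ ∞ f (x, u x))
    (hinv : (fderiv ℝ f (x, u x) ∘L .inr ℝ E₁ E₂).IsInvertible) (hu : ContinuousAt u x)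
    (heq : ∀ᶠ x' in nhds x, f (x', u x') = f (x, u x)) : ContDiffAt ℝ ∞ u x := by
  have h1 := hf.eventually_apply_eq_iff_implicitFunction (by simp) hinv
  have h2 : Filter.Tendsto (fun x' => (x', u x')) (nhds x) (nhds (x, u x)) :=
    (continuousAt_id.prodMk hu)
  have h3 := h2.eventually h1
  have h4 := hf.contDiffAt_implicitFunction (by simp) hinv
  refine h4.congr_of_eventuallyEq ?_
  filter_upwards [h3, heq] with x' hx' hx''
  exact (hx'.1 hx'').symm

/-- A function that is smooth near a compact set agrees there with a globally smooth function. -/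
theorem exists_contDiff_eqOn {E F : Type*} [NormedAddCommGroup E] [NormedSpace ℝ E]
    [FiniteDimensional ℝ E] [NormedAddCommGroup F] [NormedSpace ℝ F] {N : Set E} (hN : IsCompact N)
    {f : E → F} (hf : ∀ x ∈ N, ∀ᶠ y in nhds x, ContDiffAt ℝ ∞ f y) :
    ∃ f' : E → F, ContDiff ℝ ∞ f' ∧ Set.EqOn f' f N := by
  set V := {x | ∀ᶠ y in nhds x, ContDiffAt ℝ ∞ f y} with hV
  have hVo : IsOpen V := by
    rw [isOpen_iff_mem_nhds]
    exact fun x hx => eventually_eventually_nhds.2 hx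
  obtain ⟨t, ht, hNt, htV⟩ := exists_compact_between hN hVo hf
  obtain ⟨b, hb1, hb0, -⟩ := exists_contMDiffMap_one_nhds_of_subset_interior (n := ⊤)
    (modelWithCornersSelf ℝ E) hN.isClosed hNt
  have hbs : ContDiff ℝ ∞ b := b.contMDiff.contDiff
  refine ⟨fun x => b x • f x, contDiff_iff_contDiffAt.2 fun x => ?_, fun x hx => ?_⟩
  · by_cases hx : x ∈ t
    · exact hbs.contDiffAt.smul (htV hx).self_of_nhds
    · have : (fun x => b x • f x) =ᶠ[nhds x] fun _ => 0 := by
        filter_upwards [ht.isClosed.isOpen_compl.mem_nhds hx] with y hy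
        rw [hb0 y hy, zero_smul]
      exact contDiffAt_const.congr_of_eventuallyEq this
  · have : b x = 1 := hb1.self_of_nhdsSet x hx
    simp [this]

theorem ContDiff.exists_iteratedFDeriv_bound {E F : Type*} [NormedAddCommGroup E]
    [NormedSpace ℝ E] [NormedAddCommGroup F] [NormedSpace ℝ F] {f : E → F} (hf : ContDiff ℝ ∞ f)
    {N : Set E} (hN : IsCompact N) (m : ℕ) :
    ∃ C : ℝ, 1 ≤ C ∧ ∀ i ≤ m, ∀ x ∈ N, ‖iteratedFDeriv ℝ i f x‖ ≤ C := by
  have h : ∀ i, ∃ C : ℝ, ∀ x ∈ N, ‖iteratedFDeriv ℝ i f x‖ ≤ C := fun i =>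
    hN.exists_bound_of_continuousOn
      (hf.continuous_iteratedFDeriv (m := i) (by exact_mod_cast le_top)).continuousOn
  choose C hC using h
  refine ⟨1 + ∑ i ∈ Finset.range (m + 1), |C i|, ?_, fun i hi x hx => ?_⟩
  · have := Finset.sum_nonneg (s := Finset.range (m + 1)) fun i _ => abs_nonneg (C i)
    linarith
  · have h1 := Finset.single_le_sum (s := Finset.range (m + 1)) (f := fun i => |C i|)
      (fun i _ => abs_nonneg (C i)) (Finset.mem_range.2 (Nat.lt_succ_of_le hi))
    linarith [hC i x hx, le_abs_self (C i)]

end Smoothness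

/-! ### The billiard map on states of rays -/

section ReflectionMap

/-- The point of the line `z + ℝ p` in the plane of the points `w` with `⟪e, w - a'⟫ = s`. -/
noncomputable def slide (a' e z : E3) (s : ℝ) (p : E3) : E3 :=
  z + ((s - inner ℝ e (z - a')) / inner ℝ e p) • p

theorem inner_slide (a' e z : E3) (s : ℝ) {p : E3} (hp : inner ℝ e p ≠ 0) :
    inner ℝ e (slide a' e z s p - a') = s := by
  rw [slide, show z + ((s - inner ℝ e (z - a')) / inner ℝ e p) • p - a' =
    (z - a') + ((s - inner ℝ e (z - a')) / inner ℝ e p) • p by abel, inner_add_right,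
    inner_smul_right, div_mul_cancel₀ _ hp]
  ring

/-- The slid point depends only on the line, so the coding of a ray may use its foot or its end
indifferently. -/
theorem slide_add_smul (a' e z : E3) (s t : ℝ) {p : E3} (hp : inner ℝ e p ≠ 0) :
    slide a' e (z + t • p) s p = slide a' e z s p := by
  rw [slide, slide, show z + t • p - a' = (z - a') + t • p by abel, inner_add_right,
    inner_smul_right, add_assoc, ← add_smul]
  congr 2
  field_simp
  ring

theorem slide_slide (a' e z : E3) (s t : ℝ) {p : E3} (hp : inner ℝ e p ≠ 0) :
    slide a' e (slide a' e z s p) t p = slide a' e z t p := by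
  nth_rewrite 2 [slide]
  exact slide_add_smul a' e z t _ hp

theorem slide_eq_self (a' e z p : E3) : slide a' e z (inner ℝ e (z - a')) p = z := by
  simp [slide]

theorem contDiffAt_slide {E : Type*} [NormedAddCommGroup E] [NormedSpace ℝ E] (a' e : E3)
    {z p : E → E3} {s : E → ℝ} {x : E} (hz : ContDiffAt ℝ ∞ z x) (hs : ContDiffAt ℝ ∞ s x)
    (hp : ContDiffAt ℝ ∞ p x) (h : inner ℝ e (p x) ≠ 0) :
    ContDiffAt ℝ ∞ (fun y => slide a' e (z y) (s y) (p y)) x := by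
  unfold slide
  exact hz.add (((hs.sub (contDiffAt_const.inner ℝ (hz.sub contDiffAt_const))).div
    (contDiffAt_const.inner ℝ hp) h).smul hp)

theorem contDiffAt_reflectDir {E : Type*} [NormedAddCommGroup E] [NormedSpace ℝ E]
    {ν p : E → E3} {x : E} (hν : ContDiffAt ℝ ∞ ν x) (hp : ContDiffAt ℝ ∞ p x) :
    ContDiffAt ℝ ∞ (fun y => reflectDir (ν y) (p y)) x := by
  unfold reflectDir
  exact hp.sub ((contDiffAt_const.mul (hν.inner ℝ hp)).smul hν)

variable {Θ : Set E3} {g : E3 → ℝ}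

/-- The time at which a ray close to the axis hits the hypersurface `g = 0` near `a`. -/
theorem exists_hittingTime (hg : ContDiff ℝ ∞ g) {a e : E3} (h0 : g a = 0)
    (hne : inner ℝ (gradient g a) e ≠ 0) :
    ∃ (r : ℝ) (ψ : E3 × E3 → ℝ), 0 < r ∧
      (∀ w p, ‖w - a‖ < r → ‖p - e‖ < r → ContDiffAt ℝ ∞ ψ (w, p)) ∧
      ∀ w p t, ‖w - a‖ < r → ‖p - e‖ < r → |t| < r → g (w + t • p) = 0 → ψ (w, p) = t := by
  set f : (E3 × E3) × ℝ → ℝ := fun v => g (v.1.1 + v.2 • v.1.2) with hfd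
  have hf : ContDiff ℝ ∞ f := by
    refine hg.comp ?_
    fun_prop
  have hder : ∀ v : (E3 × E3) × ℝ, fderiv ℝ f v (0, 1) =
      inner ℝ (gradient g (v.1.1 + v.2 • v.1.2)) v.1.2 := by
    intro v
    have h1 : HasDerivAt (fun t : ℝ => (v.1, v.2 + t)) ((0, 1) : (E3 × E3) × ℝ) 0 :=
      (hasDerivAt_const (0 : ℝ) v.1).prodMk (by simpa using (hasDerivAt_id (0 : ℝ)).const_add v.2)
    have h2 : HasFDerivAt f (fderiv ℝ f v) ((fun t : ℝ => (v.1, v.2 + t)) 0) := by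
      simpa using (hf.differentiable (by simp) v).hasFDerivAt
    have h3 := h2.comp_hasDerivAt (0 : ℝ) h1
    have h4 : HasDerivAt (fun t : ℝ => v.1.1 + (v.2 + t) • v.1.2) v.1.2 0 := by
      simpa using (((hasDerivAt_id (0 : ℝ)).const_add v.2).smul_const v.1.2).const_add v.1.1
    have h5 : HasFDerivAt g (InnerProductSpace.toDual ℝ E3 (gradient g (v.1.1 + v.2 • v.1.2)))
        ((fun t : ℝ => v.1.1 + (v.2 + t) • v.1.2) 0) := by
      simpa using (hg.hasGradientAt _).hasFDerivAt
    have h6 := h5.comp_hasDerivAt (0 : ℝ) h4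
    exact h3.unique h6
  have hinv : ∀ v : (E3 × E3) × ℝ, fderiv ℝ f v (0, 1) ≠ 0 →
      (fderiv ℝ f v ∘L .inr ℝ (E3 × E3) ℝ).IsInvertible := by
    intro v hv
    refine ⟨ContinuousLinearEquiv.unitsEquivAut ℝ (Units.mk0 _ hv), ?_⟩
    ext
    simp
  set v₀ : (E3 × E3) × ℝ := ((a, e), 0) with hv₀
  have hfv₀ : f v₀ = 0 := by simp [hfd, hv₀, h0]
  have hinv₀ := hinv v₀ (by rw [hder]; simpa [hv₀] using hne)
  set ψ := (hf.contDiffAt (x := v₀)).implicitFunction (by simp) hinv₀ with hψ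
  have hψ0 : ψ (a, e) = 0 := (hf.contDiffAt (x := v₀)).implicitFunction_apply_self (by simp) hinv₀
  have hψs : ContDiffAt ℝ ∞ ψ (a, e) :=
    (hf.contDiffAt (x := v₀)).contDiffAt_implicitFunction (by simp) hinv₀
  have hev := (hf.contDiffAt (x := v₀)).eventually_apply_implicitFunction (by simp) hinv₀
  have hiff := (hf.contDiffAt (x := v₀)).eventually_apply_eq_iff_implicitFunction (by simp) hinv₀
  rw [← hψ] at hev hiff
  have hc : ∀ᶠ x in nhds (a, e), ContDiffAt ℝ 1 ψ x :=
    (hψs.of_le (m := 1) (by simp)).eventually (by simp)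
  have hcder : Continuous fun v : (E3 × E3) × ℝ => fderiv ℝ f v (0, 1) := by
    have := hg.gradient.continuous
    simp_rw [hder]; fun_prop
  have hned : ∀ᶠ x in nhds (a, e), fderiv ℝ f (x, ψ x) (0, 1) ≠ 0 := by
    have h1 : ContinuousAt (fun x => fderiv ℝ f (x, ψ x) (0, 1)) (a, e) :=
      hcder.continuousAt.comp (continuousAt_id.prodMk hψs.continuousAt)
    refine h1.eventually_ne ?_
    rw [hder, hψ0]; simpa using hne
  have hsm : ∀ᶠ x in nhds (a, e), ContDiffAt ℝ ∞ ψ x := by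
    -- Smoothness at the single point `(a, e)` gives neighbourhoods that may shrink with the order.
    -- Continuity and nondegeneracy hold on a fixed neighbourhood, where the implicit function
    -- theorem is applied again at each point.
    filter_upwards [hc, hned, hev.eventually_nhds] with x h1 h2 h3
    refine contDiffAt_of_implicit hf.contDiffAt (hinv _ h2) h1.continuousAt ?_
    filter_upwards [h3] with x' hx'
    rw [hx', h3.self_of_nhds]
  obtain ⟨r₁, hr₁, hb₁⟩ := Metric.eventually_nhds_iff.1 hsm
  obtain ⟨r₂, hr₂, hb₂⟩ := Metric.eventually_nhds_iff.1 hiff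
  refine ⟨min r₁ r₂, ψ, lt_min hr₁ hr₂, fun w p hw hp => ?_, fun w p t hw hp ht h => ?_⟩
  · refine hb₁ ?_
    rw [Prod.dist_eq, dist_eq_norm, dist_eq_norm]
    exact max_lt (hw.trans_le (min_le_left _ _)) (hp.trans_le (min_le_left _ _))
  · have h1 : dist ((w, p), t) v₀ < r₂ := by
      rw [Prod.dist_eq, Prod.dist_eq, dist_eq_norm, dist_eq_norm, dist_eq_norm, hv₀, sub_zero]
      exact max_lt (max_lt (hw.trans_le (min_le_right _ _)) (hp.trans_le (min_le_right _ _)))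
        (ht.trans_le (min_le_right _ _))
    exact (hb₂ h1).1 (by rw [hfv₀]; exact h)

/-- The billiard map near the axis: a smooth map that sends the state `(w, p)` of an incoming ray
to the state of the reflected ray, keeping the axial coordinate, together with the change of
phase. -/
theorem exists_reflectionMap (hg : ContDiff ℝ ∞ g) (hΘ : Θ = {x | g x ≤ 0})
    (hgrad : ∀ x, g x = 0 → gradient g x ≠ 0) {a a' e : E3} {d : ℝ}
    (ha : IsOutwardUnitNormal Θ a (-e)) (hd : a - a' = d • e) (s₀ s₁ : ℝ) :
    ∃ ε₀ : ℝ, 0 < ε₀ ∧ ∀ ε ε₁ : ℝ, ε ≤ ε₀ → ε₁ ≤ ε₀ →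
      ∃ (N : Set (E3 × E3)) (B : E3 × E3 → E3 × E3) (l : E3 × E3 → ℝ), IsCompact N ∧
        ContDiff ℝ ∞ B ∧ ContDiff ℝ ∞ l ∧
        ∀ X ∈ frontier Θ, ‖X - a‖ ≤ ε → ∀ p, ‖p - e‖ ≤ ε₁ → ∀ s ∈ Set.Icc s₀ s₁,
          (slide a' e X s p, p) ∈ N ∧
          B (slide a' e X s p, p) = (slide a (-e) X s (reflectDir (unitNormal g X) p),
            reflectDir (unitNormal g X) p) ∧
          l (slide a' e X s p, p) = inner ℝ p (X - slide a' e X s p) +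
            inner ℝ (reflectDir (unitNormal g X) p)
              (slide a (-e) X s (reflectDir (unitNormal g X) p) - X) := by
  have h0 := eq_zero_of_mem_frontier hg hΘ ha.2.1
  have hn := ha.eq_unitNormal hg hΘ hgrad
  have he : ‖e‖ = 1 := by simpa using ha.1
  have hee : inner ℝ e e = 1 := by rw [real_inner_self_eq_norm_sq, he]; norm_num
  have hne : inner ℝ (gradient g a) e ≠ 0 := by
    rw [gradient_eq_smul_unitNormal (hgrad a h0), ← hn, inner_smul_left, inner_neg_left, hee]
    simpa using hgrad a h0
  obtain ⟨r, ψ, hr, hψs, hψ⟩ := exists_hittingTime hg h0 hne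
  obtain ⟨r', hr', hnear⟩ := Metric.continuousAt_iff.1
    (contDiffAt_unitNormal hg (hgrad a h0)).continuousAt (1 / 16) (by norm_num)
  set m := min (min r r') (1 / 16) with hm
  have hm0 : 0 < m := by positivity
  have hmr : m ≤ r := (min_le_left _ _).trans (min_le_left _ _)
  have hmr' : m ≤ r' := (min_le_left _ _).trans (min_le_right _ _)
  have hm1 : m ≤ 1 / 16 := min_le_right _ _
  refine ⟨m / 8, by positivity, fun ε ε₁ hε hε₁ => ?_⟩
  -- The state is first brought along its ray to the plane of abscissa `d` through `a`, where the
  -- hitting time is small.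
  set hit : E3 × E3 → E3 := fun v =>
    slide a' e v.1 d v.2 + ψ (slide a' e v.1 d v.2, v.2) • v.2 with hhit
  set q : E3 × E3 → E3 := fun v => reflectDir (unitNormal g (hit v)) v.2 with hq
  -- The abscissa is read off the state itself. One map thus serves all `s` and composes with the
  -- map of the next reflection.
  set w' : E3 × E3 → E3 := fun v => slide a (-e) (hit v) (inner ℝ e (v.1 - a')) (q v) with hw'
  set f : E3 × E3 → (E3 × E3) × ℝ := fun v =>
    ((w' v, q v), inner ℝ v.2 (hit v - v.1) + inner ℝ (q v) (w' v - hit v)) with hf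
  -- facts at the states of rays hitting the obstacle near `a`
  have hpe : ∀ p, ‖p - e‖ ≤ ε₁ → 1 / 2 ≤ inner ℝ e p := by
    intro p hp
    have h2 := real_inner_le_norm e (e - p)
    rw [he, one_mul, inner_sub_right, hee, norm_sub_rev] at h2
    linarith
  have hpn : ∀ p, ‖p - e‖ ≤ ε₁ → ‖p‖ ≤ 2 := by
    intro p hp
    have := norm_add_le (p - e) e
    rw [sub_add_cancel, he] at this
    linarith
  have hplane : ∀ X p, ‖X - a‖ ≤ ε → ‖p - e‖ ≤ ε₁ → ∃ t : ℝ, |t| < r ∧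
      X = slide a' e X d p + t • p ∧ ‖slide a' e X d p - a‖ < r := by
    intro X p hX hp
    have h1 := hpe p hp
    set t := (d - inner ℝ e (X - a')) / inner ℝ e p with ht
    have e1 : d - inner ℝ e (X - a') = -inner ℝ e (X - a) := by
      rw [show X - a' = (X - a) + (a - a') by abel, hd, inner_add_right, inner_smul_right, hee]; ring
    have h2 : |t| ≤ 2 * ε := by
      rw [ht, e1, abs_div, abs_neg, div_le_iff₀ (by rw [abs_pos]; linarith)]
      have h3 : |inner ℝ e (X - a)| ≤ ‖X - a‖ := by simpa [he] using abs_real_inner_le_norm e (X - a)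
      have h4 := le_abs_self (inner ℝ e p : ℝ)
      have h5 : 0 ≤ ε := (norm_nonneg _).trans hX
      nlinarith
    refine ⟨-t, by rw [abs_neg]; linarith, by rw [slide, ← ht]; module, ?_⟩
    rw [slide, ← ht, show X + t • p - a = (X - a) + t • p by abel]
    refine lt_of_le_of_lt (norm_add_le _ _) ?_
    rw [norm_smul, Real.norm_eq_abs]
    have := mul_le_mul h2 (hpn p hp) (norm_nonneg p) (by linarith [abs_nonneg t])
    linarith
  have hhitX : ∀ X ∈ frontier Θ, ‖X - a‖ ≤ ε → ∀ p, ‖p - e‖ ≤ ε₁ → ∀ s,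
      hit (slide a' e X s p, p) = X := by
    intro X hXf hX p hp s
    obtain ⟨t, ht, hXt, hwr⟩ := hplane X p hX hp
    have h1 : inner ℝ e p ≠ 0 := by linarith [hpe p hp]
    rw [hhit]
    simp only [slide_slide a' e X s d h1]
    rw [hψ _ p t hwr (by linarith) ht (by rw [← hXt]; exact eq_zero_of_mem_frontier hg hΘ hXf)]
    exact hXt.symm
  have hqe : ∀ X ∈ frontier Θ, ‖X - a‖ ≤ ε → ∀ p, ‖p - e‖ ≤ ε₁ →
      inner ℝ (-e) (reflectDir (unitNormal g X) p) ≠ 0 := by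
    intro X hXf hX p hp
    have h1 := @hnear X (by rw [dist_eq_norm]; linarith)
    rw [← hn, dist_eq_norm, sub_neg_eq_add] at h1
    have h2 := norm_reflectDir_add_le (p := p)
      (norm_unitNormal (hgrad X (eq_zero_of_mem_frontier hg hΘ hXf))) he
    have h3 := real_inner_le_norm e (reflectDir (unitNormal g X) p + e)
    rw [he, one_mul, inner_add_right, hee] at h3
    rw [inner_neg_left]
    linarith
  -- The relevant states are a continuous image of this compact set. The reflection is smooth near
  -- them, so a cutoff gives a global smooth map with derivatives bounded on this compact set.
  set P : Set (E3 × E3 × ℝ) := (frontier Θ ∩ Metric.closedBall a ε) ×ˢ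
    (Metric.closedBall e ε₁ ×ˢ Set.Icc s₀ s₁) with hP
  have hPc : IsCompact P := ((isCompact_closedBall a ε).inter_left isClosed_frontier).prod
    ((isCompact_closedBall e ε₁).prod isCompact_Icc)
  have hPmem : ∀ v ∈ P, v.1 ∈ frontier Θ ∧ ‖v.1 - a‖ ≤ ε ∧ ‖v.2.1 - e‖ ≤ ε₁ := by
    rintro ⟨X, p, s⟩ ⟨⟨h1, h2⟩, h3, -⟩
    exact ⟨h1, by simpa [dist_eq_norm] using h2, by simpa [dist_eq_norm] using h3⟩
  set st : E3 × E3 × ℝ → E3 × E3 := fun v => (slide a' e v.1 v.2.2 v.2.1, v.2.1) with hst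
  have hstc : ContinuousOn st P := by
    intro v hv
    obtain ⟨-, -, h3⟩ := hPmem v hv
    have h1 : inner ℝ e v.2.1 ≠ 0 := by linarith [hpe _ h3]
    have := contDiffAt_slide a' e (z := fun v : E3 × E3 × ℝ => v.1) (s := fun v => v.2.2)
      (p := fun v => v.2.1) (x := v) (by fun_prop) (by fun_prop) (by fun_prop) h1
    exact (this.continuousAt.prodMk (by fun_prop)).continuousWithinAt
  have hsmooth : ∀ x ∈ st '' P, ∀ᶠ y in nhds x, ContDiffAt ℝ ∞ f y := by
    rintro _ ⟨⟨X, p, s⟩, hv, rfl⟩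
    obtain ⟨hXf, hX, hp⟩ := hPmem _ hv
    simp only at hXf hX hp
    set x := st (X, p, s) with hx
    have hx2 : x = (slide a' e X s p, p) := rfl
    have h1 : inner ℝ e p ≠ 0 := by linarith [hpe _ hp]
    obtain ⟨t, ht, hXt, hwr⟩ := hplane X p hX hp
    have hsl : ∀ y : E3 × E3, inner ℝ e y.2 ≠ 0 →
        ContDiffAt ℝ ∞ (fun y : E3 × E3 => slide a' e y.1 d y.2) y := fun y hy =>
      contDiffAt_slide a' e contDiffAt_fst contDiffAt_const contDiffAt_snd hy
    have ev1 : ∀ᶠ y : E3 × E3 in nhds x, inner ℝ e y.2 ≠ 0 := by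
      have : Continuous fun y : E3 × E3 => inner ℝ e y.2 := by fun_prop
      exact this.continuousAt.eventually_ne h1
    have ev2 : ∀ᶠ y : E3 × E3 in nhds x, ‖slide a' e y.1 d y.2 - a‖ < r := by
      have : ContinuousAt (fun y : E3 × E3 => ‖slide a' e y.1 d y.2 - a‖) x :=
        ((hsl x h1).continuousAt.sub continuousAt_const).norm
      refine this.eventually_lt_const ?_
      rw [hx2]
      simpa only [slide_slide a' e X s d h1] using hwr
    have ev3 : ∀ᶠ y : E3 × E3 in nhds x, ‖y.2 - e‖ < r := by
      have : Continuous fun y : E3 × E3 => ‖y.2 - e‖ := by fun_prop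
      refine this.continuousAt.eventually_lt_const ?_
      change ‖p - e‖ < r
      linarith
    have hhits : ∀ y : E3 × E3, inner ℝ e y.2 ≠ 0 → ‖slide a' e y.1 d y.2 - a‖ < r →
        ‖y.2 - e‖ < r → ContDiffAt ℝ ∞ hit y := fun y a1 a2 a3 =>
      (hsl y a1).add (((hψs _ _ a2 a3).comp y ((hsl y a1).prodMk contDiffAt_snd)).smul
        contDiffAt_snd)
    have hhx : hit x = X := hhitX X hXf hX p hp s
    have hhc := (hhits x ev1.self_of_nhds ev2.self_of_nhds ev3.self_of_nhds).continuousAt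
    have ev4 : ∀ᶠ y : E3 × E3 in nhds x, gradient g (hit y) ≠ 0 := by
      refine (hg.gradient.continuous.continuousAt.comp hhc).eventually_ne ?_
      simp only [Function.comp, hhx]
      exact hgrad X (eq_zero_of_mem_frontier hg hΘ hXf)
    have hqs : ∀ y : E3 × E3, ContDiffAt ℝ ∞ hit y → gradient g (hit y) ≠ 0 →
        ContDiffAt ℝ ∞ q y := fun y a1 a2 =>
      contDiffAt_reflectDir ((contDiffAt_unitNormal hg a2).comp y a1) contDiffAt_snd
    have ev5 : ∀ᶠ y : E3 × E3 in nhds x, inner ℝ (-e) (q y) ≠ 0 := by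
      have h2 := (hqs x (hhits x ev1.self_of_nhds ev2.self_of_nhds ev3.self_of_nhds)
        ev4.self_of_nhds).continuousAt
      have h3 : ContinuousAt (fun y => inner ℝ (-e) (q y)) x := continuousAt_const.inner h2
      refine h3.eventually_ne ?_
      simp only [hq, hhx]
      exact hqe X hXf hX p hp
    filter_upwards [ev1, ev2, ev3, ev4, ev5] with y a1 a2 a3 a4 a5
    have s1 := hhits y a1 a2 a3
    have s2 := hqs y s1 a4
    have s3 : ContDiffAt ℝ ∞ w' y := contDiffAt_slide a (-e) s1
      (contDiffAt_const.inner ℝ (contDiffAt_fst.sub contDiffAt_const)) s2 a5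
    exact (s3.prodMk s2).prodMk ((contDiffAt_snd.inner ℝ (s1.sub contDiffAt_fst)).add
      (s2.inner ℝ (s3.sub s1)))
  obtain ⟨F, hFs, hFe⟩ := exists_contDiff_eqOn (hPc.image_of_continuousOn hstc) hsmooth
  refine ⟨st '' P, fun v => (F v).1, fun v => (F v).2, hPc.image_of_continuousOn hstc,
    hFs.fst, hFs.snd, fun X hXf hX p hp s hs => ?_⟩
  have hmem : (slide a' e X s p, p) ∈ st '' P :=
    ⟨(X, p, s), ⟨⟨hXf, by simpa [dist_eq_norm] using hX⟩, by simpa [dist_eq_norm] using hp, hs⟩,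
      rfl⟩
  have hFx := hFe hmem
  have hh := hhitX X hXf hX p hp s
  have hin : inner ℝ e (slide a' e X s p - a') = s :=
    inner_slide a' e X s (by linarith [hpe _ hp])
  refine ⟨hmem, ?_, ?_⟩
  · simp only [hFx, hf, hw', hq, hh, hin]
  · simp only [hFx, hf, hw', hq, hh, hin]

end ReflectionMap

/-! ### Symmetry of the axis in its two endpoints -/

section Axis

variable {a : Fin 2 → E3}

theorem other_other (k : Fin 2) : other (other k) = k := by fin_cases k <;> rfl

theorem axisDir_other (a : Fin 2 → E3) (k : Fin 2) : axisDir a (other k) = -axisDir a k := by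
  rw [axisDir, axisDir, other_other, norm_sub_rev, ← smul_neg, neg_sub]

theorem sub_other_eq (ha : a 0 ≠ a 1) (k : Fin 2) :
    a k - a (other k) = ‖a 1 - a 0‖ • axisDir a k := by
  have h : ‖a k - a (other k)‖ = ‖a 1 - a 0‖ := by
    fin_cases k
    · exact norm_sub_rev _ _
    · rfl
  have h0 : ‖a 1 - a 0‖ ≠ 0 := norm_ne_zero_iff.2 (sub_ne_zero.2 ha.symm)
  rw [axisDir, h, smul_smul, mul_inv_cancel₀ h0, one_smul]

theorem norm_axisDir (ha : a 0 ≠ a 1) (k : Fin 2) : ‖axisDir a k‖ = 1 := by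
  refine norm_normalize (sub_ne_zero.2 ?_)
  fin_cases k
  · exact ha
  · exact ha.symm

theorem perp_axis_other (ha : a 0 ≠ a 1) (k : Fin 2) (z : E3) :
    perp (axisDir a (other k)) (z - a (other k)) = perp (axisDir a k) (z - a k) := by
  have h := sub_other_eq ha k
  have e : z - a (other k) = (z - a k) + ‖a 1 - a 0‖ • axisDir a k := by rw [← h]; abel
  have h1 : perp (axisDir a k) (axisDir a k) = 0 := by
    rw [perp, real_inner_self_eq_norm_sq, norm_axisDir ha]; simp
  rw [axisDir_other, perp_neg_left, e, perp_add, perp_smul, h1, smul_zero, add_zero]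

theorem inner_axis_other (ha : a 0 ≠ a 1) (k : Fin 2) (z : E3) :
    inner ℝ (axisDir a (other k)) (z - a (other k)) =
      -inner ℝ (axisDir a k) (z - a k) - ‖a 1 - a 0‖ := by
  have h := sub_other_eq ha k
  have e : z - a (other k) = (z - a k) + ‖a 1 - a 0‖ • axisDir a k := by rw [← h]; abel
  rw [axisDir_other, e, inner_neg_left, inner_add_right, inner_smul_right,
    real_inner_self_eq_norm_sq, norm_axisDir ha]
  ring

theorem mem_openCylinder_iff (ha : a 0 ≠ a 1) (k : Fin 2) {r ρ : ℝ} {x : E3} :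
    x ∈ openCylinder a r ρ ↔ inner ℝ (axisDir a k) (x - a k) < ρ ∧
      -inner ℝ (axisDir a k) (x - a k) < ‖a 1 - a 0‖ + ρ ∧
      ‖perp (axisDir a k) (x - a k)‖ < r := by
  have key : x ∈ openCylinder a r ρ ↔ inner ℝ (axisDir a 0) (x - a 0) < ρ ∧
      -inner ℝ (axisDir a 0) (x - a 0) < ‖a 1 - a 0‖ + ρ ∧
      ‖perp (axisDir a 0) (x - a 0)‖ < r := by
    have h1 : axisDir a 1 = -axisDir a 0 := axisDir_other a 0
    rw [← perp_neg_left, ← h1, openCylinder, perp, ← inner_neg_left, ← h1,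
      show axisDir a 0 = -axisDir a 1 by rw [h1, neg_neg], inner_neg_left,
      real_inner_comm (x - a 0)]
    simp only [Set.mem_ofPred_eq]
    rw [neg_lt]
  fin_cases k
  · exact key
  · rw [key]
    have h1 := perp_axis_other ha 0 x
    have h2 := inner_axis_other ha 0 x
    change perp (axisDir a 1) (x - a 1) = _ at h1
    change inner ℝ (axisDir a 1) (x - a 1) = _ at h2
    simp only [Fin.mk_one]
    rw [h1, h2]
    constructor
    · rintro ⟨u, v, w⟩; exact ⟨by linarith, by linarith, w⟩
    · rintro ⟨u, v, w⟩; exact ⟨by linarith, by linarith, w⟩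

end Axis

/-- Recovers a direction from the displacement along a ray: the longer the ray, the better the
control. -/
theorem mul_norm_sub_le_of_unit {E : Type*} [NormedAddCommGroup E] [NormedSpace ℝ E] {u u' : E}
    {t t' : ℝ} (hu : ‖u‖ = 1) (hu' : ‖u'‖ = 1) (ht : 0 ≤ t) (ht' : 0 ≤ t') :
    t * ‖u - u'‖ ≤ 2 * ‖t • u - t' • u'‖ := by
  have h1 : t • (u - u') = (t • u - t' • u') - (t - t') • u' := by module
  have h2 : |t - t'| ≤ ‖t • u - t' • u'‖ := by
    have := abs_norm_sub_norm_le (t • u) (t' • u')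
    rwa [norm_smul, norm_smul, hu, hu', Real.norm_of_nonneg ht, Real.norm_of_nonneg ht', mul_one,
      mul_one] at this
  have h3 : t * ‖u - u'‖ = ‖t • (u - u')‖ := by rw [norm_smul, Real.norm_of_nonneg ht]
  rw [h3, h1]
  refine (norm_sub_le _ _).trans ?_
  rw [norm_smul, hu', Real.norm_eq_abs]
  linarith

theorem continuousOn_of_norm_sub_le {X F : Type*} [TopologicalSpace X] [NormedAddCommGroup F]
    {C : Set X} {f : X → F} (h : X → X → ℝ) (hle : ∀ x ∈ C, ∀ x' ∈ C, ‖f x' - f x‖ ≤ h x x')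
    (hlim : ∀ x ∈ C, Filter.Tendsto (h x) (nhdsWithin x C) (nhds 0)) : ContinuousOn f C := by
  intro x hx
  rw [ContinuousWithinAt, tendsto_iff_norm_sub_tendsto_zero]
  refine squeeze_zero' (Filter.Eventually.of_forall fun _ => norm_nonneg _) ?_ (hlim x hx)
  filter_upwards [self_mem_nhdsWithin] with x' hx' using hle x hx x' hx'

theorem tendsto_norm_sub_zero {X F : Type*} [TopologicalSpace X] [NormedAddCommGroup F]
    {C : Set X} {f : X → F} (hf : ContinuousOn f C) {x : X} (hx : x ∈ C) :
    Filter.Tendsto (fun x' => ‖f x - f x'‖) (nhdsWithin x C) (nhds 0) := by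
  have h := tendsto_iff_norm_sub_tendsto_zero.1 (hf x hx)
  simpa only [norm_sub_rev] using h

/-! ### Inequalities reproduced by each reflection -/

/-- The constants of the construction: `ε` is the size of the neighbourhoods of the two reflection
points, `ε₁` bounds the angles there, `c` and `Ln` are the lower curvature bound and the Lipschitz
constant of the normals, `R` and `ρ` are the radius and the prolongation of the tube, `η` is the
opening of the cone of directions, `d` is the length of the periodic ray. -/
structure TubeParams where
  (ε ε₁ c Ln R ρ η d δ : ℝ)

namespace TubeParams

/-- Upper bound for the lengths of the rays. -/
def T (P : TubeParams) : ℝ := P.d + 3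

/-- Lipschitz constant of the directions of incoming rays. -/
noncomputable def Lp (P : TubeParams) : ℝ := 28 / P.d

/-- The neighbourhood of the reflection point `a k` in the tube. -/
def tube (P : TubeParams) (a : Fin 2 → E3) (k : Fin 2) : Set E3 :=
  tubeBall (a k) (axisDir a k) P.ε P.R

/-- The part of the tube outside `Θ k`. -/
def region (P : TubeParams) (Θ : Fin 2 → Set E3) (a : Fin 2 → E3) (k : Fin 2) : Set E3 :=
  {z | z ∉ interior (Θ k) ∧ ‖perp (axisDir a k) (z - a k)‖ < P.R ∧
    inner ℝ (axisDir a k) (z - a k) ≤ P.ρ ∧ -inner ℝ (axisDir a k) (z - a k) ≤ P.d + 1}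

/-- The constants are adapted to the two obstacles. -/
structure Fits (P : TubeParams) (Θ : Fin 2 → Set E3) (a : Fin 2 → E3)
    (n : Fin 2 → E3 → E3) : Prop where
  chart : ∀ k, ObstacleChart (Θ k) (a k) (axisDir a k) (n k) P.ε P.ε₁ P.c P.Ln
  disjoint : Disjoint (Θ 0) (Θ 1)
  ne : a 0 ≠ a 1
  d_eq : P.d = ‖a 1 - a 0‖
  ε_pos : 0 < P.ε
  ε_le : P.ε ≤ 1
  ε_le_d : 4 * P.ε ≤ P.d
  ε_le_ε₁ : 4 * P.ε ≤ P.d * P.ε₁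
  ε₁_le : P.ε₁ ≤ 1 / 28
  δ_pos : 0 < P.δ
  δ_le : P.δ ≤ 1 - 2 * P.ε₁
  c_pos : 0 < P.c
  Ln_nonneg : 0 ≤ P.Ln
  R_pos : 0 < P.R
  R_le : P.R ≤ 1
  ρ_pos : 0 < P.ρ
  ρ_le : P.ρ ≤ 1
  ρ_le_ε : P.ρ ≤ P.ε / 4
  energy : 2 * P.ρ + P.R < P.c * P.ε * P.ε
  η_pos : 0 < P.η
  η_lt : 4 * P.η < P.c * P.R
  η_le : P.η ≤ P.ε₁
  η_le_c : P.η ≤ P.c * P.ε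
  η_le_d : 4 * P.η ≤ P.c * P.d * (P.c * P.ε)
  small : 2 * P.ε₁ + 2 * P.T * (7 * P.ε₁) * (3 * P.Lp + 4 * P.Ln) ≤ 1 / 2

end TubeParams

/-- A family of convex phases, depending on `ξ ∈ C`, with rays arriving near `a k`. -/
structure IncomingFamily (P : TubeParams) (a : Fin 2 → E3) (k : Fin 2) (C : Set E3)
    (M : E3 → E3 → ℝ) (p : E3 → E3 → E3) : Prop where
  phase : ∀ ξ ∈ C, IncomingPhase (a k) (axisDir a k) P.ε P.ε₁ (P.c * P.ε) P.R P.η (M ξ) (p ξ)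
  lip : ∀ ξ ∈ C, ∀ z ∈ P.tube a k, ∀ z' ∈ P.tube a k, ‖p ξ z - p ξ z'‖ ≤ P.Lp * ‖z - z'‖
  cont : ∀ z ∈ P.tube a k, ContinuousOn (fun ξ => p ξ z) C

/-- `X ξ z` and `τ ξ z` are the foot and the length of the reflected ray that ends at `z`. -/
structure OutgoingRays (P : TubeParams) (Θ : Fin 2 → Set E3) (a : Fin 2 → E3)
    (n : Fin 2 → E3 → E3) (k : Fin 2) (C : Set E3) (p : E3 → E3 → E3) (X : E3 → E3 → E3)
    (τ : E3 → E3 → ℝ) : Prop where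
  frontier : ∀ ξ ∈ C, ∀ z ∈ P.region Θ a k, X ξ z ∈ frontier (Θ k)
  mem : ∀ ξ ∈ C, ∀ z ∈ P.region Θ a k, X ξ z ∈ P.tube a k
  nonneg : ∀ ξ ∈ C, ∀ z ∈ P.region Θ a k, 0 ≤ τ ξ z
  eq : ∀ ξ ∈ C, ∀ z ∈ P.region Θ a k,
    z = X ξ z + τ ξ z • reflectDir (n k (X ξ z)) (p ξ (X ξ z))
  axis : ∀ ξ ∈ C, ∀ z ∈ P.region Θ a k, z ∉ Θ k → perp (axisDir a k) (z - a k) = 0 →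
    P.c * ‖X ξ z - a k‖ ≤ 2 * P.η

section Step

variable {P : TubeParams} {Θ : Fin 2 → Set E3} {a : Fin 2 → E3} {n : Fin 2 → E3 → E3} {k : Fin 2}
  {C : Set E3} {M : E3 → E3 → ℝ} {p : E3 → E3 → E3} {X : E3 → E3 → E3} {τ : E3 → E3 → ℝ}

theorem TubeParams.Fits.d_pos (hP : P.Fits Θ a n) : 0 < P.d := by linarith [hP.ε_pos, hP.ε_le_d]

theorem TubeParams.Fits.Lp_pos (hP : P.Fits Θ a n) : 0 < P.Lp := by
  have := hP.d_pos; unfold TubeParams.Lp; positivity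

theorem TubeParams.Fits.disjoint_other (hP : P.Fits Θ a n) (k : Fin 2) :
    Disjoint (Θ k) (Θ (other k)) := by
  fin_cases k
  · exact hP.disjoint
  · exact hP.disjoint.symm

theorem exists_outgoing (hP : P.Fits Θ a n) (hin : IncomingFamily P a k C M p) :
    ∃ X τ, OutgoingRays P Θ a n k C p X τ := by
  have h : ∀ ξ z, ∃ (Y : E3) (t : ℝ), ξ ∈ C → z ∈ P.region Θ a k → Y ∈ frontier (Θ k) ∧
      Y ∈ P.tube a k ∧ 0 ≤ t ∧ z = Y + t • reflectDir (n k Y) (p ξ Y) ∧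
      (z ∉ Θ k → perp (axisDir a k) (z - a k) = 0 → P.c * ‖Y - a k‖ ≤ 2 * P.η) := by
    intro ξ z
    by_cases hξ : ξ ∈ C
    · by_cases hz : z ∈ P.region Θ a k
      · obtain ⟨Y, hY, hYt, t, ht, he, hax⟩ := (hP.chart k).exists_foot (hin.phase ξ hξ) hP.ε_pos
          hP.c_pos (by linarith [hP.ε₁_le]) hP.η_pos.le hP.η_lt hP.ρ_pos.le hP.R_pos hP.energy
          hP.ρ_le_ε hz.1 hz.2.1 hz.2.2.1
        exact ⟨Y, t, fun _ _ => ⟨hY, hYt, ht, he, fun h1 h2 => hax h1 (by simp [h2])⟩⟩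
      · exact ⟨0, 0, fun _ h => absurd h hz⟩
    · exact ⟨0, 0, fun h => absurd h hξ⟩
  choose X τ h using h
  exact ⟨X, τ, fun ξ hξ z hz => (h ξ z hξ hz).1, fun ξ hξ z hz => (h ξ z hξ hz).2.1,
    fun ξ hξ z hz => (h ξ z hξ hz).2.2.1, fun ξ hξ z hz => (h ξ z hξ hz).2.2.2.1,
    fun ξ hξ z hz => (h ξ z hξ hz).2.2.2.2⟩

namespace OutgoingRays

theorem norm_dir (hP : P.Fits Θ a n) (hin : IncomingFamily P a k C M p)
    (ho : OutgoingRays P Θ a n k C p X τ) {ξ z : E3} (hξ : ξ ∈ C) (hz : z ∈ P.region Θ a k) :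
    ‖reflectDir (n k (X ξ z)) (p ξ (X ξ z))‖ = 1 := by
  rw [norm_reflectDir ((hP.chart k).normal _ (ho.frontier ξ hξ z hz)).1]
  exact (hin.phase ξ hξ).norm_eq _ (ho.mem ξ hξ z hz)

theorem smul_dir (ho : OutgoingRays P Θ a n k C p X τ) {ξ z : E3} (hξ : ξ ∈ C)
    (hz : z ∈ P.region Θ a k) :
    τ ξ z • reflectDir (n k (X ξ z)) (p ξ (X ξ z)) = z - X ξ z :=
  eq_sub_of_add_eq' (ho.eq ξ hξ z hz).symm

theorem length_eq (hP : P.Fits Θ a n) (hin : IncomingFamily P a k C M p)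
    (ho : OutgoingRays P Θ a n k C p X τ) {ξ z : E3} (hξ : ξ ∈ C) (hz : z ∈ P.region Θ a k) :
    τ ξ z = ‖z - X ξ z‖ := by
  nth_rewrite 2 [ho.eq ξ hξ z hz]
  rw [add_sub_cancel_left, norm_smul, ho.norm_dir hP hin hξ hz, mul_one,
    Real.norm_of_nonneg (ho.nonneg ξ hξ z hz)]

theorem le_T (hP : P.Fits Θ a n) (hin : IncomingFamily P a k C M p)
    (ho : OutgoingRays P Θ a n k C p X τ) {ξ z : E3} (hξ : ξ ∈ C) (hz : z ∈ P.region Θ a k) :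
    τ ξ z ≤ P.T := by
  rw [ho.length_eq hP hin hξ hz]
  have h1 := norm_le_perp_add (norm_axisDir hP.ne k) (z - a k)
  have h2 : |inner ℝ (axisDir a k) (z - a k)| ≤ P.d + 1 := by
    rw [abs_le]; constructor
    · linarith [hz.2.2.2]
    · linarith [hz.2.2.1, hP.ρ_le, hP.d_pos]
  have h3 : ‖z - X ξ z‖ ≤ ‖z - a k‖ + ‖X ξ z - a k‖ := by
    rw [show z - X ξ z = (z - a k) - (X ξ z - a k) by abel]; exact norm_sub_le _ _
  have h4 := (ho.mem ξ hξ z hz).1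
  unfold TubeParams.T
  linarith [hz.2.1, hP.R_le, hP.ε_le]

/-- For `ξ = ξ'` this is a Lipschitz bound in `z` with a constant that ignores the earlier
reflections. For `z = z'` it transfers continuity in `ξ` from directions to feet. -/
theorem foot_sub_le (hP : P.Fits Θ a n) (hin : IncomingFamily P a k C M p)
    (ho : OutgoingRays P Θ a n k C p X τ) {ξ ξ' z z' : E3} (hξ : ξ ∈ C) (hξ' : ξ' ∈ C)
    (hz : z ∈ P.region Θ a k) (hz' : z' ∈ P.region Θ a k) :
    ‖X ξ z - X ξ' z'‖ ≤ 6 * ‖z - z'‖ + 16 * P.T * ‖p ξ (X ξ z) - p ξ' (X ξ z)‖ := by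
  have h := (hP.chart k).foot_sub_le (hin.phase ξ hξ) (hin.phase ξ' hξ') (Lp := P.Lp)
    (by linarith [hP.ε₁_le]) (ho.frontier ξ hξ z hz) (ho.mem ξ hξ z hz)
    (ho.frontier ξ' hξ' z' hz') (ho.mem ξ' hξ' z' hz') (ho.nonneg ξ hξ z hz)
    (τ' := τ ξ' z') (ho.le_T hP hin hξ hz) le_rfl
    (hin.lip ξ' hξ' _ (ho.mem ξ hξ z hz) _ (ho.mem ξ' hξ' z' hz')) hP.small
  rwa [← ho.eq ξ hξ z hz, ← ho.eq ξ' hξ' z' hz'] at h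

theorem foot_lip (hP : P.Fits Θ a n) (hin : IncomingFamily P a k C M p)
    (ho : OutgoingRays P Θ a n k C p X τ) {ξ z z' : E3} (hξ : ξ ∈ C)
    (hz : z ∈ P.region Θ a k) (hz' : z' ∈ P.region Θ a k) :
    ‖X ξ z - X ξ z'‖ ≤ 6 * ‖z - z'‖ := by
  simpa using ho.foot_sub_le hP hin hξ hξ hz hz'

theorem foot_cont (hP : P.Fits Θ a n) (hin : IncomingFamily P a k C M p)
    (ho : OutgoingRays P Θ a n k C p X τ) {z : E3} (hz : z ∈ P.region Θ a k) :
    ContinuousOn (fun ξ => X ξ z) C := by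
  refine continuousOn_of_norm_sub_le
    (fun ξ ξ' => 16 * P.T * ‖p ξ (X ξ z) - p ξ' (X ξ z)‖) (fun ξ hξ ξ' hξ' => ?_) fun ξ hξ => ?_
  · rw [norm_sub_rev]
    simpa using ho.foot_sub_le hP hin hξ hξ' hz hz
  · simpa using (tendsto_norm_sub_zero (hin.cont _ (ho.mem ξ hξ z hz)) hξ).const_mul (16 * P.T)

theorem dir_sub_le (hP : P.Fits Θ a n) (hin : IncomingFamily P a k C M p)
    (ho : OutgoingRays P Θ a n k C p X τ) {ξ ξ' z z' : E3} (hξ : ξ ∈ C) (hξ' : ξ' ∈ C)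
    (hz : z ∈ P.region Θ a k) (hz' : z' ∈ P.region Θ a k) :
    ‖reflectDir (n k (X ξ z)) (p ξ (X ξ z)) - reflectDir (n k (X ξ' z')) (p ξ' (X ξ' z'))‖ ≤
      (3 * P.Lp + 4 * P.Ln) * ‖X ξ z - X ξ' z'‖ + 3 * ‖p ξ (X ξ z) - p ξ' (X ξ z)‖ := by
  have h1 := norm_reflectDir_sub_le (p := p ξ (X ξ z))
    ((hP.chart k).normal _ (ho.frontier ξ hξ z hz)).1
    ((hP.chart k).normal _ (ho.frontier ξ' hξ' z' hz')).1
    ((hin.phase ξ' hξ').norm_eq _ (ho.mem ξ' hξ' z' hz'))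
  have h2 := (hP.chart k).lip _ _ (ho.mem ξ hξ z hz).1 (ho.mem ξ' hξ' z' hz').1
  have h3 := hin.lip ξ' hξ' _ (ho.mem ξ hξ z hz) _ (ho.mem ξ' hξ' z' hz')
  have h4 : ‖p ξ (X ξ z) - p ξ' (X ξ' z')‖ ≤
      ‖p ξ (X ξ z) - p ξ' (X ξ z)‖ + ‖p ξ' (X ξ z) - p ξ' (X ξ' z')‖ := by
    rw [show p ξ (X ξ z) - p ξ' (X ξ' z') =
      (p ξ (X ξ z) - p ξ' (X ξ z)) + (p ξ' (X ξ z) - p ξ' (X ξ' z')) by abel]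
    exact norm_add_le _ _
  linarith

theorem dir_lip (hP : P.Fits Θ a n) (hin : IncomingFamily P a k C M p)
    (ho : OutgoingRays P Θ a n k C p X τ) {ξ z z' : E3} (hξ : ξ ∈ C)
    (hz : z ∈ P.region Θ a k) (hz' : z' ∈ P.region Θ a k) :
    ‖reflectDir (n k (X ξ z)) (p ξ (X ξ z)) - reflectDir (n k (X ξ z')) (p ξ (X ξ z'))‖ ≤
      6 * (3 * P.Lp + 4 * P.Ln) * ‖z - z'‖ := by
  have h1 := ho.dir_sub_le hP hin hξ hξ hz hz'
  have h2 := ho.foot_lip hP hin hξ hz hz'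
  have h3 : 0 ≤ 3 * P.Lp + 4 * P.Ln := by linarith [hP.Lp_pos, hP.Ln_nonneg]
  have h4 := mul_le_mul_of_nonneg_left h2 h3
  rw [sub_self, norm_zero] at h1
  linarith

theorem dir_cont (hP : P.Fits Θ a n) (hin : IncomingFamily P a k C M p)
    (ho : OutgoingRays P Θ a n k C p X τ) {z : E3} (hz : z ∈ P.region Θ a k) :
    ContinuousOn (fun ξ => reflectDir (n k (X ξ z)) (p ξ (X ξ z))) C := by
  refine continuousOn_of_norm_sub_le (fun ξ ξ' => (3 * P.Lp + 4 * P.Ln) * ‖X ξ z - X ξ' z‖ +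
    3 * ‖p ξ (X ξ z) - p ξ' (X ξ z)‖) (fun ξ hξ ξ' hξ' => ?_) fun ξ hξ => ?_
  · rw [norm_sub_rev]
    exact ho.dir_sub_le hP hin hξ hξ' hz hz
  · have h1 := (tendsto_norm_sub_zero (ho.foot_cont hP hin hz) hξ).const_mul
      (3 * P.Lp + 4 * P.Ln)
    have h2 := (tendsto_norm_sub_zero (hin.cont _ (ho.mem ξ hξ z hz)) hξ).const_mul 3
    simpa using h1.add h2

/-- Stated for every `t ≥ 0`, not only up to `z`, because points will be pushed forward along their
rays. -/
theorem value_eq (hP : P.Fits Θ a n) (hin : IncomingFamily P a k C M p)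
    (ho : OutgoingRays P Θ a n k C p X τ) {ξ z : E3} (hξ : ξ ∈ C) (hz : z ∈ P.region Θ a k)
    {t : ℝ} (ht : 0 ≤ t) :
    valueThrough (Θ k) (M ξ) (X ξ z + t • reflectDir (n k (X ξ z)) (p ξ (X ξ z))) =
      M ξ (X ξ z) + t := by
  have hch := hP.chart k
  have hph := hin.phase ξ hξ
  have hn := hch.normal _ (ho.frontier ξ hξ z hz)
  have hm := ho.mem ξ hξ z hz
  refine valueThrough_reflected hch.isCompact hph.continuous hph.convex
    (hch.isCompact.isClosed.frontier_subset hn.2.1) hn.1 hn.2.2 (hph.grad _ hm)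
    (hph.norm_eq _ hm) ?_ ht
  linarith [hch.le_neg_inner hph hm, hP.ε₁_le]

theorem pos (ho : OutgoingRays P Θ a n k C p X τ) (hc : IsClosed (Θ k)) {ξ z : E3} (hξ : ξ ∈ C)
    (hz : z ∈ P.region Θ a k) (hzΘ : z ∉ Θ k) : 0 < τ ξ z := by
  refine lt_of_le_of_ne (ho.nonneg ξ hξ z hz) fun h => hzΘ ?_
  rw [ho.eq ξ hξ z hz, ← h, zero_smul, add_zero]
  exact hc.frontier_subset (ho.frontier ξ hξ z hz)

theorem hasGradientAt (hP : P.Fits Θ a n) (hin : IncomingFamily P a k C M p)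
    (ho : OutgoingRays P Θ a n k C p X τ) {ξ z : E3} (hξ : ξ ∈ C) (hz : z ∈ P.region Θ a k)
    (hzΘ : z ∉ Θ k) : HasGradientAt (valueThrough (Θ k) (M ξ))
      (reflectDir (n k (X ξ z)) (p ξ (X ξ z))) z := by
  have hch := hP.chart k
  have hph := hin.phase ξ hξ
  have := hasGradientAt_valueThrough ⟨_, hch.mem⟩ hch.isCompact hch.convex hph.continuous
    hph.convex (hch.isCompact.isClosed.frontier_subset (ho.frontier ξ hξ z hz))
    (ho.norm_dir hP hin hξ hz) (ho.pos hch.isCompact.isClosed hξ hz hzΘ)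
    (ho.value_eq hP hin hξ hz (ho.nonneg ξ hξ z hz))
  rwa [← ho.eq ξ hξ z hz] at this

end OutgoingRays

theorem TubeParams.Fits.tube_other_subset (hP : P.Fits Θ a n) (k : Fin 2) {z : E3}
    (hz : z ∈ P.tube a (other k)) : z ∈ P.region Θ a k ∧ z ∉ Θ k := by
  have he := norm_axisDir hP.ne (other k)
  have h1 := inner_axis_other hP.ne k z
  have h2 : |inner ℝ (axisDir a (other k)) (z - a (other k))| ≤ ‖z - a (other k)‖ := by
    simpa [he] using abs_real_inner_le_norm (axisDir a (other k)) (z - a (other k))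
  have h3 := abs_le.1 h2
  have h4 := hz.1
  have hd := hP.d_eq
  have hneg : inner ℝ (axisDir a k) (z - a k) < 0 := by
    linarith [hP.ε_le_d, hP.ε_pos, h3.1]
  have hzΘ : z ∉ Θ k := fun h => not_le.2 hneg ((hP.chart k).nonneg z h)
  refine ⟨⟨fun h => hzΘ (interior_subset h), ?_, by linarith [hP.ρ_pos], ?_⟩, hzΘ⟩
  · rw [← perp_axis_other hP.ne]; exact hz.2
  · linarith [hP.ε_le, h3.2]

theorem TubeParams.Fits.center_mem (hP : P.Fits Θ a n) (k : Fin 2) : a k ∈ P.tube a k := by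
  have : perp (axisDir a k) (0 : E3) = 0 := by simp [perp]
  simp [TubeParams.tube, tubeBall, this, hP.ε_pos, hP.R_pos]

/-- The rays reflected on `Θ k` form an incoming family for the other obstacle. -/
theorem OutgoingRays.incomingFamily (hP : P.Fits Θ a n) (hin : IncomingFamily P a k C M p)
    (ho : OutgoingRays P Θ a n k C p X τ) :
    IncomingFamily P a (other k) C (fun ξ => valueThrough (Θ k) (M ξ))
      (fun ξ z => reflectDir (n k (X ξ z)) (p ξ (X ξ z))) := by
  have hch := hP.chart k
  have hd := hP.d_pos
  -- Foot and end are within `ε` of the endpoints of the axis, so the displacement `z - X` is close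
  -- to the axis vector of length `d`. This fixes the direction independently of the incoming one
  -- and makes the flight at least `d / 2` long.
  have hvec : ∀ ξ ∈ C, ∀ z ∈ P.tube a (other k),
      P.d * ‖reflectDir (n k (X ξ z)) (p ξ (X ξ z)) - axisDir a (other k)‖ ≤
        2 * ‖(z - a (other k)) - (X ξ z - a k)‖ ∧ P.d / 2 ≤ τ ξ z := by
    intro ξ hξ z hz
    obtain ⟨hzr, hzΘ⟩ := hP.tube_other_subset k hz
    have h1 := mul_norm_sub_le_of_unit (t := P.d) (t' := τ ξ z) (norm_axisDir hP.ne (other k))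
      (ho.norm_dir hP hin hξ hzr) hd.le (ho.nonneg ξ hξ z hzr)
    have e2 := ho.smul_dir hξ hzr
    have e3 : P.d • axisDir a (other k) = a (other k) - a k := by
      have := sub_other_eq hP.ne (other k)
      rw [other_other, ← hP.d_eq] at this
      exact this.symm
    have e4 : P.d • axisDir a (other k) - τ ξ z • reflectDir (n k (X ξ z)) (p ξ (X ξ z)) =
        -((z - a (other k)) - (X ξ z - a k)) := by rw [e2, e3]; abel
    rw [e4, norm_neg, norm_sub_rev] at h1
    refine ⟨h1, ?_⟩
    have h2 : ‖P.d • axisDir a (other k)‖ - ‖z - X ξ z‖ ≤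
        ‖(z - a (other k)) - (X ξ z - a k)‖ := by
      rw [← e2]
      refine (norm_sub_norm_le _ _).trans (le_of_eq ?_)
      rw [e4, norm_neg]
    rw [norm_smul, norm_axisDir hP.ne, Real.norm_of_nonneg hd.le, ← ho.length_eq hP hin hξ hzr]
      at h2
    have h3 := norm_sub_le (z - a (other k)) (X ξ z - a k)
    linarith [hz.1, (ho.mem ξ hξ z hzr).1, hP.ε_le_d]
  refine ⟨fun ξ hξ => ⟨?_, ?_, ?_, ?_, ?_, ?_, ?_⟩, ?_, ?_⟩
  · exact continuous_valueThrough ⟨_, hch.mem⟩ hch.isCompact (hin.phase ξ hξ).continuous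
  · exact convexOn_valueThrough ⟨_, hch.mem⟩ hch.isCompact hch.convex (hin.phase ξ hξ).continuous
      (hin.phase ξ hξ).convex
  · intro z hz
    obtain ⟨hzr, hzΘ⟩ := hP.tube_other_subset k hz
    exact ho.hasGradientAt hP hin hξ hzr hzΘ
  · intro z hz
    exact ho.norm_dir hP hin hξ (hP.tube_other_subset k hz).1
  · intro z hz
    have h1 := (hvec ξ hξ z hz).1
    have h3 := norm_sub_le (z - a (other k)) (X ξ z - a k)
    have h4 := (ho.mem ξ hξ z (hP.tube_other_subset k hz).1).1
    have h5 := hz.1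
    refine le_of_mul_le_mul_left ?_ hd
    linarith [hP.ε_le_ε₁]
  · intro z hz
    obtain ⟨hzr, hzΘ⟩ := hP.tube_other_subset k hz
    have h := hch.slope_reflected (hin.phase ξ hξ) (by linarith [hP.ε₁_le]) hP.η_pos.le
      (ho.frontier ξ hξ z hzr) (ho.mem ξ hξ z hzr) (ho.nonneg ξ hξ z hzr)
    rw [← ho.eq ξ hξ z hzr] at h
    rwa [perp_axis_other hP.ne]
  · have hz := hP.center_mem (other k)
    obtain ⟨hzr, hzΘ⟩ := hP.tube_other_subset k hz
    -- For the centre, the foot of the ray ending on the axis is within `2 η / c` of `a k`. The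
    -- direction error is thus at most `4 η / (c d) ≤ c ε`.
    have h1 := (hvec ξ hξ _ hz).1
    have h2 := ho.axis ξ hξ _ hzr hzΘ (by
      rw [← perp_axis_other hP.ne]; simp [perp])
    rw [sub_self, zero_sub, norm_neg] at h1
    refine le_of_mul_le_mul_left ?_ (mul_pos hP.c_pos hd)
    have h3 := mul_le_mul_of_nonneg_left h1 hP.c_pos.le
    linarith [hP.η_le_d]
  · intro ξ hξ z hz z' hz'
    obtain ⟨hzr, hzΘ⟩ := hP.tube_other_subset k hz
    obtain ⟨hzr', hzΘ'⟩ := hP.tube_other_subset k hz'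
    have h1 := mul_norm_sub_le_of_unit (ho.norm_dir hP hin hξ hzr) (ho.norm_dir hP hin hξ hzr')
      (ho.nonneg ξ hξ z hzr) (ho.nonneg ξ hξ z' hzr')
    have e1 : τ ξ z • reflectDir (n k (X ξ z)) (p ξ (X ξ z)) -
        τ ξ z' • reflectDir (n k (X ξ z')) (p ξ (X ξ z')) = (z - z') - (X ξ z - X ξ z') := by
      rw [ho.smul_dir hξ hzr, ho.smul_dir hξ hzr']; abel
    have h2 := norm_sub_le (z - z') (X ξ z - X ξ z')
    have h3 := ho.foot_lip hP hin hξ hzr hzr'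
    have h4 := mul_le_mul_of_nonneg_right (hvec ξ hξ z hz).2
      (norm_nonneg (reflectDir (n k (X ξ z)) (p ξ (X ξ z)) -
        reflectDir (n k (X ξ z')) (p ξ (X ξ z'))))
    rw [e1] at h1
    -- Ends and 6-Lipschitz feet differ by at most `7 ‖z - z'‖` together. The factor 2 from unit
    -- vectors and the length at least `d / 2` give `28 / d`.
    rw [TubeParams.Lp, div_mul_eq_mul_div, le_div_iff₀ hd]
    linarith
  · intro z hz
    exact ho.dir_cont hP hin (hP.tube_other_subset k hz).1

end Step

theorem inner_pos_of_near {p e : E3} (he : ‖e‖ = 1) (hp : ‖p - e‖ < 1) : 0 < inner ℝ e p := by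
  have h := abs_le.1 (abs_real_inner_le_norm e (p - e))
  rw [inner_sub_right, real_inner_self_eq_norm_sq, he] at h
  linarith [h.1]

/-! ### Tracing rays back to the plane phase -/

/-- The smooth maps `B k` and `l k` describe the reflection on `Θ k` of the rays near the axis:
a ray is represented by its direction and its point of given abscissa, and `l k` is the variation
of the phase. -/
structure ReflectionMaps (P : TubeParams) (Θ : Fin 2 → Set E3) (a : Fin 2 → E3)
    (n : Fin 2 → E3 → E3) (B : Fin 2 → E3 × E3 → E3 × E3) (l : Fin 2 → E3 × E3 → ℝ)
    (A : ℕ → ℝ) : Prop where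
  smooth_map : ∀ k, ContDiff ℝ ∞ (B k)
  smooth_length : ∀ k, ContDiff ℝ ∞ (l k)
  one_le : ∀ m, 1 ≤ A m
  bound : ∀ k, ∀ X ∈ frontier (Θ k), ‖X - a k‖ ≤ P.ε → ∀ p, ‖p - axisDir a k‖ ≤ P.ε₁ →
    ∀ s ∈ Set.Icc (-1) (P.d + 1), ∀ m, ∀ i ≤ m,
      m.factorial * ‖iteratedFDeriv ℝ i (B k) (slide (a (other k)) (axisDir a k) X s p, p)‖ ≤ A m
  map_eq : ∀ k, ∀ X ∈ frontier (Θ k), ‖X - a k‖ ≤ P.ε → ∀ p, ‖p - axisDir a k‖ ≤ P.ε₁ →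
    ∀ s ∈ Set.Icc (-1) (P.d + 1), B k (slide (a (other k)) (axisDir a k) X s p, p) =
      (slide (a k) (axisDir a (other k)) X s (reflectDir (n k X) p), reflectDir (n k X) p)
  length_eq : ∀ k, ∀ X ∈ frontier (Θ k), ‖X - a k‖ ≤ P.ε → ∀ p, ‖p - axisDir a k‖ ≤ P.ε₁ →
    ∀ s ∈ Set.Icc (-1) (P.d + 1), l k (slide (a (other k)) (axisDir a k) X s p, p) =
      inner ℝ p (X - slide (a (other k)) (axisDir a k) X s p) +
        inner ℝ (reflectDir (n k X) p)
          (slide (a k) (axisDir a (other k)) X s (reflectDir (n k X) p) - X)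

/-- The representation of the ray of direction `ξ / |ξ|` through `w`. -/
noncomputable def startRay (a : Fin 2 → E3) (j : Fin 2) (ξ w : E3) (s : ℝ) : E3 × E3 :=
  (slide (a (other j)) (axisDir a j) w s (‖ξ‖⁻¹ • ξ), ‖ξ‖⁻¹ • ξ)

/-- The ray of the phase `M ξ` through `z ∈ D` comes from the ray of the plane phase through
`foot ξ z`, by the smooth map `Ψ` of rays. -/
structure TracedRays (P : TubeParams) (a : Fin 2 → E3) (D : Set E3) (k : Fin 2) (C : Set E3)
    (M : E3 → E3 → ℝ) (p : E3 → E3 → E3) (j : Fin 2) (foot : E3 → E3 → E3)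
    (Ψ : E3 × E3 → E3 × E3) (l : E3 × E3 → ℝ) (A : ℕ → ℝ) (N : ℕ) : Prop where
  foot_lip : ∀ ξ ∈ C, ∀ z ∈ D, ∀ z' ∈ D, ‖foot ξ z - foot ξ z'‖ ≤ 6 ^ N * ‖z - z'‖
  foot_cont : ∀ z ∈ D, ContinuousOn (fun ξ => foot ξ z) C
  smooth_map : ContDiff ℝ ∞ Ψ
  smooth_length : ContDiff ℝ ∞ l
  map_eq : ∀ ξ ∈ C, ∀ z ∈ D, ∀ s ∈ Set.Icc (-1) (P.d + 1),
    Ψ (startRay a j ξ (foot ξ z) s) = (slide (a (other k)) (axisDir a k) z s (p ξ z), p ξ z)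
  length_eq : ∀ ξ ∈ C, ∀ z ∈ D, ∀ s ∈ Set.Icc (-1) (P.d + 1),
    l (startRay a j ξ (foot ξ z) s) =
      M ξ z + inner ℝ (p ξ z) (slide (a (other k)) (axisDir a k) z s (p ξ z) - z)
  bound : ∀ ξ ∈ C, ∀ z ∈ D, ∀ s ∈ Set.Icc (-1) (P.d + 1), ∀ m i, 1 ≤ i → i ≤ m →
    ‖iteratedFDeriv ℝ i Ψ (startRay a j ξ (foot ξ z) s)‖ ≤ (A m ^ (N + 1)) ^ i

section Trace

variable {P : TubeParams} {Θ : Fin 2 → Set E3} {a : Fin 2 → E3} {n : Fin 2 → E3 → E3} {k : Fin 2}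
  {C : Set E3} {M : E3 → E3 → ℝ} {p : E3 → E3 → E3} {X : E3 → E3 → E3} {τ : E3 → E3 → ℝ}
  {D : Set E3} {j : Fin 2} {foot : E3 → E3 → E3} {Ψ : E3 × E3 → E3 × E3} {L : E3 × E3 → ℝ}
  {A : ℕ → ℝ} {N : ℕ} {B : Fin 2 → E3 × E3 → E3 × E3} {l : Fin 2 → E3 × E3 → ℝ}

theorem TracedRays.mono {D' : Set E3} (h : TracedRays P a D k C M p j foot Ψ L A N)
    (hD : D' ⊆ D) : TracedRays P a D' k C M p j foot Ψ L A N where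
  foot_lip ξ hξ z hz z' hz' := h.foot_lip ξ hξ z (hD hz) z' (hD hz')
  foot_cont z hz := h.foot_cont z (hD hz)
  smooth_map := h.smooth_map
  smooth_length := h.smooth_length
  map_eq ξ hξ z hz := h.map_eq ξ hξ z (hD hz)
  length_eq ξ hξ z hz := h.length_eq ξ hξ z (hD hz)
  bound ξ hξ z hz := h.bound ξ hξ z (hD hz)

theorem OutgoingRays.norm_dir_sub_le (hP : P.Fits Θ a n) (hin : IncomingFamily P a k C M p)
    (ho : OutgoingRays P Θ a n k C p X τ) {ξ z : E3} (hξ : ξ ∈ C) (hz : z ∈ P.region Θ a k) :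
    ‖reflectDir (n k (X ξ z)) (p ξ (X ξ z)) - axisDir a (other k)‖ ≤ 1 / 4 := by
  have := (hP.chart k).norm_reflected_add_le (hin.phase ξ hξ) (ho.mem ξ hξ z hz)
  rw [axisDir_other, sub_neg_eq_add]
  linarith [hP.ε₁_le]

theorem OutgoingRays.inner_dir_pos (hP : P.Fits Θ a n) (hin : IncomingFamily P a k C M p)
    (ho : OutgoingRays P Θ a n k C p X τ) {ξ z : E3} (hξ : ξ ∈ C) (hz : z ∈ P.region Θ a k) :
    0 < inner ℝ (axisDir a (other k)) (reflectDir (n k (X ξ z)) (p ξ (X ξ z))) :=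
  inner_pos_of_near (norm_axisDir hP.ne _)
    ((ho.norm_dir_sub_le hP hin hξ hz).trans_lt (by norm_num))

/-- One more reflection composes `Ψ` with `B k`, adds `l k` to the length and multiplies the
Lipschitz constant of the initial foot by 6. The bound on `Ψ` is the chain rule of order `i`, whose
factorial is built into `A`. -/
theorem TracedRays.reflect (hP : P.Fits Θ a n) (hB : ReflectionMaps P Θ a n B l A)
    (hin : IncomingFamily P a k C M p) (ho : OutgoingRays P Θ a n k C p X τ)
    (h : TracedRays P a (P.tube a k) k C M p j foot Ψ L A N) :
    TracedRays P a (P.region Θ a k) (other k) C (fun ξ => valueThrough (Θ k) (M ξ))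
      (fun ξ z => reflectDir (n k (X ξ z)) (p ξ (X ξ z))) j (fun ξ z => foot ξ (X ξ z))
      (B k ∘ Ψ) (fun w => L w + l k (Ψ w)) A (N + 1) where
  foot_lip ξ hξ z hz z' hz' := by
    refine (h.foot_lip ξ hξ _ (ho.mem ξ hξ z hz) _ (ho.mem ξ hξ z' hz')).trans ?_
    rw [pow_succ, mul_assoc]
    exact mul_le_mul_of_nonneg_left (ho.foot_lip hP hin hξ hz hz') (by positivity)
  foot_cont z hz := by
    refine continuousOn_of_norm_sub_le (fun ξ ξ' => 6 ^ N * ‖X ξ z - X ξ' z‖ +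
      ‖foot ξ (X ξ z) - foot ξ' (X ξ z)‖) (fun ξ hξ ξ' hξ' => ?_) fun ξ hξ => ?_
    · have h1 := h.foot_lip ξ' hξ' _ (ho.mem ξ' hξ' z hz) _ (ho.mem ξ hξ z hz)
      rw [norm_sub_rev (X ξ' z)] at h1
      rw [show foot ξ' (X ξ' z) - foot ξ (X ξ z) = (foot ξ' (X ξ' z) - foot ξ' (X ξ z)) +
        -(foot ξ (X ξ z) - foot ξ' (X ξ z)) by abel]
      refine (norm_add_le _ _).trans ?_
      rw [norm_neg]
      linarith
    · have h1 := (tendsto_norm_sub_zero (ho.foot_cont hP hin hz) hξ).const_mul ((6 : ℝ) ^ N)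
      have h2 := tendsto_norm_sub_zero (h.foot_cont _ (ho.mem ξ hξ z hz)) hξ
      simpa using h1.add h2
  smooth_map := (hB.smooth_map k).comp h.smooth_map
  smooth_length := h.smooth_length.add ((hB.smooth_length k).comp h.smooth_map)
  map_eq ξ hξ z hz s hs := by
    have hm := ho.mem ξ hξ z hz
    rw [Function.comp_apply, h.map_eq ξ hξ _ hm s hs, hB.map_eq k _ (ho.frontier ξ hξ z hz) hm.1.le
      _ ((hin.phase ξ hξ).near _ hm) s hs, other_other]
    nth_rewrite 6 [ho.eq ξ hξ z hz]
    rw [slide_add_smul _ _ _ _ _ (ho.inner_dir_pos hP hin hξ hz).ne']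
  length_eq ξ hξ z hz s hs := by
    have hm := ho.mem ξ hξ z hz
    have hp := (hin.phase ξ hξ).near _ hm
    have hf := ho.frontier ξ hξ z hz
    have hv := ho.value_eq hP hin hξ hz (ho.nonneg ξ hξ z hz)
    have hq := ho.norm_dir hP hin hξ hz
    have hsl := slide_add_smul (a k) (axisDir a (other k)) (X ξ z) s (τ ξ z)
      (ho.inner_dir_pos hP hin hξ hz).ne'
    have he := ho.smul_dir hξ hz
    rw [← ho.eq ξ hξ z hz] at hv hsl
    rw [h.map_eq ξ hξ _ hm s hs, h.length_eq ξ hξ _ hm s hs,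
      hB.length_eq k _ hf hm.1.le _ hp s hs, other_other, hv, hsl]
    set q := reflectDir (n k (X ξ z)) (p ξ (X ξ z))
    set w := slide (a k) (axisDir a (other k)) (X ξ z) s q
    set w' := slide (a (other k)) (axisDir a k) (X ξ z) s (p ξ (X ξ z))
    have e1 : w - X ξ z = (w - z) + τ ξ z • q := by rw [he]; abel
    rw [e1, inner_add_right, inner_smul_right, real_inner_self_eq_norm_sq, hq,
      ← neg_sub w' (X ξ z), inner_neg_right]
    ring
  bound ξ hξ z hz s hs m i hi him := by
    have hm := ho.mem ξ hξ z hz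
    have hp := (hin.phase ξ hξ).near _ hm
    have hf := ho.frontier ξ hξ z hz
    have hA := hB.one_le m
    have hfac : (0 : ℝ) < m.factorial := by exact_mod_cast m.factorial_pos
    have h1 := norm_iteratedFDeriv_comp_le (n := i) (N := ∞) (hB.smooth_map k) h.smooth_map
      (by exact_mod_cast le_top) (startRay a j ξ (foot ξ (X ξ z)) s) (C := A m / m.factorial)
      (D := A m ^ (N + 1)) (fun i' hi' => by
        rw [h.map_eq ξ hξ _ hm s hs, le_div_iff₀ hfac, mul_comm]
        exact hB.bound k _ hf hm.1.le _ hp s hs m i' (hi'.trans him))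
      (fun i' h1 h2 => h.bound ξ hξ _ hm s hs m i' h1 (h2.trans him))
    refine h1.trans ?_
    have h2 : (i.factorial : ℝ) ≤ m.factorial := by exact_mod_cast Nat.factorial_le him
    have h3 : i.factorial * (A m / m.factorial) ≤ A m := by
      rw [mul_div_assoc', div_le_iff₀ hfac, mul_comm]
      exact mul_le_mul_of_nonneg_left h2 (by linarith)
    -- Here `i ≥ 1` is needed. The new factor can then be distributed as `A m ^ i`, which keeps the
    -- form `(…) ^ i` required by the next composition.
    have h4 : A m ≤ A m ^ i := le_self_pow₀ hA (by omega)
    calc _ ≤ A m ^ i * (A m ^ (N + 1)) ^ i :=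
          mul_le_mul_of_nonneg_right (h3.trans h4) (by positivity)
      _ = _ := by rw [← mul_pow, ← pow_succ']

/-- The rays of the phase of the story `J`, whose next reflection takes place on `Θ k`. -/
structure StoryRays (P : TubeParams) (Θ : Fin 2 → Set E3) (a : Fin 2 → E3) (y : E3) (j : Fin 2)
    (J : List (Fin 2)) (k : Fin 2) (C : Set E3) (p foot : E3 → E3 → E3) (Ψ : E3 × E3 → E3 × E3)
    (l : E3 × E3 → ℝ) (A : ℕ → ℝ) : Prop where
  incoming : IncomingFamily P a k C (fun ξ => storyValue Θ y ξ J) p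
  value : ∀ ξ ∈ C, IsValueOf (Θ k) (storyPhase Θ P.δ y ξ J) (storyValue Θ y ξ J)
  subset_dom : ∀ ξ ∈ C, P.tube a k ⊆ (storyPhase Θ P.δ y ξ J).dom
  traced : TracedRays P a (P.tube a k) k C (fun ξ => storyValue Θ y ξ J) p j foot Ψ l A J.length

/-- Links the constructed rays to the phases of the statement: near `a k` the incidence satisfies
`-⟪n, p⟫ ≥ 1 - 2 ε₁ ≥ δ`, and the tube is an open part of the domain. -/
theorem StoryRays.reflectsAt (hP : P.Fits Θ a n) {y : E3} {J : List (Fin 2)}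
    (h : StoryRays P Θ a y j J k C p foot Ψ L A) {ξ Y : E3} (hξ : ξ ∈ C) (hY : Y ∈ P.tube a k)
    (hYf : Y ∈ frontier (Θ k)) :
    ReflectsAt (Θ k) P.δ (storyPhase Θ P.δ y ξ J) Y (reflectDir (n k Y) (p ξ Y)) := by
  have hph := h.incoming.phase ξ hξ
  have hYi : Y ∈ interior (storyPhase Θ P.δ y ξ J).dom :=
    interior_maximal (h.subset_dom ξ hξ) (isOpen_tubeBall _ _ _ _) hY
  have hg := (h.value ξ hξ).gradient_eq hYi (hph.grad Y hY)
  refine ⟨hYi, n k Y, (hP.chart k).normal Y hYf, ?_, ?_⟩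
  · rw [hg]; linarith [(hP.chart k).le_neg_inner hph hY, hP.δ_le]
  · rw [hg]; rfl

theorem StoryRays.region_subset_dom (hP : P.Fits Θ a n) {y : E3} {J : List (Fin 2)}
    (h : StoryRays P Θ a y j J k C p foot Ψ L A) (ho : OutgoingRays P Θ a n k C p X τ) {ξ : E3}
    (hξ : ξ ∈ C) : P.region Θ a k ⊆ (storyPhase Θ P.δ y ξ (J ++ [k])).dom := by
  intro z hz
  rw [storyPhase_append]
  exact ⟨X ξ z, _, τ ξ z, h.reflectsAt hP hξ (ho.mem ξ hξ z hz) (ho.frontier ξ hξ z hz),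
    ho.nonneg ξ hξ z hz, ho.eq ξ hξ z hz⟩

theorem StoryRays.reflect (hP : P.Fits Θ a n) (hB : ReflectionMaps P Θ a n B l A) {y : E3}
    {J : List (Fin 2)} (h : StoryRays P Θ a y j J k C p foot Ψ L A) :
    ∃ p' foot' Ψ' L', StoryRays P Θ a y j (J ++ [k]) (other k) C p' foot' Ψ' L' A := by
  obtain ⟨X, τ, ho⟩ := exists_outgoing hP h.incoming
  have hch := hP.chart k
  have htr := (h.traced.reflect hP hB h.incoming ho).mono
    (D' := P.tube a (other k)) fun z hz => (hP.tube_other_subset k hz).1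
  have hin := ho.incomingFamily hP h.incoming
  simp only [← storyValue_append] at htr hin
  refine ⟨_, _, _, _, ⟨hin, fun ξ hξ => ?_, fun ξ hξ z hz => ?_,
    by simpa only [List.length_append, List.length_singleton] using htr⟩⟩
  · rw [storyPhase_append, storyValue_append]
    exact (h.value ξ hξ).reflect hP.δ_pos ⟨_, hch.mem⟩ hch.isCompact hch.convex
      (hP.disjoint_other k)
  · exact h.region_subset_dom hP ho hξ (hP.tube_other_subset k hz).1

theorem norm_iteratedFDeriv_id_le {E : Type*} [NormedAddCommGroup E] [NormedSpace ℝ E] (x : E)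
    {i : ℕ} (hi : 1 ≤ i) : ‖iteratedFDeriv ℝ i (id : E → E) x‖ ≤ 1 := by
  obtain ⟨i, rfl⟩ := Nat.exists_eq_add_of_le' hi
  rw [← norm_iteratedFDeriv_fderiv]
  have : fderiv ℝ (id : E → E) = fun _ => ContinuousLinearMap.id ℝ E := by ext1; exact fderiv_id
  rw [this]
  rcases Nat.eq_zero_or_pos i with rfl | hi'
  · rw [norm_iteratedFDeriv_zero]; exact ContinuousLinearMap.norm_id_le
  · rw [iteratedFDeriv_const_of_ne hi'.ne']; simp

theorem continuousOn_normalize {C : Set E3} (hC : ∀ ξ ∈ C, ξ ≠ 0) :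
    ContinuousOn (fun ξ : E3 => ‖ξ‖⁻¹ • ξ) C :=
  (continuousOn_id.norm.inv₀ fun ξ hξ => norm_ne_zero_iff.2 (hC ξ hξ)).smul continuousOn_id

/-- The direction `ξ / |ξ|` is constant, so every invariant reduces to its distance `< η` from the
axis. For the slope, the component orthogonal to the axis only sees `ξ / |ξ| - e`. -/
theorem storyRays_nil (hP : P.Fits Θ a n) (hB : ReflectionMaps P Θ a n B l A) (y : E3)
    (j : Fin 2) : StoryRays P Θ a y j [] j (directionCone (axisDir a j) P.η)
      (fun ξ _ => ‖ξ‖⁻¹ • ξ) (fun _ z => z) id (fun w => inner ℝ w.2 (w.1 - y)) A := by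
  have he := norm_axisDir hP.ne j
  refine ⟨⟨fun ξ hξ => ⟨(isValueOf_planePhase (Θ j) y hξ.1).continuous,
    convexOn_planePhase y ξ, fun z _ => hasGradientAt_planePhase y ξ z,
    fun _ _ => norm_normalize hξ.1, fun _ _ => hξ.2.le.trans hP.η_le, fun z _ => ?_,
    hξ.2.le.trans hP.η_le_c⟩, fun ξ _ z _ z' _ => ?_, fun z _ =>
      continuousOn_normalize fun ξ hξ => hξ.1⟩, fun ξ hξ => isValueOf_planePhase _ y hξ.1,
    fun ξ _ => Set.subset_univ _, ?_⟩
  · have h := abs_le.1 (abs_real_inner_le_norm (perp (axisDir a j) (z - a j))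
      (‖ξ‖⁻¹ • ξ - axisDir a j))
    rw [inner_sub_right, real_inner_comm (axisDir a j) (perp _ _), inner_perp he] at h
    have h2 := mul_le_mul_of_nonneg_left hξ.2.le (norm_nonneg (perp (axisDir a j) (z - a j)))
    linarith [h.1]
  · rw [sub_self, norm_zero]
    exact mul_nonneg hP.Lp_pos.le (norm_nonneg _)
  · refine ⟨fun ξ _ z _ z' _ => by simp, fun z _ => continuousOn_const, contDiff_id,
      contDiff_snd.inner ℝ (contDiff_fst.sub contDiff_const), fun ξ _ z _ s _ => rfl,
      fun ξ hξ z _ s _ => ?_, fun ξ _ z _ s _ m i hi him => ?_⟩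
    · change inner ℝ (‖ξ‖⁻¹ • ξ) (slide (a (other j)) (axisDir a j) z s (‖ξ‖⁻¹ • ξ) - y) =
        inner ℝ (z - y) ξ / ‖ξ‖ + _
      rw [show inner ℝ (z - y) ξ / ‖ξ‖ = inner ℝ (‖ξ‖⁻¹ • ξ) (z - y) by
        rw [inner_smul_left, real_inner_comm]; simp [div_eq_inv_mul], ← inner_add_right]
      congr 1; abel
    · refine (norm_iteratedFDeriv_id_le _ hi).trans ?_
      exact one_le_pow₀ (one_le_pow₀ (hB.one_le m))

/-- The finite alternating sequences with first index `j` whose next index is `k`. -/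
inductive Reaches (j : Fin 2) : List (Fin 2) → Fin 2 → Prop
  | nil : Reaches j [] j
  | snoc {J : List (Fin 2)} {k : Fin 2} : Reaches j J k → Reaches j (J ++ [k]) (other k)

theorem eq_other_of_ne {i k : Fin 2} (h : i ≠ k) : other i = k := by
  fin_cases i <;> fin_cases k <;> simp_all [other]

theorem IsStory.exists_reaches {j k : Fin 2} {J : List (Fin 2)} (h : IsStory j k J) :
    ∃ J', J = J' ++ [k] ∧ Reaches j J' k := by
  induction J using List.reverseRecOn generalizing k with
  | nil => simp [IsStory] at h
  | append_singleton J i ih =>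
    obtain ⟨h1, h2, h3⟩ := h
    have hi : i = k := by simpa using h2
    subst hi
    refine ⟨J, rfl, ?_⟩
    rcases List.eq_nil_or_concat J with rfl | ⟨J', i', rfl⟩
    · have : i = j := by simpa using h1
      rw [this]; exact .nil
    · simp only [List.concat_eq_append] at *
      rw [List.isChain_append] at h3
      have hne : i' ≠ i := h3.2.2 i' (by simp) i (by simp)
      obtain ⟨J'', e, hJ⟩ := ih (k := i') ⟨by
        cases J' <;> simpa using h1, by simp, h3.1⟩
      have := List.append_inj_left' e rfl
      rw [← eq_other_of_ne hne, this]
      exact .snoc hJ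

theorem Reaches.exists_storyRays (hP : P.Fits Θ a n) (hB : ReflectionMaps P Θ a n B l A) (y : E3)
    {j k : Fin 2} {J : List (Fin 2)} (h : Reaches j J k) :
    ∃ p foot Ψ L, StoryRays P Θ a y j J k (directionCone (axisDir a j) P.η) p foot Ψ L A := by
  induction h with
  | nil => exact ⟨_, _, _, _, storyRays_nil hP hB y j⟩
  | snoc _ ih =>
    obtain ⟨p, foot, Ψ, L, h⟩ := ih
    exact h.reflect hP hB

end Trace

/-! ### Prolongation of the phase into the obstacle -/

theorem hasGradientAt_of_quadratic {E : Type*} [NormedAddCommGroup E] [InnerProductSpace ℝ E]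
    [CompleteSpace E] {f : E → ℝ} {q x : E} {K : ℝ} {U : Set E} (hU : U ∈ nhds x)
    (h : ∀ x' ∈ U, |f x' - f x - inner ℝ q (x' - x)| ≤ K * ‖x' - x‖ ^ 2) :
    HasGradientAt f q x := by
  rw [hasGradientAt_iff_isLittleO]
  have h1 : (fun x' => f x' - f x - inner ℝ q (x' - x)) =O[nhds x] fun x' => ‖x' - x‖ ^ 2 := by
    refine Asymptotics.IsBigO.of_bound K ?_
    filter_upwards [hU] with x' hx'
    rw [Real.norm_eq_abs, norm_pow, norm_norm]
    exact h x' hx'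
  refine h1.trans_isLittleO ?_
  have h2 : Filter.Tendsto (fun x' => x' - x) (nhds x) (nhds 0) := by
    have : Continuous fun x' : E => x' - x := by fun_prop
    simpa using this.tendsto x
  exact (Asymptotics.isLittleO_norm_pow_id one_lt_two).comp_tendsto h2

theorem isOpen_openCylinder (a : Fin 2 → E3) (r ρ : ℝ) : IsOpen (openCylinder a r ρ) := by
  unfold openCylinder
  exact (isOpen_lt (by fun_prop) (by fun_prop)).and
    ((isOpen_lt (by fun_prop) (by fun_prop)).and (isOpen_lt (by fun_prop) (by fun_prop)))

theorem isOpen_directionCone (d : E3) (η : ℝ) : IsOpen (directionCone d η) := by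
  have h : IsOpen {ξ : E3 | ξ ≠ 0} := isOpen_ne
  have h2 := (((continuousOn_normalize (C := {ξ : E3 | ξ ≠ 0}) fun ξ hξ => hξ).sub
    continuousOn_const).norm : ContinuousOn (fun ξ : E3 => ‖‖ξ‖⁻¹ • ξ - d‖) _)
  exact h2.isOpen_inter_preimage h isOpen_Iio

/-- The cylinder of radius `r` prolonged by `ρ'` is covered by the rays that leave the obstacles
prolonged backwards by the length `s`. -/
structure TubeParams.Prolongs (P : TubeParams) (r ρ' s : ℝ) : Prop where
  r_pos : 0 < r
  ρ_pos : 0 < ρ'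
  s_pos : 0 < s
  contract : s * (6 * (3 * P.Lp + 4 * P.Ln)) ≤ 1 / 2
  radius : r + s ≤ P.R
  length : ρ' + s ≤ P.ρ
  s_le : s ≤ 1 / 4
  quad : ρ' ≤ P.c * (s / 4) ^ 2
  linear : ρ' < P.c * P.ε * P.ε

/-- The rays of the reflected phase prolonged backwards: `x` is the point of abscissa `-s` on the
ray through `x⁺ ξ x`. -/
structure ProlongedRays (P : TubeParams) (Θ : Fin 2 → Set E3) (a : Fin 2 → E3) (k : Fin 2)
    (C U : Set E3) (q : E3 → E3 → E3) (s : ℝ) (xp : E3 → E3 → E3) : Prop where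
  mem : ∀ ξ ∈ C, ∀ x ∈ U, xp ξ x ∈ P.region Θ a k
  notMem : ∀ ξ ∈ C, ∀ x ∈ U, xp ξ x ∉ Θ k
  eq : ∀ ξ ∈ C, ∀ x ∈ U, xp ξ x = x + s • q ξ (xp ξ x)

section Prolong

variable {P : TubeParams} {Θ : Fin 2 → Set E3} {a : Fin 2 → E3} {n : Fin 2 → E3 → E3} {k : Fin 2}
  {C : Set E3} {M : E3 → E3 → ℝ} {p : E3 → E3 → E3} {X : E3 → E3 → E3} {τ : E3 → E3 → ℝ}
  {r ρ' s : ℝ} {xp : E3 → E3 → E3} {U : Set E3} {q : E3 → E3 → E3}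

/-- The Lipschitz estimate for feet leaves the second time free, so two feet whose lines meet at
`z'` coincide. -/
theorem OutgoingRays.foot_unique (hP : P.Fits Θ a n) (hin : IncomingFamily P a k C M p)
    (ho : OutgoingRays P Θ a n k C p X τ) {ξ z z' : E3} (hξ : ξ ∈ C) (hz : z ∈ P.region Θ a k)
    (hz' : z' ∈ P.region Θ a k) {t : ℝ}
    (he : z' = X ξ z + t • reflectDir (n k (X ξ z)) (p ξ (X ξ z))) : X ξ z' = X ξ z := by
  have h := (hP.chart k).foot_sub_le (hin.phase ξ hξ) (hin.phase ξ hξ) (Lp := P.Lp) (E₀ := 0)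
    (by linarith [hP.ε₁_le]) (ho.frontier ξ hξ z' hz') (ho.mem ξ hξ z' hz')
    (ho.frontier ξ hξ z hz) (ho.mem ξ hξ z hz) (ho.nonneg ξ hξ z' hz')
    (τ' := t) (ho.le_T hP hin hξ hz') (by simp)
    (hin.lip ξ hξ _ (ho.mem ξ hξ z' hz') _ (ho.mem ξ hξ z hz)) hP.small
  rw [← ho.eq ξ hξ z' hz', ← he] at h
  simpa [sub_eq_zero] using h

theorem mem_region_of_mem_openCylinder (hP : P.Fits Θ a n) (hr : P.Prolongs r ρ' s) {x : E3}
    (hx : x ∈ openCylinder a r ρ') (hxΘ : x ∉ interior (Θ k)) : x ∈ P.region Θ a k := by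
  obtain ⟨h1, h2, h3⟩ := (mem_openCylinder_iff hP.ne k).1 hx
  rw [← hP.d_eq] at h2
  have := hr.s_pos
  exact ⟨hxΘ, by linarith [hr.radius], by linarith [hr.length],
    by linarith [hr.length, hP.ρ_le]⟩

/-- A point outside the obstacle is pushed forward along its own ray. -/
theorem OutgoingRays.push_mem (hP : P.Fits Θ a n) (hin : IncomingFamily P a k C M p)
    (ho : OutgoingRays P Θ a n k C p X τ) (hr : P.Prolongs r ρ' s) {ξ x : E3} (hξ : ξ ∈ C)
    (hx : x ∈ openCylinder a r ρ') (hxΘ : x ∉ interior (Θ k)) :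
    x + s • reflectDir (n k (X ξ x)) (p ξ (X ξ x)) ∈ P.region Θ a k ∧
    x + s • reflectDir (n k (X ξ x)) (p ξ (X ξ x)) ∉ Θ k ∧
    X ξ (x + s • reflectDir (n k (X ξ x)) (p ξ (X ξ x))) = X ξ x := by
  have hz := mem_region_of_mem_openCylinder hP hr hx hxΘ
  obtain ⟨h1, h2, h3⟩ := (mem_openCylinder_iff hP.ne k).1 hx
  rw [← hP.d_eq] at h2
  have hq := ho.norm_dir hP hin hξ hz
  have hq' := ho.inner_dir_pos hP hin hξ hz
  have hek := norm_axisDir hP.ne k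
  have hs := hr.s_pos
  rw [axisDir_other, inner_neg_left] at hq'
  set q := reflectDir (n k (X ξ x)) (p ξ (X ξ x)) with hqd
  have he : x + s • q = X ξ x + (τ ξ x + s) • q := by
    rw [add_smul, ho.smul_dir hξ hz]; abel
  have hn : x + s • q ∉ Θ k := by
    rw [he]
    exact (hP.chart k).reflected_notMem (hin.phase ξ hξ) (by linarith [hP.ε₁_le])
      (ho.frontier ξ hξ x hz) (ho.mem ξ hξ x hz) (by linarith [ho.nonneg ξ hξ x hz])
  have hqi := abs_le.1 (abs_real_inner_le_norm (axisDir a k) q)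
  rw [hek, hq] at hqi
  have hmem : x + s • q ∈ P.region Θ a k := by
    have e0 : x + s • q - a k = (x - a k) + s • q := by abel
    refine ⟨fun h => hn (interior_subset h), ?_, ?_, ?_⟩
    · rw [e0, perp_add, perp_smul]
      have h4 := norm_perp_le hek q
      refine (norm_add_le _ _).trans_lt ?_
      rw [norm_smul, Real.norm_of_nonneg hs.le]
      rw [hq] at h4
      nlinarith [hr.radius]
    · rw [e0, inner_add_right, inner_smul_right]
      nlinarith [hr.length]
    · rw [e0, inner_add_right, inner_smul_right]
      nlinarith [hr.length, hP.ρ_le]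
  exact ⟨hmem, hn, ho.foot_unique hP hin hξ hz hmem he⟩

/-- Banach's fixed point theorem for `z ↦ x + s q(z)` on the ball of radius `s / 2` around `a k - s
e`. This ball lies outside `Θ k`, and curvature puts `x` within `s / 4` of `a k`. -/
theorem OutgoingRays.exists_prolonged_of_mem (hP : P.Fits Θ a n)
    (hin : IncomingFamily P a k C M p) (ho : OutgoingRays P Θ a n k C p X τ)
    (hr : P.Prolongs r ρ' s) {ξ x : E3} (hξ : ξ ∈ C) (hx : x ∈ openCylinder a r ρ')
    (hxΘ : x ∈ Θ k) : ∃ z, z ∈ P.region Θ a k ∧ z ∉ Θ k ∧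
      z = x + s • reflectDir (n k (X ξ z)) (p ξ (X ξ z)) := by
  have hch := hP.chart k
  have hek := norm_axisDir hP.ne k
  have hs := hr.s_pos
  have h1 := ((mem_openCylinder_iff hP.ne k).1 hx).1
  have hxa : ‖x - a k‖ ≤ s / 4 := by
    rcases lt_or_ge ‖x - a k‖ P.ε with h | h
    · have h2 := hch.quad x hxΘ h
      have h3 : P.c * ‖x - a k‖ ^ 2 ≤ P.c * (s / 4) ^ 2 := by linarith [hr.quad]
      exact (pow_le_pow_iff_left₀ (norm_nonneg _) (by linarith) two_ne_zero).1
        (le_of_mul_le_mul_left h3 hP.c_pos)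
    · have h2 := hch.linear x hxΘ h
      have h3 := mul_le_mul_of_nonneg_left h (mul_pos hP.c_pos hP.ε_pos).le
      linarith [hr.linear]
  set b := a k - s • axisDir a k with hb
  have hball : ∀ z ∈ Metric.closedBall b (s / 2), z ∈ P.region Θ a k ∧ z ∉ Θ k := by
    intro z hz
    rw [Metric.mem_closedBall, dist_eq_norm] at hz
    have e0 : z - a k = (z - b) + (-s) • axisDir a k := by rw [hb]; module
    have hp0 : perp (axisDir a k) (axisDir a k) = 0 := by
      rw [perp, real_inner_self_eq_norm_sq, hek]; simp
    have hi := abs_le.1 (abs_real_inner_le_norm (axisDir a k) (z - b))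
    rw [hek, one_mul] at hi
    have hin0 : inner ℝ (axisDir a k) (z - a k) = inner ℝ (axisDir a k) (z - b) - s := by
      rw [e0, inner_add_right, inner_smul_right, real_inner_self_eq_norm_sq, hek]; ring
    have hn : z ∉ Θ k := fun h => by linarith [hch.nonneg z h]
    refine ⟨⟨fun h => hn (interior_subset h), ?_, ?_, ?_⟩, hn⟩
    · rw [e0, perp_add, perp_smul, hp0, smul_zero, add_zero]
      linarith [norm_perp_le hek (z - b), hr.radius, hr.r_pos]
    · linarith [hP.ρ_pos]
    · linarith [hP.d_pos, hr.s_le]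
  set f : E3 → E3 := fun z => x + s • reflectDir (n k (X ξ z)) (p ξ (X ξ z)) with hf
  have hmaps : Set.MapsTo f (Metric.closedBall b (s / 2)) (Metric.closedBall b (s / 2)) := by
    intro z hz
    have h2 := ho.norm_dir_sub_le hP hin hξ (hball z hz).1
    rw [axisDir_other, sub_neg_eq_add] at h2
    rw [Metric.mem_closedBall, dist_eq_norm]
    have e0 : f z - b = (x - a k) +
        s • (reflectDir (n k (X ξ z)) (p ξ (X ξ z)) + axisDir a k) := by
      rw [hf, hb]; module
    rw [e0]
    refine (norm_add_le _ _).trans ?_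
    rw [norm_smul, Real.norm_of_nonneg hs.le]
    nlinarith
  have hcontr : ContractingWith (1 / 2 : NNReal) (hmaps.restrict f _ _) := by
    refine ⟨by rw [← NNReal.coe_lt_coe]; norm_num, LipschitzWith.of_dist_le_mul fun z z' => ?_⟩
    have h2 := ho.dir_lip hP hin hξ (hball z z.2).1 (hball z' z'.2).1
    change dist (f z) (f z') ≤ _ * dist (z : E3) z'
    rw [dist_eq_norm, dist_eq_norm, hf]
    simp only [add_sub_add_left_eq_sub, ← smul_sub]
    rw [norm_smul, Real.norm_of_nonneg hs.le]
    refine (mul_le_mul_of_nonneg_left h2 hs.le).trans ?_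
    rw [← mul_assoc]
    refine mul_le_mul_of_nonneg_right ?_ (norm_nonneg _)
    simpa using hr.contract
  obtain ⟨z, hz, hfix, -⟩ := hcontr.exists_fixedPoint' Metric.isClosed_closedBall.isComplete
    hmaps (Metric.mem_closedBall_self (by linarith : (0 : ℝ) ≤ s / 2)) (edist_ne_top _ _)
  exact ⟨z, (hball z hz).1, (hball z hz).2, hfix.symm⟩

theorem OutgoingRays.exists_prolonged (hP : P.Fits Θ a n) (hin : IncomingFamily P a k C M p)
    (ho : OutgoingRays P Θ a n k C p X τ) (hr : P.Prolongs r ρ' s) :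
    ∃ xp, ProlongedRays P Θ a k C (openCylinder a r ρ')
      (fun ξ z => reflectDir (n k (X ξ z)) (p ξ (X ξ z))) s xp := by
  have h : ∀ ξ x, ∃ z, ξ ∈ C → x ∈ openCylinder a r ρ' → z ∈ P.region Θ a k ∧ z ∉ Θ k ∧
      z = x + s • reflectDir (n k (X ξ z)) (p ξ (X ξ z)) := by
    intro ξ x
    by_cases hξ : ξ ∈ C
    · by_cases hx : x ∈ openCylinder a r ρ'
      · by_cases hxΘ : x ∈ interior (Θ k)
        · obtain ⟨z, hz⟩ := ho.exists_prolonged_of_mem hP hin hr hξ hx (interior_subset hxΘ)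
          exact ⟨z, fun _ _ => hz⟩
        · obtain ⟨h1, h2, h3⟩ := ho.push_mem hP hin hr hξ hx hxΘ
          exact ⟨_, fun _ _ => ⟨h1, h2, by rw [h3]⟩⟩
      · exact ⟨0, fun _ h => absurd h hx⟩
    · exact ⟨0, fun h => absurd h hξ⟩
  choose xp h using h
  exact ⟨xp, fun ξ hξ x hx => (h ξ x hξ hx).1, fun ξ hξ x hx => (h ξ x hξ hx).2.1,
    fun ξ hξ x hx => (h ξ x hξ hx).2.2⟩

namespace ProlongedRays

variable {L : ℝ}

theorem norm_sub_le (hs : 0 < s) (hL : s * L ≤ 1 / 2) (h : ProlongedRays P Θ a k C U q s xp)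
    (hq : ∀ ξ ∈ C, ∀ z ∈ P.region Θ a k, ∀ z' ∈ P.region Θ a k, ‖q ξ z - q ξ z'‖ ≤ L * ‖z - z'‖)
    {ξ ξ' x x' : E3} (hξ : ξ ∈ C) (hξ' : ξ' ∈ C) (hx : x ∈ U) (hx' : x' ∈ U) :
    ‖xp ξ x - xp ξ' x'‖ ≤ 2 * ‖x - x'‖ + 2 * s * ‖q ξ (xp ξ x) - q ξ' (xp ξ x)‖ := by
  have h1 := h.eq ξ hξ x hx
  have h2 := h.eq ξ' hξ' x' hx'
  have e : xp ξ x - xp ξ' x' = (x - x') + s • ((q ξ (xp ξ x) - q ξ' (xp ξ x)) +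
      (q ξ' (xp ξ x) - q ξ' (xp ξ' x'))) := by
    calc _ = (x + s • q ξ (xp ξ x)) - (x' + s • q ξ' (xp ξ' x')) := by rw [← h1, ← h2]
      _ = _ := by module
  have h3 := hq ξ' hξ' _ (h.mem ξ hξ x hx) _ (h.mem ξ' hξ' x' hx')
  have h4 := norm_add_le (x - x') (s • ((q ξ (xp ξ x) - q ξ' (xp ξ x)) +
      (q ξ' (xp ξ x) - q ξ' (xp ξ' x'))))
  have h5 := norm_add_le (q ξ (xp ξ x) - q ξ' (xp ξ x)) (q ξ' (xp ξ x) - q ξ' (xp ξ' x'))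
  rw [← e, norm_smul, Real.norm_of_nonneg hs.le] at h4
  have h6 := mul_le_mul_of_nonneg_left (h5.trans (add_le_add_right h3 _)) hs.le
  have h7 := mul_le_mul_of_nonneg_right hL (norm_nonneg (xp ξ x - xp ξ' x'))
  nlinarith

theorem cont (hs : 0 < s) (hL : s * L ≤ 1 / 2) (h : ProlongedRays P Θ a k C U q s xp)
    (hq : ∀ ξ ∈ C, ∀ z ∈ P.region Θ a k, ∀ z' ∈ P.region Θ a k, ‖q ξ z - q ξ z'‖ ≤ L * ‖z - z'‖)
    (hc : ∀ z ∈ P.region Θ a k, ContinuousOn (fun ξ => q ξ z) C) {x : E3} (hx : x ∈ U) :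
    ContinuousOn (fun ξ => xp ξ x) C := by
  refine continuousOn_of_norm_sub_le (fun ξ ξ' => 2 * s * ‖q ξ (xp ξ x) - q ξ' (xp ξ x)‖)
    (fun ξ hξ ξ' hξ' => ?_) fun ξ hξ => ?_
  · rw [norm_sub_rev]
    simpa using h.norm_sub_le hs hL hq hξ hξ' hx hx
  · simpa using (tendsto_norm_sub_zero (hc _ (h.mem ξ hξ x hx)) hξ).const_mul (2 * s)

/-- The gradient inequalities of `V ξ` at the two pushed points sandwich the increment. The shift `s
(u' - u)` contributes only at second order, since `⟪u, u' - u⟫ = -‖u' - u‖² / 2` for unit vectors.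
-/
theorem hasGradientAt (hs : 0 < s) (hL : s * L ≤ 1 / 2) (hU : IsOpen U)
    (h : ProlongedRays P Θ a k C U q s xp)
    (hq : ∀ ξ ∈ C, ∀ z ∈ P.region Θ a k, ∀ z' ∈ P.region Θ a k, ‖q ξ z - q ξ z'‖ ≤ L * ‖z - z'‖)
    (hq1 : ∀ ξ ∈ C, ∀ z ∈ P.region Θ a k, ‖q ξ z‖ = 1) {V : E3 → E3 → ℝ}
    (hconv : ∀ ξ ∈ C, ConvexOn ℝ Set.univ (V ξ))
    (hV : ∀ ξ ∈ C, ∀ z ∈ P.region Θ a k, z ∉ Θ k → HasGradientAt (V ξ) (q ξ z) z)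
    {ξ x : E3} (hξ : ξ ∈ C) (hx : x ∈ U) :
    HasGradientAt (fun x => V ξ (xp ξ x) - s) (q ξ (xp ξ x)) x := by
  refine hasGradientAt_of_quadratic (K := |L| * 2 + 2 * s * |L| ^ 2) (hU.mem_nhds hx)
    fun x' hx' => ?_
  have hm := h.mem ξ hξ x hx
  have hm' := h.mem ξ hξ x' hx'
  have g1 := (hconv ξ hξ).add_inner_le (hV ξ hξ _ hm (h.notMem ξ hξ x hx)) (xp ξ x')
  have g2 := (hconv ξ hξ).add_inner_le (hV ξ hξ _ hm' (h.notMem ξ hξ x' hx')) (xp ξ x)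
  have n1 := hq1 ξ hξ _ hm
  have n2 := hq1 ξ hξ _ hm'
  have l1 := hq ξ hξ _ hm' _ hm
  have l2 := h.norm_sub_le hs hL hq hξ hξ hx' hx
  rw [sub_self, norm_zero, mul_zero, add_zero] at l2
  have h1 := h.eq ξ hξ x hx
  have h2 := h.eq ξ hξ x' hx'
  set u := q ξ (xp ξ x)
  set u' := q ξ (xp ξ x')
  have e : xp ξ x' - xp ξ x = (x' - x) + s • (u' - u) := by
    rw [h1, h2]; module
  rw [← neg_sub (xp ξ x'), inner_neg_right] at g2
  rw [e, inner_add_right, inner_smul_right, inner_sub_right u u', real_inner_self_eq_norm_sq] at g1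
  rw [e, inner_add_right, inner_smul_right, inner_sub_right u' u', real_inner_self_eq_norm_sq] at g2
  have e2 : ‖u' - u‖ ^ 2 = 2 - 2 * inner ℝ u u' := by
    rw [norm_sub_sq_real, n1, n2, real_inner_comm]; ring
  have e3 : inner ℝ u' (x' - x) = inner ℝ u (x' - x) + inner ℝ (u' - u) (x' - x) := by
    rw [inner_sub_left]; ring
  have c1 := (abs_le.1 (abs_real_inner_le_norm (u' - u) (x' - x))).2
  rw [real_inner_comm u u'] at g2
  rw [n1] at g1
  rw [n2, e3] at g2
  have b1 : ‖u' - u‖ ≤ |L| * (2 * ‖x' - x‖) :=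
    (l1.trans (mul_le_mul_of_nonneg_right (le_abs_self L) (norm_nonneg _))).trans
      (mul_le_mul_of_nonneg_left l2 (abs_nonneg L))
  have b2 : ‖u' - u‖ ^ 2 ≤ (|L| * (2 * ‖x' - x‖)) ^ 2 :=
    pow_le_pow_left₀ (norm_nonneg _) b1 2
  have b3 := mul_le_mul_of_nonneg_right b1 (norm_nonneg (x' - x))
  have b4 := mul_le_mul_of_nonneg_left b2 hs.le
  have b5 : 0 ≤ |L| * (2 * ‖x' - x‖) * ‖x' - x‖ := by positivity
  rw [abs_le]
  constructor <;> nlinarith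

end ProlongedRays

end Prolong

/-! ### The phase in terms of the map of rays -/

theorem norm_slide_sub_le {a' e z z' p : E3} {t t' : ℝ} (he : ‖e‖ = 1) (hp : ‖p‖ = 1)
    (h : 1 / 2 ≤ inner ℝ e p) :
    ‖slide a' e z t p - slide a' e z' t' p‖ ≤ 3 * ‖z - z'‖ + 2 * |t - t'| := by
  have e1 : slide a' e z t p - slide a' e z' t' p =
      (z - z') + (((t - t') - inner ℝ e (z - z')) / inner ℝ e p) • p := by
    have : inner ℝ e (z - z') = inner ℝ e (z - a') - inner ℝ e (z' - a') := by
      rw [← inner_sub_right]; congr 1; abel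
    rw [slide, slide, this]
    module
  rw [e1]
  refine (norm_add_le _ _).trans ?_
  rw [norm_smul, hp, mul_one, Real.norm_eq_abs, abs_div,
    abs_of_pos (show 0 < inner ℝ e p by linarith)]
  have h1 := abs_real_inner_le_norm e (z - z')
  rw [he, one_mul] at h1
  have h2 := abs_sub (t - t') (inner ℝ e (z - z'))
  have h3 : |(t - t') - inner ℝ e (z - z')| / inner ℝ e p ≤ 2 * (|t - t'| + ‖z - z'‖) := by
    rw [div_le_iff₀ (by linarith)]
    have : 0 ≤ |t - t'| + ‖z - z'‖ := by positivity
    nlinarith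
  linarith

/-- The smooth map `Ψ` of rays, followed along `w`, reaches every point of `U`; the second
component of `Ψ` is then the gradient of the phase `Φ`. -/
structure RayChart (U C : Set E3) (Φ : E3 → E3 → ℝ) (w : E3 × E3 → E3)
    (Ψ : E3 × E3 → E3 × E3) (L : E3 × E3 → ℝ) (K : ℝ) (A : ℕ → ℝ) : Prop where
  smooth_map : ContDiff ℝ ∞ Ψ
  smooth_length : ContDiff ℝ ∞ L
  cont : ContinuousOn w (U ×ˢ C)
  lip : ∀ ξ ∈ C, ∀ x ∈ U, ∀ x' ∈ U, ‖w (x, ξ) - w (x', ξ)‖ ≤ K * ‖x - x'‖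
  fst_eq : ∀ ξ ∈ C, ∀ x ∈ U, (Ψ (w (x, ξ), ‖ξ‖⁻¹ • ξ)).1 = x
  length_eq : ∀ ξ ∈ C, ∀ x ∈ U, L (w (x, ξ), ‖ξ‖⁻¹ • ξ) = Φ x ξ
  grad : ∀ ξ ∈ C, ∀ x ∈ U, HasGradientAt (fun x => Φ x ξ) (Ψ (w (x, ξ), ‖ξ‖⁻¹ • ξ)).2 x
  norm_eq : ∀ ξ ∈ C, ∀ x ∈ U, ‖(Ψ (w (x, ξ), ‖ξ‖⁻¹ • ξ)).2‖ = 1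
  bound : ∀ ξ ∈ C, ∀ x ∈ U, ∀ m i, 1 ≤ i → i ≤ m →
    ‖iteratedFDeriv ℝ i Ψ (w (x, ξ), ‖ξ‖⁻¹ • ξ)‖ ≤ A m ^ i

section Chart

variable {P : TubeParams} {Θ : Fin 2 → Set E3} {a : Fin 2 → E3} {n : Fin 2 → E3 → E3}
  {j k : Fin 2} {p foot : E3 → E3 → E3} {Ψ : E3 × E3 → E3 × E3} {L : E3 × E3 → ℝ} {A : ℕ → ℝ}
  {B : Fin 2 → E3 × E3 → E3 × E3} {l : Fin 2 → E3 × E3 → ℝ} {r ρ' s : ℝ}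

/-- A point `x` is pushed forward to `xp ξ x`, its ray is traced back to the plane phase, and the
initial state is chosen with the abscissa of `x`. Since abscissas are preserved, `Ψ` sends this
state to `x` itself. -/
theorem StoryRays.exists_rayChart (hP : P.Fits Θ a n) (hB : ReflectionMaps P Θ a n B l A)
    (hr : P.Prolongs r ρ' s) {y : E3} {J : List (Fin 2)}
    (h : StoryRays P Θ a y j J k (directionCone (axisDir a j) P.η) p foot Ψ L A) :
    ∃ Φ w Ψ' L', RayChart (openCylinder a r ρ') (directionCone (axisDir a j) P.η) Φ w Ψ' L'
        (48 ^ (J.length + 1)) (fun m => A m ^ (J.length + 1 + 1)) ∧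
      ∀ ξ ∈ directionCone (axisDir a j) P.η, ∀ x ∈ openCylinder a r ρ' \ interior (Θ k),
        x ∈ (storyPhase Θ P.δ y ξ (J ++ [k])).dom ∧
          Φ x ξ = (storyPhase Θ P.δ y ξ (J ++ [k])).toFun x := by
  obtain ⟨X, τ, ho⟩ := exists_outgoing hP h.incoming
  obtain ⟨xp, hxp⟩ := ho.exists_prolonged hP h.incoming hr
  have htr := h.traced.reflect hP hB h.incoming ho
  have hch := hP.chart k
  have hej := norm_axisDir hP.ne j
  have hek := norm_axisDir hP.ne (other k)
  set C := directionCone (axisDir a j) P.η with hC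
  set q : E3 → E3 → E3 := fun ξ z => reflectDir (n k (X ξ z)) (p ξ (X ξ z)) with hq
  set V : E3 → E3 → ℝ := fun ξ => valueThrough (Θ k) (storyValue Θ y ξ J) with hV
  set f : E3 → E3 → E3 := fun ξ z => foot ξ (X ξ z) with hf
  set U := openCylinder a r ρ' with hU
  have hs := hr.s_pos
  have hlip : ∀ ξ ∈ C, ∀ z ∈ P.region Θ a k, ∀ z' ∈ P.region Θ a k,
      ‖q ξ z - q ξ z'‖ ≤ 6 * (3 * P.Lp + 4 * P.Ln) * ‖z - z'‖ :=
    fun ξ hξ z hz z' hz' => ho.dir_lip hP h.incoming hξ hz hz'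
  have hvp : ∀ ξ ∈ C, ∀ x ∈ U, ∀ x' ∈ U, ‖xp ξ x - xp ξ x'‖ ≤ 2 * ‖x - x'‖ := by
    intro ξ hξ x hx x' hx'
    simpa using hxp.norm_sub_le hs hr.contract hlip hξ hξ hx hx'
  have hconv : ∀ ξ ∈ C, ConvexOn ℝ Set.univ (V ξ) := fun ξ hξ =>
    convexOn_valueThrough ⟨_, hch.mem⟩ hch.isCompact hch.convex (h.incoming.phase ξ hξ).continuous
      (h.incoming.phase ξ hξ).convex
  have hgr : ∀ ξ ∈ C, ∀ x ∈ U,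
      HasGradientAt (fun x => V ξ (xp ξ x) - s) (q ξ (xp ξ x)) x := fun ξ hξ x hx =>
    hxp.hasGradientAt hs hr.contract (isOpen_openCylinder a r ρ') hlip
      (fun ξ hξ z hz => ho.norm_dir hP h.incoming hξ hz) hconv
      (fun ξ hξ z hz hz' => ho.hasGradientAt hP h.incoming hξ hz hz') hξ hx
  set t : E3 → ℝ := fun x => inner ℝ (axisDir a (other k)) (x - a k) with ht
  have htm : ∀ x ∈ U, t x ∈ Set.Icc (-1) (P.d + 1) := by
    intro x hx
    obtain ⟨h1, h2, -⟩ := (mem_openCylinder_iff hP.ne k).1 hx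
    rw [← hP.d_eq] at h2
    have : t x = -inner ℝ (axisDir a k) (x - a k) := by
      change inner ℝ (axisDir a (other k)) (x - a k) = _
      rw [axisDir_other, inner_neg_left]
    rw [this]
    constructor <;> linarith [hr.length, hP.ρ_le]
  have hmap : ∀ ξ ∈ C, ∀ x ∈ U, slide (a k) (axisDir a (other k)) (xp ξ x) (t x) (q ξ (xp ξ x)) =
      x := by
    intro ξ hξ x hx
    have hpos := ho.inner_dir_pos hP h.incoming hξ (hxp.mem ξ hξ x hx)
    nth_rewrite 1 [hxp.eq ξ hξ x hx]
    rw [slide_add_smul _ _ _ _ _ hpos.ne', slide_eq_self]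
  have hmap' : ∀ ξ ∈ C, ∀ x ∈ U, (B k ∘ Ψ) (startRay a j ξ (f ξ (xp ξ x)) (t x)) =
      (x, q ξ (xp ξ x)) := by
    intro ξ hξ x hx
    have := htr.map_eq ξ hξ _ (hxp.mem ξ hξ x hx) (t x) (htm x hx)
    rw [other_other] at this
    rw [this, hmap ξ hξ x hx]
  have hflip : ∀ ξ ∈ C, ∀ x ∈ U, ∀ x' ∈ U,
      ‖f ξ (xp ξ x) - f ξ (xp ξ x')‖ ≤ 6 ^ (J.length + 1) * (2 * ‖x - x'‖) := by
    intro ξ hξ x hx x' hx'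
    exact (htr.foot_lip ξ hξ _ (hxp.mem ξ hξ x hx) _ (hxp.mem ξ hξ x' hx')).trans
      (mul_le_mul_of_nonneg_left (hvp ξ hξ x hx x' hx') (by positivity))
  have hdir : ∀ ξ ∈ C, 1 / 2 ≤ inner ℝ (axisDir a j) (‖ξ‖⁻¹ • ξ) := by
    intro ξ hξ
    have h1 := abs_le.1 (abs_real_inner_le_norm (axisDir a j) (‖ξ‖⁻¹ • ξ - axisDir a j))
    rw [inner_sub_right, real_inner_self_eq_norm_sq, hej] at h1
    linarith [h1.1, hξ.2, hP.η_le, hP.ε₁_le]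
  have hfcont : ContinuousOn (fun z : E3 × E3 => f z.2 (xp z.2 z.1)) (U ×ˢ C) := by
    have hxc : ContinuousOn (fun z : E3 × E3 => xp z.2 z.1) (U ×ˢ C) :=
      continuousOn_prod_of_continuousOn_lipschitzOnWith _ 2
        (fun x hx => hxp.cont hs hr.contract hlip
          (fun z hz => ho.dir_cont hP h.incoming hz) hx)
        (fun ξ hξ => LipschitzOnWith.of_dist_le_mul fun x hx x' hx' => by
          simpa [dist_eq_norm] using hvp ξ hξ x hx x' hx')
    have hfc : ContinuousOn (fun z : E3 × E3 => f z.2 z.1) (P.region Θ a k ×ˢ C) :=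
      continuousOn_prod_of_continuousOn_lipschitzOnWith _ (6 ^ (J.length + 1))
        (fun z hz => htr.foot_cont z hz)
        (fun ξ hξ => LipschitzOnWith.of_dist_le_mul fun z hz z' hz' => by
          simpa [dist_eq_norm] using htr.foot_lip ξ hξ z hz z' hz')
    exact hfc.comp (hxc.prodMk continuousOn_snd) fun z hz => ⟨hxp.mem _ hz.2 _ hz.1, hz.2⟩
  refine ⟨fun x ξ => V ξ (xp ξ x) - s,
    fun z => (startRay a j z.2 (f z.2 (xp z.2 z.1)) (t z.1)).1, B k ∘ Ψ,
    fun w => L w + l k (Ψ w), ⟨htr.smooth_map, htr.smooth_length, ?_, ?_, ?_, ?_, ?_, ?_, ?_⟩, ?_⟩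
  · have hn : ContinuousOn (fun z : E3 × E3 => ‖z.2‖⁻¹ • z.2) (U ×ˢ C) :=
      (continuousOn_normalize (C := C) fun ξ hξ => hξ.1).comp continuousOn_snd fun z hz => hz.2
    have htc : Continuous t := by rw [ht]; fun_prop
    have h1 : ContinuousOn (fun z : E3 × E3 => t z.1 -
        inner ℝ (axisDir a j) (f z.2 (xp z.2 z.1) - a (other j))) (U ×ˢ C) :=
      (htc.comp continuous_fst).continuousOn.sub
        (continuousOn_const.inner (hfcont.sub continuousOn_const))
    have h2 : ContinuousOn (fun z : E3 × E3 => inner ℝ (axisDir a j) (‖z.2‖⁻¹ • z.2))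
        (U ×ˢ C) := continuousOn_const.inner hn
    exact hfcont.add ((h1.div h2 fun z hz => (one_half_pos.trans_le (hdir _ hz.2)).ne').smul hn)
  · intro ξ hξ x hx x' hx'
    refine (norm_slide_sub_le hej (norm_normalize hξ.1) (hdir ξ hξ)).trans ?_
    have h1 := hflip ξ hξ x hx x' hx'
    have h2 : |t x - t x'| ≤ ‖x - x'‖ := by
      rw [ht]
      simp only
      rw [← inner_sub_right, sub_sub_sub_cancel_right]
      simpa [hek] using abs_real_inner_le_norm (axisDir a (other k)) (x - x')
    -- The foot is Lipschitz with constant `2 * 6 ^ (J.length + 1)`. Sliding triples this and adds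
    -- `2`, and `6 * 6 ^ N + 2 ≤ 8 * 6 ^ N ≤ 48 ^ N` for `N = J.length + 1`.
    have h3 : (1 : ℝ) ≤ 6 ^ (J.length + 1) := one_le_pow₀ (by norm_num)
    have h4 : (8 : ℝ) ≤ 8 ^ (J.length + 1) := le_self_pow₀ (by norm_num) (by omega)
    have h5 : (48 : ℝ) ^ (J.length + 1) = 8 ^ (J.length + 1) * 6 ^ (J.length + 1) := by
      rw [← mul_pow]; norm_num
    have h6 := norm_nonneg (x - x')
    rw [h5]
    have h7 : 8 * (6 : ℝ) ^ (J.length + 1) ≤ 8 ^ (J.length + 1) * 6 ^ (J.length + 1) :=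
      mul_le_mul_of_nonneg_right h4 (by positivity)
    have h8 := mul_le_mul_of_nonneg_right h7 h6
    have h9 := mul_le_mul_of_nonneg_right h3 h6
    linarith
  · intro ξ hξ x hx
    exact congrArg Prod.fst (hmap' ξ hξ x hx)
  · intro ξ hξ x hx
    have h1 := htr.length_eq ξ hξ _ (hxp.mem ξ hξ x hx) (t x) (htm x hx)
    rw [other_other, hmap ξ hξ x hx] at h1
    have h2 : x - xp ξ x = -(s • q ξ (xp ξ x)) := by
      rw [← sub_eq_iff_eq_add'.2 (hxp.eq ξ hξ x hx), neg_sub]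
    have h3 := ho.norm_dir hP h.incoming hξ (hxp.mem ξ hξ x hx)
    change L (startRay a j ξ (f ξ (xp ξ x)) (t x)) +
      l k (Ψ (startRay a j ξ (f ξ (xp ξ x)) (t x))) = _
    rw [h1, h2, inner_neg_right, inner_smul_right, real_inner_self_eq_norm_sq, h3]
    simp only [hV]
    ring
  · intro ξ hξ x hx
    exact Eq.mpr (congrArg (fun v : E3 × E3 =>
      HasGradientAt (fun x => V ξ (xp ξ x) - s) v.2 x) (hmap' ξ hξ x hx)) (hgr ξ hξ x hx)
  · intro ξ hξ x hx
    refine (congrArg (fun v : E3 × E3 => ‖v.2‖) (hmap' ξ hξ x hx)).trans ?_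
    exact ho.norm_dir hP h.incoming hξ (hxp.mem ξ hξ x hx)
  · intro ξ hξ x hx m i hi him
    exact htr.bound ξ hξ _ (hxp.mem ξ hξ x hx) (t x) (htm x hx) m i hi him
  · rintro ξ hξ x ⟨hx, hxΘ⟩
    have hz := mem_region_of_mem_openCylinder hP hr hx hxΘ
    have hdom := h.region_subset_dom hP ho hξ hz
    refine ⟨hdom, ?_⟩
    obtain ⟨h1, h2, h3⟩ := ho.push_mem hP h.incoming hr hξ hx hxΘ
    -- Outside the obstacle, the push along the ray of `x` itself solves the same fixed point
    -- equation, whose solution is unique by contraction. So the prolongation agrees with the phase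
    -- there.
    have hxe : xp ξ x = x + s • q ξ x := by
      have e1 := hxp.eq ξ hξ x hx
      have e2 : x + s • q ξ x = x + s • q ξ (x + s • q ξ x) := by
        simp only [hq] at h3 ⊢
        rw [h3]
      have e3 := hlip ξ hξ _ (hxp.mem ξ hξ x hx) _ h1
      have e4 : ‖xp ξ x - (x + s • q ξ x)‖ ≤ 1 / 2 * ‖xp ξ x - (x + s • q ξ x)‖ := by
        calc ‖xp ξ x - (x + s • q ξ x)‖ = ‖s • (q ξ (xp ξ x) - q ξ (x + s • q ξ x))‖ := by
              nth_rewrite 1 [e1, e2]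
              rw [smul_sub, add_sub_add_left_eq_sub]
          _ ≤ s * (6 * (3 * P.Lp + 4 * P.Ln) * ‖xp ξ x - (x + s • q ξ x)‖) := by
              rw [norm_smul, Real.norm_of_nonneg hs.le]
              exact mul_le_mul_of_nonneg_left e3 hs.le
          _ ≤ _ := by
              rw [← mul_assoc]
              exact mul_le_mul_of_nonneg_right hr.contract (norm_nonneg _)
      have e5 : ‖xp ξ x - (x + s • q ξ x)‖ = 0 := by
        linarith [norm_nonneg (xp ξ x - (x + s • q ξ x))]
      exact sub_eq_zero.1 (norm_eq_zero.1 e5)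
    have hval := ho.value_eq hP h.incoming hξ hz (t := τ ξ x + s)
      (by linarith [ho.nonneg ξ hξ x hz])
    rw [add_smul, ho.smul_dir hξ hz, ← add_assoc, add_sub_cancel] at hval
    have hval0 := ho.value_eq hP h.incoming hξ hz (ho.nonneg ξ hξ x hz)
    rw [← ho.eq ξ hξ x hz] at hval0
    rw [storyPhase_append] at hdom ⊢
    rw [(h.value ξ hξ).reflectPhase_eq hP.δ_pos hch.isCompact x hdom, hval0]
    change V ξ (xp ξ x) - s = _
    rw [hxe]
    change valueThrough (Θ k) (storyValue Θ y ξ J) (x + s • q ξ x) - s = _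
    rw [hval]
    ring

end Chart

/-! ### Exponential bounds for families of functions -/

/-- Nondegeneracy from a merely Lipschitz right inverse. If `u ≠ 0` were orthogonal to the range of
`S`, then moving `x` along `u` would give `t ‖u‖² = ⟪u, F(w(x + t u)) - F(w x)⟫ = o(t)`. -/
theorem LinearMap.surjective_of_fderiv_of_rightInverse {E : Type*} [NormedAddCommGroup E]
    [InnerProductSpace ℝ E] [FiniteDimensional ℝ E] {F w : E → E} {S : E →L[ℝ] E} {x : E} {K : ℝ}
    (hF : HasFDerivAt F S (w x)) (hw : ∀ᶠ x' in nhds x, ‖w x' - w x‖ ≤ K * ‖x' - x‖)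
    (hFw : ∀ᶠ x' in nhds x, F (w x') = x') : Function.Surjective S := by
  by_contra hns
  have hlt : LinearMap.range (S : E →ₗ[ℝ] E) ≠ ⊤ := fun h => hns (LinearMap.range_eq_top.1 h)
  obtain ⟨u, hu, hu0⟩ := Submodule.exists_mem_ne_zero_of_ne_bot
    (mt Submodule.orthogonal_eq_bot_iff.1 hlt)
  have hortho : ∀ v, inner ℝ u (S v) = 0 := fun v => by
    rw [real_inner_comm]
    exact (Submodule.mem_orthogonal _ _).1 hu _ ⟨v, rfl⟩
  have hcurve : Filter.Tendsto (fun t : ℝ => x + t • u) (nhds 0) (nhds x) := by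
    have : Continuous fun t : ℝ => x + t • u := by fun_prop
    simpa using this.tendsto 0
  have hO : (fun x' => w x' - w x) =O[nhds x] fun x' => x' - x := by
    refine Asymptotics.IsBigO.of_bound K ?_
    exact hw
  have hwc : Filter.Tendsto w (nhds x) (nhds (w x)) := by
    rw [tendsto_iff_norm_sub_tendsto_zero]
    have h0 : Filter.Tendsto (fun x' => K * ‖x' - x‖) (nhds x) (nhds 0) := by
      have : Continuous fun x' : E => K * ‖x' - x‖ := by fun_prop
      simpa using this.tendsto x
    exact squeeze_zero' (Filter.Eventually.of_forall fun _ => norm_nonneg _) hw h0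
  have h1 : (fun x' => F (w x') - F (w x) - S (w x' - w x)) =o[nhds x] fun x' => x' - x :=
    ((hasFDerivAt_iff_isLittleO.1 hF).comp_tendsto hwc).trans_isBigO hO
  have h2 := h1.comp_tendsto hcurve
  have h3 : (fun t : ℝ => t * ‖u‖ ^ 2) =o[nhds 0] fun t : ℝ => t := by
    have h4 : (fun t : ℝ => t * ‖u‖ ^ 2) =O[nhds 0]
        ((fun x' => F (w x') - F (w x) - S (w x' - w x)) ∘ fun t : ℝ => x + t • u) := by
      refine Asymptotics.IsBigO.of_bound ‖u‖ ?_
      filter_upwards [hcurve.eventually hFw] with t ht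
      have hx := hFw.self_of_nhds
      have e : t * ‖u‖ ^ 2 = inner ℝ u (F (w (x + t • u)) - F (w x) -
          S (w (x + t • u) - w x)) := by
        rw [ht, hx, inner_sub_right, hortho, add_sub_cancel_left, inner_smul_right,
          real_inner_self_eq_norm_sq, sub_zero]
      rw [e]
      exact norm_inner_le_norm _ _
    refine (h4.trans_isLittleO h2).trans_isBigO ?_
    refine Asymptotics.IsBigO.of_bound ‖u‖ (Filter.Eventually.of_forall fun t => ?_)
    simp [norm_smul, mul_comm]
  have h5 : HasDerivAt (fun t : ℝ => t * ‖u‖ ^ 2) 0 0 := by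
    rw [hasDerivAt_iff_isLittleO]
    simpa using h3
  have h6 : HasDerivAt (fun t : ℝ => t * ‖u‖ ^ 2) (‖u‖ ^ 2) 0 := by
    exact ((hasDerivAt_id (0 : ℝ)).mul_const (‖u‖ ^ 2)).congr_deriv (by simp)
  have h7 := h6.unique h5
  exact hu0 (norm_eq_zero.1 (pow_eq_zero_iff two_ne_zero |>.1 h7))

/-- The families of smooth functions `u i` on the sets `O i` whose derivatives up to the order `m`
grow at most exponentially in `N i`. -/
def ExpBounded {ι E F : Type*} [NormedAddCommGroup E] [NormedSpace ℝ E] [NormedAddCommGroup F]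
    [NormedSpace ℝ F] (N : ι → ℕ) (O : ι → Set E) (m : ℕ) (u : ι → E → F) : Prop :=
  (∀ i, ContDiffOn ℝ ∞ (u i) (O i)) ∧ ∃ D : ℝ, 1 ≤ D ∧ ∀ i, ∀ x ∈ O i, ∀ k ≤ m,
    ‖iteratedFDerivWithin ℝ k (u i) (O i) x‖ ≤ D ^ N i

namespace ExpBounded

variable {ι E F G H : Type*} [NormedAddCommGroup E] [NormedSpace ℝ E] [NormedAddCommGroup F]
  [NormedSpace ℝ F] [NormedAddCommGroup G] [NormedSpace ℝ G] [NormedAddCommGroup H]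
  [NormedSpace ℝ H] {N : ι → ℕ} {O : ι → Set E} {m : ℕ} {u u' : ι → E → F} {v : ι → E → G}

/-- Because `N i ≥ 1`, a fixed factor `c` is absorbed by enlarging the base. This is why exponential
bounds are stable under the operations below. -/
theorem of_bound (hN : ∀ i, 1 ≤ N i) (hu : ∀ i, ContDiffOn ℝ ∞ (u i) (O i)) {c D : ℝ}
    (hD : 1 ≤ D) (h : ∀ i, ∀ x ∈ O i, ∀ k ≤ m,
      ‖iteratedFDerivWithin ℝ k (u i) (O i) x‖ ≤ c * D ^ N i) : ExpBounded N O m u := by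
  refine ⟨hu, max c 1 * D, one_le_mul_of_one_le_of_one_le (le_max_right _ _) hD,
    fun i x hx k hk => (h i x hx k hk).trans ?_⟩
  rw [mul_pow]
  refine mul_le_mul_of_nonneg_right ?_ (by positivity)
  exact (le_max_left c 1).trans (le_self_pow₀ (le_max_right _ _) (by have := hN i; omega))

theorem mono {m' : ℕ} (h : ExpBounded N O m u) (hm : m' ≤ m) : ExpBounded N O m' u := by
  obtain ⟨hu, D, hD, hb⟩ := h
  exact ⟨hu, D, hD, fun i x hx k hk => hb i x hx k (hk.trans hm)⟩

theorem congr (h : ExpBounded N O m u) (he : ∀ i, Set.EqOn (u' i) (u i) (O i)) :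
    ExpBounded N O m u' := by
  obtain ⟨hu, D, hD, hb⟩ := h
  refine ⟨fun i => (hu i).congr (he i), D, hD, fun i x hx k hk => ?_⟩
  rw [iteratedFDerivWithin_congr (he i) hx]
  exact hb i x hx k hk

theorem clm (hN : ∀ i, 1 ≤ N i) (hO : ∀ i, IsOpen (O i)) (L : F →L[ℝ] G)
    (h : ExpBounded N O m u) : ExpBounded N O m fun i x => L (u i x) := by
  obtain ⟨hu, D, hD, hb⟩ := h
  refine of_bound hN (fun i => L.contDiff.comp_contDiffOn (hu i)) (c := ‖L‖) hD
    fun i x hx k hk => ?_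
  refine (L.norm_iteratedFDerivWithin_comp_left ((hu i) x hx) (hO i).uniqueDiffOn hx
    (by exact_mod_cast le_top)).trans ?_
  exact mul_le_mul_of_nonneg_left (hb i x hx k hk) (norm_nonneg L)

theorem bilinear (hN : ∀ i, 1 ≤ N i) (hO : ∀ i, IsOpen (O i)) (B : F →L[ℝ] G →L[ℝ] H)
    (h : ExpBounded N O m u) (h' : ExpBounded N O m v) :
    ExpBounded N O m fun i x => B (u i x) (v i x) := by
  obtain ⟨hu, D, hD, hb⟩ := h
  obtain ⟨hv, D', hD', hb'⟩ := h'
  refine of_bound hN (fun i => B.isBoundedBilinearMap.contDiff.comp_contDiffOn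
    ((hu i).prodMk (hv i))) (c := ‖B‖ * 2 ^ m)
    (one_le_mul_of_one_le_of_one_le hD hD') fun i x hx k hk => ?_
  refine (B.norm_iteratedFDerivWithin_le_of_bilinear (hu i) (hv i) (hO i).uniqueDiffOn hx
    (n := k) (by exact_mod_cast le_top)).trans ?_
  rw [mul_assoc]
  refine mul_le_mul_of_nonneg_left ?_ (norm_nonneg B)
  calc _ ≤ ∑ l ∈ Finset.range (k + 1), (k.choose l : ℝ) * (D * D') ^ N i := by
        refine Finset.sum_le_sum fun l hl => ?_
        have hlk : l ≤ k := Nat.lt_succ_iff.1 (Finset.mem_range.1 hl)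
        rw [mul_pow, mul_assoc]
        refine mul_le_mul_of_nonneg_left ?_ (Nat.cast_nonneg _)
        exact mul_le_mul (hb i x hx l (hlk.trans hk)) (hb' i x hx _ ((Nat.sub_le k l).trans hk))
          (norm_nonneg _) (by positivity)
    _ = 2 ^ k * (D * D') ^ N i := by
        rw [← Finset.sum_mul]
        congr 1
        exact_mod_cast Nat.sum_range_choose k
    _ ≤ _ := by
        refine mul_le_mul_of_nonneg_right (pow_le_pow_right₀ (by norm_num) hk) (by positivity)

theorem add (hN : ∀ i, 1 ≤ N i) (hO : ∀ i, IsOpen (O i)) (h : ExpBounded N O m u)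
    (h' : ExpBounded N O m u') : ExpBounded N O m fun i x => u i x + u' i x := by
  obtain ⟨hu, D, hD, hb⟩ := h
  obtain ⟨hv, D', hD', hb'⟩ := h'
  refine of_bound hN (fun i => (hu i).add (hv i)) (c := 2)
    (one_le_mul_of_one_le_of_one_le hD hD') fun i x hx k hk => ?_
  have e : iteratedFDerivWithin ℝ k (fun x => u i x + u' i x) (O i) x =
      iteratedFDerivWithin ℝ k (u i) (O i) x + iteratedFDerivWithin ℝ k (u' i) (O i) x :=
    iteratedFDerivWithin_add_apply (((hu i) x hx).of_le (by exact_mod_cast le_top))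
      (((hv i) x hx).of_le (by exact_mod_cast le_top)) (hO i).uniqueDiffOn hx
  rw [e]
  refine (norm_add_le _ _).trans ?_
  have h1 := hb i x hx k hk
  have h2 := hb' i x hx k hk
  have h3 : (1 : ℝ) ≤ D ^ N i := one_le_pow₀ hD
  have h4 : (1 : ℝ) ≤ D' ^ N i := one_le_pow₀ hD'
  rw [mul_pow]
  nlinarith

theorem const (hN : ∀ i, 1 ≤ N i) (c : F) : ExpBounded N O m fun _ _ => c := by
  refine of_bound hN (fun i => contDiffOn_const) (c := ‖c‖) le_rfl fun i x hx k hk => ?_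
  rw [one_pow, mul_one]
  rcases Nat.eq_zero_or_pos k with rfl | hk'
  · rw [norm_iteratedFDerivWithin_zero]
  · rw [iteratedFDerivWithin_const_of_ne hk'.ne']; simp

theorem of_isCompact (hN : ∀ i, 1 ≤ N i) (hO : ∀ i, IsOpen (O i)) {f : E → F} {W Q : Set E}
    (hW : IsOpen W) (hQ : IsCompact Q) (hQW : Q ⊆ W) (hOQ : ∀ i, O i ⊆ Q)
    (hf : ContDiffOn ℝ ∞ f W) : ExpBounded N O m fun _ => f := by
  have h : ∀ k : ℕ, ∃ c : ℝ, ∀ x ∈ Q, ‖iteratedFDerivWithin ℝ k f W x‖ ≤ c := fun k =>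
    hQ.exists_bound_of_continuousOn
      ((hf.continuousOn_iteratedFDerivWithin (by exact_mod_cast le_top) hW.uniqueDiffOn).mono hQW)
  choose c hc using h
  refine of_bound hN (fun i => hf.mono ((hOQ i).trans hQW)) (D := 1)
    (c := ∑ k ∈ Finset.range (m + 1), |c k|) le_rfl fun i x hx k hk => ?_
  rw [one_pow, mul_one, iteratedFDerivWithin_of_isOpen k (hO i) hx,
    ← iteratedFDerivWithin_of_isOpen k hW (hQW (hOQ i hx))]
  refine ((hc k x (hOQ i hx)).trans (le_abs_self _)).trans ?_
  exact Finset.single_le_sum (f := fun k => |c k|) (fun _ _ => abs_nonneg _)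
    (Finset.mem_range.2 (by omega))

theorem zero_iff : ExpBounded N O 0 u ↔ (∀ i, ContDiffOn ℝ ∞ (u i) (O i)) ∧
    ∃ D : ℝ, 1 ≤ D ∧ ∀ i, ∀ x ∈ O i, ‖u i x‖ ≤ D ^ N i := by
  refine and_congr_right fun _ => exists_congr fun D => and_congr_right fun _ =>
    forall_congr' fun i => forall₂_congr fun x hx => ?_
  simp

theorem fderiv (hO : ∀ i, IsOpen (O i)) (h : ExpBounded N O (m + 1) u) :
    ExpBounded N O m fun i => fderiv ℝ (u i) := by
  obtain ⟨hu, D, hD, hb⟩ := h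
  refine ⟨fun i => (hu i).fderiv_of_isOpen (hO i) (by simp), D, hD, fun i x hx k hk => ?_⟩
  have e : Set.EqOn (_root_.fderiv ℝ (u i)) (fderivWithin ℝ (u i) (O i)) (O i) := fun y hy =>
    (fderivWithin_of_isOpen (hO i) hy).symm
  rw [iteratedFDerivWithin_congr e hx, norm_iteratedFDerivWithin_fderivWithin
    (hO i).uniqueDiffOn hx]
  exact hb i x hx _ (by omega)

theorem succ (hO : ∀ i, IsOpen (O i)) (h0 : ExpBounded N O 0 u)
    (h : ExpBounded N O m fun i => _root_.fderiv ℝ (u i)) : ExpBounded N O (m + 1) u := by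
  obtain ⟨hu, D, hD, hb⟩ := h0
  obtain ⟨-, D', hD', hb'⟩ := h
  refine ⟨hu, D * D', one_le_mul_of_one_le_of_one_le hD hD', fun i x hx k hk => ?_⟩
  have h3 : (1 : ℝ) ≤ D ^ N i := one_le_pow₀ hD
  have h4 : (1 : ℝ) ≤ D' ^ N i := one_le_pow₀ hD'
  rw [mul_pow]
  rcases k with _ | k
  · exact (hb i x hx 0 le_rfl).trans (le_mul_of_one_le_right (by linarith) h4)
  · have e : Set.EqOn (_root_.fderiv ℝ (u i)) (fderivWithin ℝ (u i) (O i)) (O i) := fun y hy =>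
      (fderivWithin_of_isOpen (hO i) hy).symm
    have := hb' i x hx k (by omega)
    rw [iteratedFDerivWithin_congr e hx, norm_iteratedFDerivWithin_fderivWithin
      (hO i).uniqueDiffOn hx] at this
    exact this.trans (le_mul_of_one_le_left (by linarith) h3)

/-- Only derivatives of `g` of order at least one enter, and for order `m` only `fderiv ℝ g` up to
order `m - 1`. This gain of one order drives the later induction. -/
theorem comp (hN : ∀ i, 1 ≤ N i) (hO : ∀ i, IsOpen (O i)) {g : ι → E → F} {f : ι → F → G}
    (hf : ∀ i, ContDiff ℝ ∞ (f i)) {D : ℝ} (hD : 1 ≤ D)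
    (hfb : ∀ i, ∀ x ∈ O i, ∀ k ≤ m, ‖iteratedFDeriv ℝ k (f i) (g i x)‖ ≤ D ^ N i)
    (hg : ∀ i, ContDiffOn ℝ ∞ (g i) (O i))
    (hg' : ∀ m', m = m' + 1 → ExpBounded N O m' fun i => _root_.fderiv ℝ (g i)) :
    ExpBounded N O m fun i x => f i (g i x) := by
  have hgb : ∃ D' : ℝ, 1 ≤ D' ∧ ∀ i, ∀ x ∈ O i, ∀ k, 1 ≤ k → k ≤ m →
      ‖iteratedFDerivWithin ℝ k (g i) (O i) x‖ ≤ D' ^ N i := by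
    rcases m with _ | m
    · exact ⟨1, le_rfl, fun i x hx k h1 h2 => by omega⟩
    · obtain ⟨-, D', hD', hb'⟩ := hg' m rfl
      refine ⟨D', hD', fun i x hx k h1 h2 => ?_⟩
      obtain ⟨k, rfl⟩ := Nat.exists_eq_add_of_le' h1
      have e : Set.EqOn (_root_.fderiv ℝ (g i)) (fderivWithin ℝ (g i) (O i)) (O i) := fun y hy =>
        (fderivWithin_of_isOpen (hO i) hy).symm
      have := hb' i x hx k (by omega)
      rwa [iteratedFDerivWithin_congr e hx, norm_iteratedFDerivWithin_fderivWithin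
        (hO i).uniqueDiffOn hx] at this
  obtain ⟨D', hD', hb'⟩ := hgb
  refine of_bound hN (fun i => (hf i).comp_contDiffOn (hg i)) (c := m.factorial)
    (one_le_mul_of_one_le_of_one_le hD (one_le_pow₀ hD' : 1 ≤ D' ^ m)) fun i x hx k hk => ?_
  have h4 : (1 : ℝ) ≤ D' ^ N i := one_le_pow₀ hD'
  refine (norm_iteratedFDerivWithin_comp_le (hf i).contDiffOn (hg i) (n := k)
    (by exact_mod_cast le_top) uniqueDiffOn_univ (hO i).uniqueDiffOn (Set.mapsTo_univ _ _) hx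
    (C := D ^ N i) (D := D' ^ N i) (fun l hl => ?_) fun l h1 h2 => ?_).trans ?_
  · rw [iteratedFDerivWithin_univ]
    exact hfb i x hx l (hl.trans hk)
  · exact (hb' i x hx l h1 (h2.trans hk)).trans (le_self_pow₀ h4 (by omega))
  · rw [mul_pow, ← pow_mul, ← pow_mul, mul_comm (N i), mul_assoc]
    refine mul_le_mul (by exact_mod_cast Nat.factorial_le hk) ?_ (by positivity) (by positivity)
    refine mul_le_mul_of_nonneg_left ?_ (by positivity)
    exact pow_le_pow_right₀ hD' (Nat.mul_le_mul_right _ hk)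

end ExpBounded

theorem ContinuousLinearMap.isInvertible_of_surjective {E : Type*} [NormedAddCommGroup E]
    [NormedSpace ℝ E] [FiniteDimensional ℝ E] {S : E →L[ℝ] E} (h : Function.Surjective S) :
    S.IsInvertible := by
  have hi : Function.Injective S :=
    (LinearMap.injective_iff_surjective (f := (S : E →ₗ[ℝ] E))).2 h
  refine ⟨(LinearEquiv.ofBijective (S : E →ₗ[ℝ] E) ⟨hi, h⟩).toContinuousLinearEquiv, ?_⟩
  ext x
  rfl

theorem contDiffOn_unitDir {E : Type*} [NormedAddCommGroup E] [InnerProductSpace ℝ E] :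
    ContDiffOn ℝ ∞ (fun z : E × E => ‖z.2‖⁻¹ • z.2) {z | z.2 ≠ 0} := by
  intro z hz
  refine ContDiffAt.contDiffWithinAt ?_
  exact ((contDiffAt_snd.norm ℝ hz).inv (norm_ne_zero_iff.2 hz)).smul contDiffAt_snd

/-! ### Smoothness of the initial state and of the phase -/

namespace RayChart

variable {U C : Set E3} {Φ : E3 → E3 → ℝ} {w : E3 × E3 → E3} {Ψ : E3 × E3 → E3 × E3}
  {L : E3 × E3 → ℝ} {K : ℝ} {A : ℕ → ℝ}

/-- The derivative of the first component of `Ψ` in its first variable. -/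
noncomputable def fstDeriv (Ψ : E3 × E3 → E3 × E3) (v : E3 × E3) : E3 →L[ℝ] E3 :=
  (ContinuousLinearMap.fst ℝ E3 E3) ∘L ((fderiv ℝ Ψ v) ∘L (ContinuousLinearMap.inl ℝ E3 E3))

theorem hasFDerivAt_fst (hΨ : ContDiff ℝ ∞ Ψ) (v : E3 × E3) :
    HasFDerivAt (fun x => (Ψ (x, v.2)).1) (fstDeriv Ψ v) v.1 := by
  have h1 : HasFDerivAt Ψ (fderiv ℝ Ψ v) v :=
    (hΨ.differentiable (by simp)).differentiableAt.hasFDerivAt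
  have h2 : HasFDerivAt (fun x : E3 => (x, v.2)) (ContinuousLinearMap.inl ℝ E3 E3) v.1 :=
    hasFDerivAt_prodMk_left v.1 v.2
  exact (ContinuousLinearMap.fst ℝ E3 E3).hasFDerivAt.comp v.1 (h1.comp v.1 h2)

theorem surjective_fstDeriv (h : RayChart U C Φ w Ψ L K A) (hU : IsOpen U) {z : E3 × E3}
    (hz : z ∈ U ×ˢ C) : Function.Surjective (fstDeriv Ψ (w z, ‖z.2‖⁻¹ • z.2)) := by
  have hxU := hU.mem_nhds hz.1
  refine LinearMap.surjective_of_fderiv_of_rightInverse (w := fun x => w (x, z.2)) (x := z.1)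
    (K := K) (hasFDerivAt_fst h.smooth_map (w z, ‖z.2‖⁻¹ • z.2)) ?_ ?_
  · filter_upwards [hxU] with x hx using h.lip _ hz.2 x hx _ hz.1
  · filter_upwards [hxU] with x hx using h.fst_eq _ hz.2 x hx

/-- The state `w` is continuous and solves `Ψ₁(w, ξ/|ξ|) = x`, whose derivative in `w` is surjective
between spaces of equal finite dimension, hence invertible. -/
theorem contDiffOn_foot (h : RayChart U C Φ w Ψ L K A) (hU : IsOpen U) (hC : IsOpen C)
    (hC0 : ∀ ξ ∈ C, ξ ≠ 0) : ContDiffOn ℝ ∞ w (U ×ˢ C) := by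
  intro z hz
  have hO : IsOpen (U ×ˢ C) := hU.prod hC
  refine ContDiffAt.contDiffWithinAt ?_
  have hd : ContDiffAt ℝ ∞ (fun z : E3 × E3 => ‖z.2‖⁻¹ • z.2) z :=
    contDiffOn_unitDir.contDiffAt ((isOpen_ne.preimage continuous_snd).mem_nhds (hC0 _ hz.2))
  set f : (E3 × E3) × E3 → E3 := fun v => (Ψ (v.2, ‖v.1.2‖⁻¹ • v.1.2)).1 - v.1.1 with hf
  have hfd : ContDiffAt ℝ ∞ f (z, w z) := by
    refine ContDiffAt.sub ?_ (contDiffAt_fst.fst)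
    refine ContDiffAt.fst (h.smooth_map.contDiffAt.comp _ ?_)
    have hd' : ContDiffAt ℝ ∞ (fun v : (E3 × E3) × E3 => ‖v.1.2‖⁻¹ • v.1.2) (z, w z) :=
      ContDiffAt.comp (g := fun z : E3 × E3 => ‖z.2‖⁻¹ • z.2) (z, w z) hd contDiffAt_fst
    exact contDiffAt_snd.prodMk hd'
  refine contDiffAt_of_implicit hfd ?_ ((h.cont z hz).continuousAt (hO.mem_nhds hz)) ?_
  · have h1 : HasFDerivAt (fun x => f (z, x)) (fstDeriv Ψ (w z, ‖z.2‖⁻¹ • z.2)) (w z) :=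
      (hasFDerivAt_fst h.smooth_map (w z, ‖z.2‖⁻¹ • z.2)).sub_const z.1
    have h2 : HasFDerivAt (fun x => f (z, x)) (fderiv ℝ f (z, w z) ∘L .inr ℝ (E3 × E3) E3) (w z) :=
      (hfd.differentiableAt (by simp)).hasFDerivAt.comp (w z) (hasFDerivAt_prodMk_right z (w z))
    rw [← h1.unique h2]
    exact ContinuousLinearMap.isInvertible_of_surjective (h.surjective_fstDeriv hU hz)
  · filter_upwards [hO.mem_nhds hz] with z' hz'
    rw [hf]
    simp only
    rw [h.fst_eq _ hz'.2 _ hz'.1, h.fst_eq _ hz.2 _ hz.1, sub_self, sub_self]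

theorem contDiffOn_unit {U C : Set E3} (hC0 : ∀ ξ ∈ C, ξ ≠ 0) :
    ContDiffOn ℝ ∞ (fun z : E3 × E3 => ‖z.2‖⁻¹ • z.2) (U ×ˢ C) :=
  contDiffOn_unitDir.mono fun _ hz => hC0 _ hz.2

theorem contDiffOn_phase (h : RayChart U C Φ w Ψ L K A) (hU : IsOpen U) (hC : IsOpen C)
    (hC0 : ∀ ξ ∈ C, ξ ≠ 0) : ContDiffOn ℝ ∞ (fun z : E3 × E3 => Φ z.1 z.2) (U ×ˢ C) := by
  refine (h.smooth_length.comp_contDiffOn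
    ((h.contDiffOn_foot hU hC hC0).prodMk (contDiffOn_unit hC0))).congr fun _ hz => ?_
  exact (h.length_eq _ hz.2 _ hz.1).symm

end RayChart

/-- The product rule applied to `S V = 1`, multiplied by `V` on the left. -/
theorem fderiv_of_comp_eq_id {E X : Type*} [NormedAddCommGroup E] [NormedSpace ℝ E]
    [NormedAddCommGroup X] [NormedSpace ℝ X] {S V : E → X →L[ℝ] X} {z : E}
    (hS : DifferentiableAt ℝ S z) (hV : DifferentiableAt ℝ V z)
    (h : ∀ᶠ z' in nhds z, S z' ∘L V z' = .id ℝ X) (h' : V z ∘L S z = .id ℝ X) :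
    fderiv ℝ V z = -(ContinuousLinearMap.compL ℝ X X X (V z) ∘L
      ((ContinuousLinearMap.compL ℝ X X X).flip (V z) ∘L fderiv ℝ S z)) := by
  have h1 := hS.hasFDerivAt.clm_comp hV.hasFDerivAt
  have h2 : HasFDerivAt (fun z' => S z' ∘L V z') (0 : E →L[ℝ] X →L[ℝ] X) z :=
    (hasFDerivAt_const (ContinuousLinearMap.id ℝ X) z).congr_of_eventuallyEq h
  have h3 := h1.unique h2
  ext v x
  have h4 := congrArg (fun T : E →L[ℝ] X →L[ℝ] X => V z (T v x)) h3
  have h5 : ∀ y, V z (S z y) = y := fun y => congrArg (fun T : X →L[ℝ] X => T y) h'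
  simp [h5] at h4
  simpa using eq_neg_of_add_eq_zero_left h4

namespace ExpBounded

variable {ι E F G H : Type*} [NormedAddCommGroup E] [NormedSpace ℝ E] [NormedAddCommGroup F]
  [NormedSpace ℝ F] [NormedAddCommGroup G] [NormedSpace ℝ G] [NormedAddCommGroup H]
  [NormedSpace ℝ H] {N : ι → ℕ} {O : ι → Set E} {m : ℕ}

theorem clm_comp (hN : ∀ i, 1 ≤ N i) (hO : ∀ i, IsOpen (O i)) {u : ι → E → G →L[ℝ] H}
    {v : ι → E → F →L[ℝ] G} (h : ExpBounded N O m u) (h' : ExpBounded N O m v) :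
    ExpBounded N O m fun i x => u i x ∘L v i x :=
  h.bilinear hN hO (ContinuousLinearMap.compL ℝ F G H) h'

theorem neg (hN : ∀ i, 1 ≤ N i) (hO : ∀ i, IsOpen (O i)) {u : ι → E → F}
    (h : ExpBounded N O m u) : ExpBounded N O m fun i x => -u i x :=
  h.clm hN hO (-ContinuousLinearMap.id ℝ F)

/-- By `V' = -V S' V`, a bound on `V` at order `l` gives one at order `l + 1`. Only the bound at
order zero has to be supplied from outside. -/
theorem inverse (hN : ∀ i, 1 ≤ N i) (hO : ∀ i, IsOpen (O i)) {S V : ι → E → F →L[ℝ] F}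
    (hS : ExpBounded N O m S) (hV : ExpBounded N O 0 V)
    (h : ∀ i, ∀ z ∈ O i, S i z ∘L V i z = .id ℝ F) (h' : ∀ i, ∀ z ∈ O i, V i z ∘L S i z = .id ℝ F) :
    ExpBounded N O m V := by
  have key : ∀ l ≤ m, ExpBounded N O l V := by
    intro l
    induction l with
    | zero => exact fun _ => hV
    | succ l ih =>
      intro hl
      have hVl := ih (by omega)
      have hS' := (hS.mono hl).fderiv hO
      refine hV.succ hO (((((hVl.clm hN hO (ContinuousLinearMap.compL ℝ F F F)).clm_comp hN hO
        ((hVl.clm hN hO (ContinuousLinearMap.compL ℝ F F F).flip).clm_comp hN hO hS')).neg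
          hN hO)).congr fun i z hz => ?_)
      refine fderiv_of_comp_eq_id ?_ ?_ ?_ (h' i z hz)
      · exact ((hS.1 i).contDiffAt ((hO i).mem_nhds hz)).differentiableAt (by simp)
      · exact ((hV.1 i).contDiffAt ((hO i).mem_nhds hz)).differentiableAt (by simp)
      · filter_upwards [(hO i).mem_nhds hz] with z' hz' using h i z' hz'
  exact key m le_rfl

end ExpBounded

namespace RayChart

theorem norm_fderiv_foot_le {U C : Set E3} {Φ : E3 → E3 → ℝ} {w : E3 × E3 → E3}
    {Ψ : E3 × E3 → E3 × E3} {L : E3 × E3 → ℝ} {K : ℝ} {A : ℕ → ℝ}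
    (h : RayChart U C Φ w Ψ L K A) (hU : IsOpen U) (hK : 0 ≤ K) {z : E3 × E3}
    (hz : z ∈ U ×ˢ C) (hw : DifferentiableAt ℝ w z) :
    ‖fderiv ℝ w z ∘L .inl ℝ E3 E3‖ ≤ K := by
  have h1 : HasFDerivAt (fun x => w (x, z.2)) (fderiv ℝ w z ∘L .inl ℝ E3 E3) z.1 :=
    HasFDerivAt.comp (g := w) z.1 hw.hasFDerivAt (hasFDerivAt_prodMk_left z.1 z.2)
  refine h1.le_of_lip' hK ?_
  filter_upwards [hU.mem_nhds hz.1] with x hx using h.lip _ hz.2 x hx _ hz.1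

theorem fstDeriv_comp_add {U C : Set E3} {Φ : E3 → E3 → ℝ} {w : E3 × E3 → E3}
    {Ψ : E3 × E3 → E3 × E3} {L : E3 × E3 → ℝ} {K : ℝ} {A : ℕ → ℝ}
    (h : RayChart U C Φ w Ψ L K A) (hO : IsOpen (U ×ˢ C)) {z : E3 × E3}
    (hz : z ∈ U ×ˢ C) {W H : E3 × E3 →L[ℝ] E3} (hw : HasFDerivAt w W z)
    (hn : HasFDerivAt (fun z : E3 × E3 => ‖z.2‖⁻¹ • z.2) H z) :
    .fst ℝ E3 E3 ∘L (fderiv ℝ Ψ (w z, ‖z.2‖⁻¹ • z.2) ∘L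
      (.inl ℝ E3 E3 ∘L W + .inr ℝ E3 E3 ∘L H)) = .fst ℝ E3 E3 := by
  have e : ContinuousLinearMap.inl ℝ E3 E3 ∘L W + ContinuousLinearMap.inr ℝ E3 E3 ∘L H =
      W.prod H := by ext v <;> simp
  have h1 : HasFDerivAt Ψ (fderiv ℝ Ψ (w z, ‖z.2‖⁻¹ • z.2)) (w z, ‖z.2‖⁻¹ • z.2) :=
    (h.smooth_map.differentiable (by simp)).differentiableAt.hasFDerivAt
  have h2 : HasFDerivAt (fun z : E3 × E3 => Ψ (w z, ‖z.2‖⁻¹ • z.2))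
      (fderiv ℝ Ψ (w z, ‖z.2‖⁻¹ • z.2) ∘L W.prod H) z :=
    HasFDerivAt.comp (g := Ψ) z h1 (hw.prodMk hn)
  rw [e]
  have h3 : HasFDerivAt (fun z : E3 × E3 => (Ψ (w z, ‖z.2‖⁻¹ • z.2)).1)
      (.fst ℝ E3 E3 ∘L (fderiv ℝ Ψ (w z, ‖z.2‖⁻¹ • z.2) ∘L W.prod H)) z :=
    (ContinuousLinearMap.fst ℝ E3 E3).hasFDerivAt.comp z h2
  refine h3.unique ((ContinuousLinearMap.fst ℝ E3 E3).hasFDerivAt.congr_of_eventuallyEq ?_)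
  filter_upwards [hO.mem_nhds hz] with z' hz' using h.fst_eq _ hz'.2 _ hz'.1

section Family

variable {ι : Type*} {N : ι → ℕ} {U : Set E3} {C : ι → Set E3} {Φ : ι → E3 → E3 → ℝ}
  {w : ι → E3 × E3 → E3} {Ψ : ι → E3 × E3 → E3 × E3} {L : ι → E3 × E3 → ℝ} {A : ℕ → ℝ}

/-- Differentiating `Ψ₁(w, ν) = x` gives `S ∘ Dw + T ∘ Dν = fst`, where `S` and `T` are the partial
derivatives of `Ψ₁`. So `V = ∂w/∂x` is the inverse of `S`, and `Dw = V ∘ (fst - T ∘ Dν)`. The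
Lipschitz constant `48 ^ N` bounds `V`. Induction on the order then bounds `Dw` and finally `Ψ₂(w,
ν)`. -/
theorem expBounded_snd (hN : ∀ i, 1 ≤ N i) (hA : ∀ m, 1 ≤ A m)
    (h : ∀ i, RayChart U (C i) (Φ i) (w i) (Ψ i) (L i) (48 ^ N i) (fun m => A m ^ (N i + 1)))
    (hU : IsOpen U) (hC : ∀ i, IsOpen (C i)) {R b₀ b₁ : ℝ} (hb₀ : 0 < b₀)
    (hUR : U ⊆ Metric.closedBall 0 R) (hCb : ∀ i, ∀ ξ ∈ C i, b₀ ≤ ‖ξ‖ ∧ ‖ξ‖ ≤ b₁) (m : ℕ) :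
    ExpBounded N (fun i => U ×ˢ C i) m fun i z => (Ψ i (w i z, ‖z.2‖⁻¹ • z.2)).2 := by
  set O : ι → Set (E3 × E3) := fun i => U ×ˢ C i with hOd
  have hO : ∀ i, IsOpen (O i) := fun i => hU.prod (hC i)
  have hC0 : ∀ i, ∀ ξ ∈ C i, ξ ≠ 0 := fun i ξ hξ => norm_pos_iff.1 (hb₀.trans_le (hCb i ξ hξ).1)
  set ν : E3 × E3 → E3 := fun z => ‖z.2‖⁻¹ • z.2 with hν
  have hw : ∀ i, ContDiffOn ℝ ∞ (w i) (O i) := fun i => (h i).contDiffOn_foot hU (hC i) (hC0 i)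
  have hνs : ∀ i, ContDiffOn ℝ ∞ ν (O i) := fun i => contDiffOn_unit (hC0 i)
  have hg : ∀ i, ContDiffOn ℝ ∞ (fun z => (w i z, ν z)) (O i) := fun i => (hw i).prodMk (hνs i)
  have hwd : ∀ i, ∀ z ∈ O i, DifferentiableAt ℝ (w i) z := fun i z hz =>
    ((hw i).contDiffAt ((hO i).mem_nhds hz)).differentiableAt (by simp)
  have hνd : ∀ i, ∀ z ∈ O i, DifferentiableAt ℝ ν z := fun i z hz =>
    ((hνs i).contDiffAt ((hO i).mem_nhds hz)).differentiableAt (by simp)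
  have hH : ∀ m, ExpBounded N O m fun _ => fderiv ℝ ν := by
    intro m
    have hQ : IsCompact ((Metric.closedBall (0 : E3) R) ×ˢ
        ((Metric.closedBall (0 : E3) b₁) ∩ {ξ | b₀ ≤ ‖ξ‖})) :=
      (isCompact_closedBall _ _).prod
        ((isCompact_closedBall _ _).inter_right (isClosed_le continuous_const continuous_norm))
    refine (ExpBounded.of_isCompact (m := m + 1) hN hO
      (isOpen_ne.preimage continuous_snd) hQ ?_ ?_ contDiffOn_unitDir).fderiv hO
    · exact fun z hz => norm_pos_iff.1 (hb₀.trans_le hz.2.2)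
    · exact fun i z hz => ⟨hUR hz.1, by simpa using (hCb i _ hz.2).2, (hCb i _ hz.2).1⟩
  set G : ι → E3 × E3 → (E3 × E3 →L[ℝ] E3 × E3) := fun i z => fderiv ℝ (Ψ i) (w i z, ν z) with hG
  set V : ι → E3 × E3 → (E3 →L[ℝ] E3) := fun i z => fderiv ℝ (w i) z ∘L .inl ℝ E3 E3 with hV
  set S : ι → E3 × E3 → (E3 →L[ℝ] E3) := fun i z => fstDeriv (Ψ i) (w i z, ν z) with hS
  set T : ι → E3 × E3 → (E3 →L[ℝ] E3) := fun i z =>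
    .fst ℝ E3 E3 ∘L (G i z ∘L .inr ℝ E3 E3) with hT
  have hkey : ∀ i, ∀ z ∈ O i, S i z ∘L fderiv ℝ (w i) z + T i z ∘L fderiv ℝ ν z =
      .fst ℝ E3 E3 := by
    intro i z hz
    have := ((h i).fstDeriv_comp_add (hO i) hz (hwd i z hz).hasFDerivAt
      (hνd i z hz).hasFDerivAt)
    rw [ContinuousLinearMap.comp_add, ContinuousLinearMap.comp_add] at this
    exact this
  have hνl : ∀ i, ∀ z ∈ O i, fderiv ℝ ν z ∘L .inl ℝ E3 E3 = 0 := by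
    intro i z hz
    have h1 : HasFDerivAt (fun x => ν (x, z.2)) (fderiv ℝ ν z ∘L .inl ℝ E3 E3) z.1 :=
      HasFDerivAt.comp (g := ν) z.1 (hνd i z hz).hasFDerivAt (hasFDerivAt_prodMk_left z.1 z.2)
    exact h1.unique (hasFDerivAt_const (‖z.2‖⁻¹ • z.2) z.1)
  have hSV : ∀ i, ∀ z ∈ O i, S i z ∘L V i z = .id ℝ E3 := by
    intro i z hz
    have h1 := congrArg (fun B : E3 × E3 →L[ℝ] E3 => B ∘L .inl ℝ E3 E3) (hkey i z hz)
    simp only [ContinuousLinearMap.add_comp, ContinuousLinearMap.comp_assoc, hνl i z hz,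
      ContinuousLinearMap.comp_zero, add_zero] at h1
    rw [hV]
    simp only
    rw [h1]
    ext v; simp
  have hVS : ∀ i, ∀ z ∈ O i, V i z ∘L S i z = .id ℝ E3 := by
    intro i z hz
    have h1 : (S i z : E3 →ₗ[ℝ] E3) * (V i z : E3 →ₗ[ℝ] E3) = 1 := by
      ext v : 1
      exact congrArg (fun B : E3 →L[ℝ] E3 => B v) (hSV i z hz)
    have h2 := mul_eq_one_comm.1 h1
    ext v : 1
    exact congrArg (fun B : E3 →ₗ[ℝ] E3 => B v) h2
  have hW : ∀ i, ∀ z ∈ O i, fderiv ℝ (w i) z =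
      V i z ∘L (.fst ℝ E3 E3 + -(T i z ∘L fderiv ℝ ν z)) := by
    intro i z hz
    rw [← hkey i z hz, add_neg_cancel_right, ← ContinuousLinearMap.comp_assoc, hVS i z hz,
      ContinuousLinearMap.id_comp]
  have hV0 : ExpBounded N O 0 V := by
    refine ExpBounded.zero_iff.2 ⟨fun i => ?_, 48, by norm_num, fun i z hz => ?_⟩
    · exact ((hw i).fderiv_of_isOpen (hO i) (by simp)).clm_comp contDiffOn_const
    · exact (h i).norm_fderiv_foot_le hU (by positivity) hz (hwd i z hz)
  -- From `D(w, ν)` at order `m - 1` one obtains `DΨ` along `(w, ν)` at order `m`, hence `S`, `T`,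
  -- `V` and again `D(w, ν)` at order `m`. For `m = 0` nothing is assumed.
  have hstep : ∀ m, (∀ m', m = m' + 1 →
      ExpBounded N O m' fun i => fderiv ℝ fun z => (w i z, ν z)) →
      ExpBounded N O m G ∧ ExpBounded N O m (fun i => fderiv ℝ fun z => (w i z, ν z)) := by
    intro m hm
    have hGm : ExpBounded N O m G := by
      refine ExpBounded.comp hN hO (f := fun i => fderiv ℝ (Ψ i))
        (fun i => (h i).smooth_map.fderiv_right (by simp))
        -- The square comes from `N + 1 ≤ 2 N`, the outer exponent from the power `k + 1 ≤ m + 1` in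
        -- the bound on `Ψ`.
        (D := (A (m + 1) ^ 2) ^ (m + 1))
        (one_le_pow₀ (one_le_pow₀ (hA _))) (fun i z hz k hk => ?_) hg hm
      rw [norm_iteratedFDeriv_fderiv]
      refine ((h i).bound _ hz.2 _ hz.1 (m + 1) (k + 1) (by omega) (by omega)).trans ?_
      rw [← pow_mul, ← pow_mul, ← pow_mul]
      refine pow_le_pow_right₀ (hA _) ?_
      calc (N i + 1) * (k + 1) ≤ (2 * N i) * (m + 1) :=
            Nat.mul_le_mul (by have := hN i; omega) (by omega)
        _ = 2 * ((m + 1) * N i) := by ring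
    have hSm : ExpBounded N O m S :=
      (ExpBounded.const hN (ContinuousLinearMap.fst ℝ E3 E3)).clm_comp hN hO
        (hGm.clm_comp hN hO (ExpBounded.const hN (ContinuousLinearMap.inl ℝ E3 E3)))
    have hTm : ExpBounded N O m T :=
      (ExpBounded.const hN (ContinuousLinearMap.fst ℝ E3 E3)).clm_comp hN hO
        (hGm.clm_comp hN hO (ExpBounded.const hN (ContinuousLinearMap.inr ℝ E3 E3)))
    have hVm : ExpBounded N O m V := hSm.inverse hN hO hV0 hSV hVS
    have hWm : ExpBounded N O m fun i => fderiv ℝ (w i) :=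
      (hVm.clm_comp hN hO ((ExpBounded.const hN (ContinuousLinearMap.fst ℝ E3 E3)).add hN hO
        ((hTm.clm_comp hN hO (hH m)).neg hN hO))).congr hW
    refine ⟨hGm, ((((ExpBounded.const hN (ContinuousLinearMap.inl ℝ E3 E3)).clm_comp hN hO
      hWm).add hN hO ((ExpBounded.const hN (ContinuousLinearMap.inr ℝ E3 E3)).clm_comp hN hO
        (hH m)))).congr fun i z hz => ?_⟩
    rw [((hwd i z hz).hasFDerivAt.prodMk (hνd i z hz).hasFDerivAt).fderiv]
    ext v <;> simp
  have hall : ∀ m, ExpBounded N O m fun i => fderiv ℝ fun z => (w i z, ν z) := by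
    intro m
    induction m with
    | zero => exact (hstep 0 fun m' hm' => by omega).2
    | succ m ih =>
      refine (hstep (m + 1) fun m' hm' => ?_).2
      obtain rfl : m = m' := by omega
      exact ih
  have h0 : ExpBounded N O 0 fun i z => (Ψ i (w i z, ν z)).2 := by
    refine ExpBounded.zero_iff.2 ⟨fun i => ((h i).smooth_map.comp_contDiffOn (hg i)).snd, 1, le_rfl,
      fun i z hz => ?_⟩
    rw [one_pow]
    exact ((h i).norm_eq _ hz.2 _ hz.1).le
  rcases m with _ | m
  · exact h0
  · have hGm := (hstep m fun m' _ => hall m').1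
    refine h0.succ hO (((ExpBounded.const hN (ContinuousLinearMap.snd ℝ E3 E3)).clm_comp hN hO
      (hGm.clm_comp hN hO (hall m))).congr fun i z hz => ?_)
    have h1 : HasFDerivAt (Ψ i) (G i z) (w i z, ν z) :=
      ((h i).smooth_map.differentiable (by simp)).differentiableAt.hasFDerivAt
    have h2 : HasFDerivAt (fun z => (w i z, ν z)) (fderiv ℝ (fun z => (w i z, ν z)) z) z :=
      (((hg i).contDiffAt ((hO i).mem_nhds hz)).differentiableAt (by simp)).hasFDerivAt
    have h3 : HasFDerivAt (fun z => Ψ i (w i z, ν z))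
        (G i z ∘L fderiv ℝ (fun z => (w i z, ν z)) z) z :=
      HasFDerivAt.comp (g := Ψ i) z h1 h2
    exact ((ContinuousLinearMap.snd ℝ E3 E3).hasFDerivAt.comp z h3).fderiv

end Family

end RayChart

/-! ### Multi-index derivatives -/

section MultiDeriv

variable {ι κ : Type*} {N : ι → ℕ} {O : ι → Set (E3 × E3)} {dom : κ → Set E3} {ind : κ → ι}
  {sl : κ → E3 → E3 × E3} {J : E3 →L[ℝ] E3 × E3}

/-- The operator `T` acts on the slices of the families with exponential bounds. -/
def ActsOnSlices (N : ι → ℕ) (O : ι → Set (E3 × E3)) (dom : κ → Set E3) (ind : κ → ι)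
    (sl : κ → E3 → E3 × E3) (T : (E3 → E3) → E3 → E3) : Prop :=
  ∀ u : ι → E3 × E3 → E3, (∀ m, ExpBounded N O m u) → ∃ u' : ι → E3 × E3 → E3,
    (∀ m, ExpBounded N O m u') ∧ ∀ t f, Set.EqOn f (u (ind t) ∘ sl t) (dom t) →
      Set.EqOn (T f) (u' (ind t) ∘ sl t) (dom t)

theorem ActsOnSlices.comp {T T' : (E3 → E3) → E3 → E3} (h : ActsOnSlices N O dom ind sl T)
    (h' : ActsOnSlices N O dom ind sl T') : ActsOnSlices N O dom ind sl (T ∘ T') := by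
  intro u hu
  obtain ⟨u', hu', he'⟩ := h' u hu
  obtain ⟨u'', hu'', he''⟩ := h u' hu'
  exact ⟨u'', hu'', fun t f hf => he'' t _ (he' t f hf)⟩

theorem ActsOnSlices.iterate {T : (E3 → E3) → E3 → E3} (h : ActsOnSlices N O dom ind sl T)
    (r : ℕ) : ActsOnSlices N O dom ind sl T^[r] := by
  induction r with
  | zero => exact fun u hu => ⟨u, hu, fun _ _ hf => hf⟩
  | succ r ih => exact ih.comp h

/-- A partial derivative of a slice is the full derivative in a fixed direction. One order is lost,
harmlessly, since bounds of all orders are assumed. -/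
theorem actsOnSlices_partialDeriv (hN : ∀ i, 1 ≤ N i) (hO : ∀ i, IsOpen (O i))
    (hdom : ∀ t, IsOpen (dom t)) (hsl : ∀ t x, HasFDerivAt (sl t) J x)
    (hmem : ∀ t, ∀ x ∈ dom t, sl t x ∈ O (ind t)) (l : Fin 3) :
    ActsOnSlices N O dom ind sl (partialDeriv l) := by
  intro u hu
  set v : E3 × E3 := J (EuclideanSpace.single l 1) with hv
  refine ⟨fun i z => fderiv ℝ (u i) z v, fun m =>
    ((hu (m + 1)).fderiv hO).clm hN hO (ContinuousLinearMap.apply ℝ E3 v), fun t f hf x hx => ?_⟩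
  have h1 : HasFDerivAt (u (ind t)) (fderiv ℝ (u (ind t)) (sl t x)) (sl t x) :=
    ((((hu 0).1 (ind t)).contDiffAt ((hO _).mem_nhds (hmem t x hx))).differentiableAt
      (by simp)).hasFDerivAt
  have h2 : HasFDerivAt f (fderiv ℝ (u (ind t)) (sl t x) ∘L J) x :=
    (h1.comp x (hsl t x)).congr_of_eventuallyEq (hf.eventuallyEq_of_mem ((hdom t).mem_nhds hx))
  rw [partialDeriv, h2.fderiv]
  rfl

theorem actsOnSlices_multiDeriv (hN : ∀ i, 1 ≤ N i) (hO : ∀ i, IsOpen (O i))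
    (hdom : ∀ t, IsOpen (dom t)) (hsl : ∀ t x, HasFDerivAt (sl t) J x)
    (hmem : ∀ t, ∀ x ∈ dom t, sl t x ∈ O (ind t)) (α : Fin 3 → ℕ) :
    ActsOnSlices N O dom ind sl (multiDeriv α) := by
  have h := actsOnSlices_partialDeriv hN hO hdom hsl hmem
  exact ((h 0).iterate (α 0)).comp (((h 1).iterate (α 1)).comp ((h 2).iterate (α 2)))

end MultiDeriv

theorem exists_mixedDerivGrad_bound {ι : Type*} {N : ι → ℕ} {U : Set E3} {C : ι → Set E3}
    {Φ : ι → E3 → E3 → ℝ} {u : ι → E3 × E3 → E3} (hN : ∀ i, 1 ≤ N i) (hU : IsOpen U)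
    (hC : ∀ i, IsOpen (C i)) (hu : ∀ m, ExpBounded N (fun i => U ×ˢ C i) m u)
    (hgrad : ∀ i, ∀ ξ ∈ C i, ∀ x ∈ U, gradient (fun z => Φ i z ξ) x = u i (x, ξ))
    (α β : Fin 3 → ℕ) : ∃ D : ℝ, 1 ≤ D ∧ ∀ i, ∀ x ∈ U, ∀ ξ ∈ C i,
      ‖mixedDerivGrad α β (Φ i) x ξ‖ ≤ D ^ N i := by
  have hO : ∀ i, IsOpen (U ×ˢ C i) := fun i => hU.prod (hC i)
  -- First the derivatives in `x`, on slices with `ξ` frozen, then those in `ξ`, on slices with `x`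
  -- frozen.
  obtain ⟨u', hu', he'⟩ := actsOnSlices_multiDeriv (κ := Σ i, C i) (dom := fun _ => U)
    (ind := fun t => t.1) (sl := fun t x => (x, (t.2 : E3))) (J := .inl ℝ E3 E3) hN hO
    (fun _ => hU) (fun t x => hasFDerivAt_prodMk_left x _) (fun t x hx => ⟨hx, t.2.2⟩) β u hu
  obtain ⟨u'', hu'', he''⟩ := actsOnSlices_multiDeriv (κ := ι × U) (dom := fun t => C t.1)
    (ind := fun t => t.1) (sl := fun t ξ => ((t.2 : E3), ξ)) (J := .inr ℝ E3 E3) hN hO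
    (fun t => hC t.1) (fun t x => hasFDerivAt_prodMk_right _ x) (fun t x hx => ⟨t.2.2, hx⟩) α u' hu'
  obtain ⟨-, D, hD, hb⟩ := ExpBounded.zero_iff.1 (hu'' 0)
  refine ⟨D, hD, fun i x hx ξ hξ => ?_⟩
  have h1 : mixedDerivGrad α β (Φ i) x ξ = u'' i (x, ξ) :=
    he'' (i, ⟨x, hx⟩) _ (fun ζ hζ => he' ⟨i, ζ, hζ⟩ _ (fun z hz => hgrad i ζ hζ z hz) hx) hξ
  rw [h1]
  exact hb i (x, ξ) ⟨hx, hξ⟩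

/-! ### Choice of the constants -/

theorem ObstacleChart.mono {Θ : Set E3} {a e : E3} {n : E3 → E3} {ε ε₁ c c' Ln Ln' : ℝ}
    (h : ObstacleChart Θ a e n ε ε₁ c Ln) (hε : 0 ≤ ε) (hc : c' ≤ c) (hL : Ln ≤ Ln') :
    ObstacleChart Θ a e n ε ε₁ c' Ln' :=
  { h with
    lip := fun x x' hx hx' => (h.lip x x' hx hx').trans
      (mul_le_mul_of_nonneg_right hL (norm_nonneg _))
    quad := fun X hX hXa => (mul_le_mul_of_nonneg_right hc (by positivity)).trans
      (h.quad X hX hXa)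
    linear := fun X hX hXa => (mul_le_mul_of_nonneg_right
      (mul_le_mul_of_nonneg_right hc hε) (norm_nonneg _)).trans (h.linear X hX hXa) }

theorem exists_pos_le_of_forall_pos (l : List ℝ) (h : ∀ x ∈ l, 0 < x) :
    ∃ t : ℝ, 0 < t ∧ ∀ x ∈ l, t ≤ x := by
  induction l with
  | nil => exact ⟨1, one_pos, by simp⟩
  | cons b l ih =>
    obtain ⟨t, ht, htl⟩ := ih fun x hx => h x (List.mem_cons_of_mem _ hx)
    refine ⟨min b t, lt_min (h b List.mem_cons_self) ht, fun x hx => ?_⟩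
    rcases List.mem_cons.1 hx with rfl | hx
    · exact min_le_left _ _
    · exact (min_le_right _ _).trans (htl x hx)

/-- The constants are chosen in the order `c, Ln`, then `ε₁`, `ε`, the tube sizes `R, ρ`, the
opening `η`, the push `s` and the prolongation `ρ'`. Each is small in terms of those before it, and
none depends on the story. -/
theorem exists_fits {Θ : Fin 2 → Set E3} (hΘ : ∀ i, IsObstacle (Θ i))
    (hdisj : Disjoint (Θ 0) (Θ 1)) {a : Fin 2 → E3} (ha : IsPeriodicRay Θ a) {δ₁ : ℝ}
    (hδ₁ : 0 < δ₁) (hδ₁' : δ₁ < 1) :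
    ∃ P n B l A r ρ s, TubeParams.Fits P Θ a n ∧ ReflectionMaps P Θ a n B l A ∧
      P.Prolongs r ρ s ∧ P.δ = δ₁ := by
  have hne : a 0 ≠ a 1 := by
    intro h
    have h1 : ‖axisDir a 1‖ = 1 := by simpa using (ha 1).1
    have h2 : a 1 - a (other 1) = 0 := sub_eq_zero.2 h.symm
    rw [axisDir, h2] at h1
    simp at h1
  set d := ‖a 1 - a 0‖ with hd
  have hd0 : 0 < d := norm_pos_iff.2 (sub_ne_zero.2 hne.symm)
  choose hne' hcomp hconv g hg hgΘ hgrad c₀ hc₀ hcurv using hΘ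
  choose c Ln hc hLn hchart using fun k => exists_obstacleChart (hg k) (hgΘ k) (hcomp k) (hconv k)
    (hgrad k) (hc₀ k) (hcurv k) (ha k)
  choose ε₂ hε₂ hmap using fun k => exists_reflectionMap (hg k) (hgΘ k) (hgrad k) (ha k)
    (sub_other_eq hne k) (-1) (d + 1)
  obtain ⟨c', hc', hcl⟩ := exists_pos_le_of_forall_pos [c 0, c 1] (by simp [hc])
  have hcl' : ∀ k, c' ≤ c k := Fin.forall_fin_two.2 ⟨hcl _ (by simp), hcl _ (by simp)⟩
  set Ln' := Ln 0 + Ln 1 with hLn'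
  have hLl : ∀ k, Ln k ≤ Ln' := Fin.forall_fin_two.2
    ⟨by linarith [hLn 1], by linarith [hLn 0]⟩
  have hLn0 : 0 ≤ Ln' := add_nonneg (hLn 0) (hLn 1)
  set Q := 3 * (28 / d) + 4 * Ln' with hQ
  have hQ0 : 0 < Q := by positivity
  obtain ⟨ε₁, hε₁, hε₁l⟩ := exists_pos_le_of_forall_pos
    [1 / 28, (1 - δ₁) / 2, ε₂ 0, ε₂ 1, 1 / (2 * (2 + 14 * (d + 3) * Q))] (by
      have : 0 < 1 - δ₁ := by linarith
      have h1 := hε₂ 0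
      have h2 := hε₂ 1
      simp only [List.forall_mem_cons]
      refine ⟨by norm_num, by positivity, h1, h2, by positivity, by simp⟩)
  simp only [List.forall_mem_cons] at hε₁l
  obtain ⟨e1, e2, e3, e4, e5, -⟩ := hε₁l
  choose ε₀ hε₀ hch using fun k => hchart k ε₁ hε₁ (by linarith)
  obtain ⟨ε, hε, hεl⟩ := exists_pos_le_of_forall_pos
    [1, d / 4, d * ε₁ / 4, ε₀ 0, ε₀ 1, ε₂ 0, ε₂ 1] (by
      simp only [List.forall_mem_cons]
      refine ⟨by norm_num, by positivity, by positivity, hε₀ 0, hε₀ 1, hε₂ 0, hε₂ 1, by simp⟩)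
  simp only [List.forall_mem_cons] at hεl
  obtain ⟨f1, f2, f3, f4, f5, f6, f7, -⟩ := hεl
  obtain ⟨R, hR, hRl⟩ := exists_pos_le_of_forall_pos [1, c' * ε * ε / 4] (by
      simp only [List.forall_mem_cons]
      refine ⟨by norm_num, by positivity, by simp⟩)
  simp only [List.forall_mem_cons] at hRl
  obtain ⟨g1, g2, -⟩ := hRl
  obtain ⟨ρ, hρ, hρl⟩ := exists_pos_le_of_forall_pos [1, ε / 4, c' * ε * ε / 4] (by
      simp only [List.forall_mem_cons]
      refine ⟨by norm_num, by positivity, by positivity, by simp⟩)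
  simp only [List.forall_mem_cons] at hρl
  obtain ⟨h1, h2, h3, -⟩ := hρl
  obtain ⟨η, hη, hηl⟩ := exists_pos_le_of_forall_pos
    [c' * R / 8, ε₁, c' * ε, c' * d * (c' * ε) / 4] (by
      simp only [List.forall_mem_cons]
      refine ⟨by positivity, hε₁, by positivity, by positivity, by simp⟩)
  simp only [List.forall_mem_cons] at hηl
  obtain ⟨k1, k2, k3, k4, -⟩ := hηl
  obtain ⟨s, hs, hsl⟩ := exists_pos_le_of_forall_pos [1 / 4, R / 2, ρ / 2, 1 / (12 * Q)] (by
      simp only [List.forall_mem_cons]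
      refine ⟨by norm_num, by positivity, by positivity, by positivity, by simp⟩)
  simp only [List.forall_mem_cons] at hsl
  obtain ⟨l1, l2, l3, l4, -⟩ := hsl
  obtain ⟨ρ', hρ', hρl'⟩ := exists_pos_le_of_forall_pos [ρ / 2, c' * (s / 4) ^ 2] (by
      simp only [List.forall_mem_cons]
      refine ⟨by positivity, by positivity, by simp⟩)
  simp only [List.forall_mem_cons] at hρl'
  obtain ⟨m1, m2, -⟩ := hρl'
  choose K B l hK hB hl hspec using fun k => hmap k ε ε₁
    ((Fin.forall_fin_two (p := fun k => ε ≤ ε₂ k)).2 ⟨f6, f7⟩ k)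
    ((Fin.forall_fin_two (p := fun k => ε₁ ≤ ε₂ k)).2 ⟨e3, e4⟩ k)
  choose D hD1 hD using fun k m => (hB k).exists_iteratedFDeriv_bound (hK k) m
  have hce : 0 < c' * ε * ε := by positivity
  have hnorm : ∀ k, ∀ X ∈ frontier (Θ k),
      IsOutwardUnitNormal (Θ k) X (unitNormal (g k) X) := fun k X hX =>
    isOutwardUnitNormal_unitNormal (hg k) (hgΘ k) (hconv k) (hgrad k) hX
  refine ⟨⟨ε, ε₁, c', Ln', R, ρ, η, d, δ₁⟩, fun k => unitNormal (g k), B, l,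
    fun m => m.factorial * (D 0 m + D 1 m), R / 2, ρ', s,
    ⟨fun k => ?_, hdisj, hne, hd, hε, f1, by linarith, by linarith, e1, hδ₁,
      by change δ₁ ≤ 1 - 2 * ε₁; linarith, hc', hLn0, hR, g1,
      hρ, h1, h2, by change 2 * ρ + R < c' * ε * ε; linarith, hη,
      by change 4 * η < c' * R; nlinarith [mul_pos hc' hR], k2, k3,
      by change 4 * η ≤ c' * d * (c' * ε); linarith, ?_⟩,
    ⟨hB, hl, fun m => ?_, fun k X hX hXa p hp t ht m i him => ?_, fun k X hX hXa p hp t ht => ?_,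
      fun k X hX hXa p hp t ht => ?_⟩,
    ⟨by linarith, hρ', hs, ?_, by change R / 2 + s ≤ R; linarith, by change ρ' + s ≤ ρ; linarith,
      l1, m2, by change ρ' < c' * ε * ε; linarith⟩, rfl⟩
  · exact (hch k ε hε ((Fin.forall_fin_two (p := fun k => ε ≤ ε₀ k)).2 ⟨f4, f5⟩ k)).mono hε.le
      (hcl' k) (hLl k)
  · change 2 * ε₁ + 2 * (d + 3) * (7 * ε₁) * Q ≤ 1 / 2
    rw [le_div_iff₀ (by positivity)] at e5
    linarith
  · have : (1 : ℝ) ≤ m.factorial := by exact_mod_cast m.factorial_pos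
    nlinarith [hD1 0 m, hD1 1 m]
  · refine mul_le_mul_of_nonneg_left ?_ (Nat.cast_nonneg _)
    refine (hD k m i him _ (hspec k X hX hXa p hp t ht).1).trans ?_
    have e : ∀ k, D k m ≤ D 0 m + D 1 m := Fin.forall_fin_two.2
      ⟨by linarith [hD1 1 m], by linarith [hD1 0 m]⟩
    exact e k
  · rw [axisDir_other]
    exact (hspec k X hX hXa p hp t ht).2.1
  · rw [axisDir_other]
    exact (hspec k X hX hXa p hp t ht).2.2
  · change s * (6 * Q) ≤ 1 / 2
    rw [le_div_iff₀ (by positivity)] at l4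
    linarith

/-! ### Conclusion -/

theorem RayChart.mono {U C C' : Set E3} {Φ : E3 → E3 → ℝ} {w : E3 × E3 → E3}
    {Ψ : E3 × E3 → E3 × E3} {L : E3 × E3 → ℝ} {K : ℝ} {A : ℕ → ℝ}
    (h : RayChart U C Φ w Ψ L K A) (hC : C' ⊆ C) : RayChart U C' Φ w Ψ L K A where
  smooth_map := h.smooth_map
  smooth_length := h.smooth_length
  cont := h.cont.mono (Set.prod_mono_right hC)
  lip ξ hξ := h.lip ξ (hC hξ)
  fst_eq ξ hξ := h.fst_eq ξ (hC hξ)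
  length_eq ξ hξ := h.length_eq ξ (hC hξ)
  grad ξ hξ := h.grad ξ (hC hξ)
  norm_eq ξ hξ := h.norm_eq ξ (hC hξ)
  bound ξ hξ := h.bound ξ (hC hξ)

theorem RayChart.realisesPhaseOn {Θ : Fin 2 → Set E3} {δ : ℝ} {y : E3} {J : List (Fin 2)}
    {k : Fin 2} {U C : Set E3} {Φ : E3 → E3 → ℝ} {w : E3 × E3 → E3}
    {Ψ : E3 × E3 → E3 × E3} {L : E3 × E3 → ℝ} {K : ℝ} {A : ℕ → ℝ}
    (h : RayChart U C Φ w Ψ L K A) (hU : IsOpen U) (hC : IsOpen C) (hC0 : ∀ ξ ∈ C, ξ ≠ 0)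
    (hrefl : ∀ ξ ∈ C, IsReflectionOf (Θ k) δ (storyPhase Θ δ y ξ J.dropLast)
      (storyPhase Θ δ y ξ J))
    (hdom : ∀ ξ ∈ C, ∀ x ∈ U \ interior (Θ k),
      x ∈ (storyPhase Θ δ y ξ J).dom ∧ Φ x ξ = (storyPhase Θ δ y ξ J).toFun x) :
    RealisesPhaseOn Θ δ y J k U C Φ :=
  ⟨hrefl, hdom, h.contDiffOn_phase hU hC hC0, fun ξ hξ x hx => by
    rw [(h.grad ξ hξ x hx).gradient]; exact h.norm_eq ξ hξ x hx⟩

theorem exists_openCylinder_subset_closedBall {a : Fin 2 → E3} (ha : a 0 ≠ a 1) (r ρ : ℝ) :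
    ∃ R, openCylinder a r ρ ⊆ Metric.closedBall 0 R := by
  refine ⟨‖a 0‖ + (r + (‖a 1 - a 0‖ + |ρ|)), fun x hx => ?_⟩
  obtain ⟨h1, h2, h3⟩ := (mem_openCylinder_iff ha 0).1 hx
  have h4 := norm_le_perp_add (norm_axisDir ha 0) (x - a 0)
  have h5 : |inner ℝ (axisDir a 0) (x - a 0)| ≤ ‖a 1 - a 0‖ + |ρ| := by
    rw [abs_le]
    constructor <;> linarith [le_abs_self ρ, norm_nonneg (a 1 - a 0)]
  have h6 := norm_add_le (a 0) (x - a 0)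
  rw [add_sub_cancel] at h6
  rw [Metric.mem_closedBall, dist_zero_right]
  linarith

theorem proposition4p10 (Θ : Fin 2 → Set E3) (hΘ : ∀ i, IsObstacle (Θ i))
    (hdisj : Disjoint (Θ 0) (Θ 1)) (a : Fin 2 → E3) (ha : IsPeriodicRay Θ a)
    (δ₁ : ℝ) (hδ₁ : 0 < δ₁) (hδ₁' : δ₁ < 1) :
    ∃ r ρ η : ℝ, 0 < r ∧ 0 < ρ ∧ 0 < η ∧
      ∃ Φ : List (Fin 2) → E3 → E3 → E3 → ℝ,
        (∀ (j k : Fin 2) (J : List (Fin 2)) (y : E3), IsStory j k J →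
          RealisesPhaseOn Θ δ₁ y J k (openCylinder a r ρ) (directionCone (axisDir a j) η)
            (Φ J y)) ∧
        ∀ α₀ β₀ : ℝ, 0 < α₀ → α₀ ≤ β₀ → ∀ α β : Fin 3 → ℕ, ∃ D : ℝ, 0 < D ∧
          ∀ (j k : Fin 2) (J : List (Fin 2)) (y : E3), IsStory j k J →
            ∀ x ∈ openCylinder a r ρ, ∀ ξ ∈ directionCone (axisDir a j) η,
              α₀ ≤ ‖ξ‖ → ‖ξ‖ ≤ β₀ →
                ‖mixedDerivGrad α β (Φ J y) x ξ‖ ≤ D ^ J.length := by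
  obtain ⟨P, n, B, l, A, r, ρ, s, hP, hB, hr, rfl⟩ := exists_fits hΘ hdisj ha hδ₁ hδ₁'
  have hA := hB.one_le
  have hU := isOpen_openCylinder a r ρ
  have key : ∀ (J : List (Fin 2)) (y : E3), ∃ Φ w Ψ L, ∀ j k, IsStory j k J →
      RayChart (openCylinder a r ρ) (directionCone (axisDir a j) P.η) Φ w Ψ L (48 ^ J.length)
        (fun m => A m ^ (J.length + 1)) ∧
      (∀ ξ ∈ directionCone (axisDir a j) P.η, IsReflectionOf (Θ k) P.δ
        (storyPhase Θ P.δ y ξ J.dropLast) (storyPhase Θ P.δ y ξ J)) ∧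
      ∀ ξ ∈ directionCone (axisDir a j) P.η, ∀ x ∈ openCylinder a r ρ \ interior (Θ k),
        x ∈ (storyPhase Θ P.δ y ξ J).dom ∧ Φ x ξ = (storyPhase Θ P.δ y ξ J).toFun x := by
    intro J y
    by_cases hJ : ∃ j k, IsStory j k J
    · obtain ⟨j, k, hJ⟩ := hJ
      obtain ⟨J', rfl, hreach⟩ := hJ.exists_reaches
      obtain ⟨p, foot, Ψ, L, hst⟩ := hreach.exists_storyRays hP hB y
      obtain ⟨Φ, w, Ψ', L', hchart, hdom⟩ := hst.exists_rayChart hP hB hr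
      refine ⟨Φ, w, Ψ', L', fun j' k' hJ' => ?_⟩
      -- The list determines its first and last entries, so one function `Φ J y` serves all
      -- admissible `j` and `k`.
      obtain rfl : j' = j := Option.some.inj (hJ'.1.symm.trans hJ.1)
      obtain rfl : k' = k := Option.some.inj (hJ'.2.1.symm.trans hJ.2.1)
      refine ⟨by simpa only [List.length_append, List.length_singleton] using hchart,
        fun ξ hξ => ?_, hdom⟩
      rw [List.dropLast_concat, storyPhase_append]
      exact (hst.value ξ hξ).isReflectionOf hP.δ_pos (hP.chart k').isCompact
    · exact ⟨fun _ _ => 0, fun _ => 0, id, fun _ => 0, fun j k h => absurd ⟨j, k, h⟩ hJ⟩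
  choose Φ w Ψ L h using key
  refine ⟨r, ρ, P.η, hr.r_pos, hr.ρ_pos, hP.η_pos, Φ, fun j k J y hJ => ?_,
    fun α₀ β₀ hα₀ hβ₀ α β => ?_⟩
  · obtain ⟨h1, h2, h3⟩ := h J y j k hJ
    exact h1.realisesPhaseOn hU (isOpen_directionCone _ _) (fun ξ hξ => hξ.1) h2 h3
  · obtain ⟨R, hR⟩ := exists_openCylinder_subset_closedBall hP.ne r ρ
    let ι := {t : Fin 2 × Fin 2 × List (Fin 2) × E3 // IsStory t.1 t.2.1 t.2.2.1}
    let N : ι → ℕ := fun t => t.1.2.2.1.length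
    -- An open set of parameters containing those with `α₀ ≤ ‖ξ‖ ≤ β₀`, still bounded and away from
    -- `0`, so that the derivatives of `ξ / |ξ|` are bounded on it. The index includes `y`, which
    -- makes the bounds uniform in `y`.
    let C : ι → Set E3 := fun t => directionCone (axisDir a t.1.1) P.η ∩
      {ξ | α₀ / 2 < ‖ξ‖ ∧ ‖ξ‖ < 2 * β₀}
    have hN : ∀ t, 1 ≤ N t := by
      rintro ⟨⟨j, k, J, y⟩, hJ⟩
      rcases J with _ | ⟨i, J⟩
      · simp [IsStory] at hJ
      · simp [N]
    have hC : ∀ t, IsOpen (C t) := fun t => (isOpen_directionCone _ _).inter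
      ((isOpen_lt continuous_const continuous_norm).and
        (isOpen_lt continuous_norm continuous_const))
    have hchart : ∀ t : ι, RayChart (openCylinder a r ρ) (C t) (Φ t.1.2.2.1 t.1.2.2.2)
        (w t.1.2.2.1 t.1.2.2.2) (Ψ t.1.2.2.1 t.1.2.2.2) (L t.1.2.2.1 t.1.2.2.2) (48 ^ N t)
        (fun m => A m ^ (N t + 1)) := fun t =>
      (h t.1.2.2.1 t.1.2.2.2 t.1.1 t.1.2.1 t.2).1.mono Set.inter_subset_left
    obtain ⟨D, hD, hb⟩ := exists_mixedDerivGrad_bound hN hU hC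
      (RayChart.expBounded_snd hN hA hchart hU hC (half_pos hα₀) hR
        (fun t ξ hξ => ⟨hξ.2.1.le, hξ.2.2.le⟩))
      (fun t ξ hξ x hx => ((hchart t).grad ξ hξ x hx).gradient) α β
    refine ⟨D, by linarith, fun j k J y hJ x hx ξ hξ h1 h2 => ?_⟩
    exact hb ⟨(j, k, J, y), hJ⟩ x hx ξ ⟨hξ, by linarith, by linarith⟩
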